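/- **Setting.** Let $f=f(w,v):\mathbb R^2\to\mathbb R$ be $C^3$ with all partial derivatives of order $\le 3$ bounded, and let $\varepsilon>0$. Let $w_0,v_0:\mathbb R\to\varepsilon\mathbb Z$ be right continuous, piecewise constant with finitely many jumps, of bounded variation and compactly supported, and assume $\partial_w f(w,v)>-1$ for all $w$ in the convex hull of $w_0(\mathbb R)$ and $v\in v_0(\mathbb R)$. For a function $g$ of $w$ let $g_\varepsilon$ be its piecewise affine interpolation at the points of $\varepsilon\mathbb Z$. Let $(w,v)$ be the wavefront tracking solution of $w_t+\partial_wf(w,v)\,w_x=0$, $v_t-v_x=0$ with datum $(w_0,v_0)$, where $v(t,x)=v_0(x+t)$ and each Riemann problem for $w$ with states $(w^-,w^+)$ at a point where $v$ has right state $v^+$ is solved by the entropy solution of the scalar Riemann problem with flux $f_\varepsilon(\cdot,v^+)$. Jumps of $v$ (resp. $w$) are the wavefronts of the first (resp. second) family. Suppose that the points in $t>0$ where wavefronts collide are $(t_j,x_j)$, $1\le j\le J$, with $0=:t_0<t_1<\dots<t_J$, and that exactly two wavefronts meet at each of them. The point $(t_j,x_j)$ is a *transversal interaction point* if one of the two is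 of the first family and the other of the second; then $|v_{h(j)}|=|v(t_j,x_j)-v(t_j,x_j-)|$ is the strength of the one of the first family. **Waves.** The waves are $s\in\mathcal W=\{1,\dots,\varepsilon^{-1}\mathrm{Tot.Var.}(w_0)\}$, each of strength $|s|=\varepsilon$; a set $\mathcal I$ of waves has strength $|\mathcal I|=\varepsilon\,\#\mathcal I$. With $V(x)=\mathrm{Tot.Var.}(w_0;(-\infty,x])$ the initial position is $x(0,s)=\inf\{x:\varepsilon s\le V(x)\}$, the sign is $\mathcal S(s)=\operatorname{sign}[w_0(x(0,s))-w_0(x(0,s)-)]$ and the right state is $\hat w(s)=w_0(x(0,s)-)+\mathcal S(s)[\varepsilon s-V(x(0,s)-)]$. The cell of $s$ is $(\hat w(s)-\varepsilon,\hat w(s)]$ if $\mathcal S(s)=1$ and $[\hat w(s),\hat w(s)+\varepsilon)$ if $\mathcal S(s)=-1$. For an interval $\mathcal I$ of positive (negative) waves with union of cells $I$, the Riemann problem $\mathcal I$ with flux $g$ gives to $s\in\mathcal I$ the slope on its cell of the convex (concave) envelope of $g_\varepsilon$ in $\bar I$; it *divides* two waves if it gives them different speeds. The speed $\sigma(t_j,s)$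 is the one given to $s$ by the Riemann problem consisting of all waves at the position $x(t_j,s)$, with flux $f(\cdot,v(t_j,x(t_j,s)))$. The position $x(t,s)$ moves with speed $\sigma(t_j,s)$ in $[t_j,t_{j+1}]$, except that a wave reaching $(t_{j+1},x_{j+1})$ is cancelled, i.e. $x(t,s)=+\infty$ for $t\ge t_{j+1}$, unless $\mathcal S(s)w(t_{j+1},x_{j+1}-)\le\mathcal S(s)\hat w(s)-\varepsilon$ and $\mathcal S(s)\hat w(s)\le\mathcal S(s)w(t_{j+1},x_{j+1})$. Let $\mathcal W(t)$ be the set of waves not cancelled at time $t$, and $\mathcal W(t,x)$ the set of those at position $x$. On each maximal interval of waves of $\mathcal W(t_j)$ with constant sign, let $\mathtt f_{t_j}$ be a $C^{1,1}$ function with $\mathtt f_{t_j}''=\partial^2_{ww}f(\cdot,v(t_j,x(t_j,s)))$ a.e. on the cell of each of its waves $s$ (unique up to affine functions). **The functional.** Let $s<s'$ be in $\mathcal W(t_j)$. They *have already interacted* if $x(t,s)=x(t,s')$ for some $t\in[0,t_j]$. They are *joined* at $t_j$ if they have the same position and speed; pairs that have already interacted and are not joined are *divided*. For a divided pair let $T$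 be the last time $t\le t_j$ with $x(t,s)=x(t,s')$ and $\mathcal I(t_j,s,s')=\mathcal W(T,x(T,s))\cap\mathcal W(t_j)$. Its partition $\mathcal P(t_j,s,s')$ is defined recursively: if $T=t_j$, its classes are the classes of joined waves; if $T<t_j$, $p,p'$ are equivalent iff they belong to the same $\mathcal J\in\mathcal P(t_{j-1},s,s')$ and the Riemann problem $\mathcal J\cap\mathcal W(t_j)$ with flux $\mathtt f_{t_j}$ does not divide them. For $p<p'$ in $\mathcal I(t_j,s,s')$ put $\pi(t_j,s,s')[p,p']=0$ if $j=0$ or $s,s'$ are joined at $t_{j-1}$. If they are divided at $t_{j-1}$, put $\pi(t_j,s,s')[p,p']=\pi(t_{j-1},s,s')[p,p']$ if $(t_j,x_j)$ is not a transversal interaction point, and otherwise $$\pi(t_j,s,s')[p,p']=\pi(t_{j-1},s,s')[p,p']+2\|D^3_{wwv}f\|_{L^\infty}|v_{h(j)}|\sum|\mathcal J|,$$ where the sum is over the $\mathcal J\in\mathcal P(t_{j-1},s,s')$ with $\mathcal J\subseteq\mathcal W(t_j,x_j)$ lying (weakly, in the order of classes) between the class of $p$ and the class of $p'$. Set $$\mathfrak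 q(t_j,s,s')=\begin{cases}0,& s,s'\text{ joined at }t_j,\\ \dfrac{\pi(t_j,s,s')[s,s']}{|\hat w(s')-(\hat w(s)-\mathcal S(s)\varepsilon)|},& s,s'\text{ divided at }t_j,\\ \|D^2_{ww}f\|_{L^\infty},& s,s'\text{ have never interacted up to }t_j,\end{cases}\qquad \mathfrak Q(t_j)=\sum_{s<s',\ s,s'\in\mathcal W(t_j)}\mathfrak q(t_j,s,s')\,|s||s'|.$$ **Theorem.** For every $j$ such that $(t_j,x_j)$ is a transversal interaction point, $$\mathfrak Q(t_j)-\mathfrak Q(t_{j-1})\le 6\log(2)\,\|D^3_{wwv}f\|_{L^\infty}\,|v_{h(j)}|\,|\mathcal W(t_j,x_j)|\,\mathrm{Tot.Var.}(w_0),$$ and, summing over all transversal interaction points, $$\sum_{j\text{ transversal}}\big[\mathfrak Q(t_j)-\mathfrak Q(t_{j-1})\big]\le 6\log(2)\,\|D^3_{wwv}f\|_{L^\infty}\,\mathrm{Tot.Var.}(w_0)^2\,\mathrm{Tot.Var.}(v_0).$$ -/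

import Mathlib

open Set

noncomputable section

namespace Wavefront

/-! ### Convex envelopes, grid interpolation and the scalar Riemann solver -/

/-- Convex envelope of `g` in `[a, b]`: the supremum of the convex functions on `[a, b]` that lie
below `g` there. -/
def convEnv (a b : ℝ) (g : ℝ → ℝ) (u : ℝ) : ℝ :=
  sSup {y | ∃ φ : ℝ → ℝ, ConvexOn ℝ (Icc a b) φ ∧ (∀ z ∈ Icc a b, φ z ≤ g z) ∧ y = φ u}

/-- Concave envelope of `g` in `[a, b]`: the infimum of the concave functions on `[a, b]` that lie
above `g` there. -/
def concEnv (a b : ℝ) (g : ℝ → ℝ) (u : ℝ) : ℝ :=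
  sInf {y | ∃ φ : ℝ → ℝ, ConcaveOn ℝ (Icc a b) φ ∧ (∀ z ∈ Icc a b, g z ≤ φ z) ∧ y = φ u}

/-- Piecewise affine interpolation of `g` with grid size `ε`: it is affine on every
`[m ε, (m + 1) ε]`, `m : ℤ`, and coincides with `g` at the grid points. -/
def gridInterp (ε : ℝ) (g : ℝ → ℝ) (u : ℝ) : ℝ :=
  g (⌊u / ε⌋ * ε) + Int.fract (u / ε) * (g ((⌊u / ε⌋ + 1) * ε) - g (⌊u / ε⌋ * ε))

/-- The right continuous self-similar entropy solution, at `ξ = x / t`, of the scalar Riemann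
problem `(uL, uR)`, `uL, uR ∈ ℤ ε`, with flux the grid interpolation of `g`. The derivative of the
envelope of the flux is constant on every grid cell (we read it at the midpoint) and increases along
the jump from `uL` to `uR`; a cell travels with that speed, so the state at `ξ` is obtained
from `uL` by adding (`uL ≤ uR`) or subtracting (`uR < uL`) the cells with speed at most `ξ`. -/
def riemannSolver (ε : ℝ) (g : ℝ → ℝ) (uL uR ξ : ℝ) : ℝ :=
  open Classical in
  if uL ≤ uR then
    uL + ε * ({m : ℤ | uL ≤ m * ε ∧ (m + 1) * ε ≤ uR ∧
      deriv (convEnv uL uR (gridInterp ε g)) ((m + 1 / 2) * ε) ≤ ξ}.ncard : ℝ)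
  else
    uL - ε * ({m : ℤ | uR ≤ m * ε ∧ (m + 1) * ε ≤ uL ∧
      deriv (concEnv uR uL (gridInterp ε g)) ((m + 1 / 2) * ε) ≤ ξ}.ncard : ℝ)

/-! ### Initial data and norms -/

/-- Compactly supported, right continuous, piecewise constant functions of bounded variation with
values in `ℤ ε`. -/
structure IsGridStep (ε : ℝ) (g : ℝ → ℝ) : Prop where
  compact_support : HasCompactSupport g
  bounded_variation : BoundedVariationOn g univ
  right_continuous : ∀ x, ContinuousWithinAt g (Ici x) x
  grid_valued : ∀ x, ∃ m : ℤ, g x = m * ε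
  finite_jumps : {x | ¬ ContinuousAt g x}.Finite

/-- Total variation on the real line. -/
def totVar (g : ℝ → ℝ) : ℝ := (eVariationOn g univ).toReal

/-- `∂f/∂w`. -/
def dw (f : ℝ → ℝ → ℝ) (w v : ℝ) : ℝ := deriv (fun w' => f w' v) w

/-- `∂²f/∂w²`. -/
def dww (f : ℝ → ℝ → ℝ) (w v : ℝ) : ℝ := deriv (fun w' => dw f w' v) w

/-- `∂³f/∂w²∂v`. -/
def dwwv (f : ℝ → ℝ → ℝ) (w v : ℝ) : ℝ := deriv (fun v' => dww f w v') v

/-- Supremum norm on the plane (the `L^∞` norm, for continuous functions). -/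
def supNorm (g : ℝ → ℝ → ℝ) : ℝ := ⨆ p : ℝ × ℝ, |g p.1 p.2|

/-- `f` is `C³` with all its partial derivatives of order at most three bounded on the plane. -/
structure IsAdmissibleFlux (f : ℝ → ℝ → ℝ) : Prop where
  contDiff : ContDiff ℝ 3 (fun p : ℝ × ℝ => f p.1 p.2)
  bounded : ∃ C : ℝ, ∀ k : ℕ, k ≤ 3 → ∀ p : ℝ × ℝ,
    ‖iteratedFDeriv ℝ k (fun p : ℝ × ℝ => f p.1 p.2) p‖ ≤ C

/-! ### The wavefront tracking solution -/

/-- The data: grid size, flux, initial datum `(w₀, v₀)`, and the number `J`, the times `time j` and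
the points `point j`, `1 ≤ j ≤ J`, of the collisions. That the latter really are the collisions
of the solution is required in `IsCollisionSequence` below. -/
structure Data where
  ε : ℝ
  f : ℝ → ℝ → ℝ
  w₀ : ℝ → ℝ
  v₀ : ℝ → ℝ
  J : ℕ
  time : ℕ → ℝ
  point : ℕ → ℝ

namespace Data

variable (D : Data)

/-- Second component of the solution, which solves `v_t - v_x = 0`. -/
def v (t x : ℝ) : ℝ := D.v₀ (x + t)

/-- The centred fan, as a function of the slope `ξ`, that the Riemann solver puts at the point `a`
at time `time j` when the first component at that time is `g`. The flux is `f(·, v⁺)`, where `v⁺`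
is the right state of `v` at the point. -/
def fan (j : ℕ) (g : ℝ → ℝ) (a ξ : ℝ) : ℝ :=
  riemannSolver D.ε (fun w => D.f w (D.v (D.time j) a)) (Function.leftLim g a) (g a) ξ

/-- First component of the solution at the time `time j`, obtained from the initial datum by solving
all Riemann problems at `time j` and letting the resulting fronts travel up to `time (j + 1)`.
Points `a` at which the first component is continuous contribute zero to the sum. -/
def w : ℕ → ℝ → ℝ
  | 0 => D.w₀
  | j + 1 => fun x => ∑ᶠ a : ℝ,
      (D.fan j (w j) a ((x - a) / (D.time (j + 1) - D.time j)) - Function.leftLim (w j) a)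

/-- Wavefronts after a collision time: of the first family, identified by the initial position
`y`; of the second family, identified by the position `a` at that time and the speed `c`. -/
inductive Front where
  | first (y : ℝ) : Front
  | second (a c : ℝ) : Front

/-- Position, at the time `τ`, of a wavefront present just after `time j`. -/
def Front.pos (D : Data) (j : ℕ) (τ : ℝ) : Front → ℝ
  | .first y => y - τ
  | .second a c => a + c * (τ - D.time j)

/-- The wavefronts present just after `time j`: the jumps of `v`, and the jumps of the fans of the
first component. -/
def fronts (j : ℕ) : Set Front :=
  {F | match F with
    | .first y => ¬ ContinuousAt D.v₀ y
    | .second a c => ¬ ContinuousAt (D.fan j (D.w j) a) c}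

/-- Two distinct wavefronts present after `time j` would meet in `(τ, ξ)`, if they travelled freely
until `τ`. -/
def Collide (j : ℕ) (τ ξ : ℝ) : Prop :=
  ∃ F ∈ D.fronts j, ∃ G ∈ D.fronts j, F ≠ G ∧ F.pos D j τ = ξ ∧ G.pos D j τ = ξ

/-- `(time j, point j)`, `1 ≤ j ≤ J`, are exactly the points of the half plane `t > 0` where
wavefronts collide; they are ordered by strictly increasing times, starting from
`time 0 = 0`, and exactly two wavefronts meet in each of them. -/
structure IsCollisionSequence : Prop where
  time_zero : D.time 0 = 0
  time_lt : ∀ j < D.J, D.time j < D.time (j + 1)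
  first_collision : ∀ j < D.J, ∀ τ ξ : ℝ, D.time j < τ → τ ≤ D.time (j + 1) →
    (D.Collide j τ ξ ↔ τ = D.time (j + 1) ∧ ξ = D.point (j + 1))
  binary : ∀ j < D.J,
    {F ∈ D.fronts j | F.pos D j (D.time (j + 1)) = D.point (j + 1)}.ncard = 2
  no_more : ∀ τ ξ : ℝ, D.time D.J < τ → ¬ D.Collide D.J τ ξ

/-- `(time j, point j)` is a transversal interaction point: one of the colliding wavefronts is of
the first family and the other one of the second family. -/
def IsTransversal : ℕ → Prop
  | 0 => False
  | j + 1 => (∃ y, Front.first y ∈ D.fronts j ∧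
        (Front.first y).pos D j (D.time (j + 1)) = D.point (j + 1)) ∧
      ∃ a c, Front.second a c ∈ D.fronts j ∧
        (Front.second a c).pos D j (D.time (j + 1)) = D.point (j + 1)

open Classical in
/-- The indices `1 ≤ j ≤ J` of the transversal interaction points. -/
def transversalIndices : Finset ℕ := (Finset.Icc 1 D.J).filter D.IsTransversal

/-- Strength of the wavefront of the first family that passes through `(time j, point j)`. -/
def firstStrength (j : ℕ) : ℝ :=
  |D.v₀ (D.point j + D.time j) - Function.leftLim D.v₀ (D.point j + D.time j)|

/-! ### Waves of the second family -/

/-- The waves `1, …, Tot.Var.(w₀) / ε` (the quotient is an integer). -/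
def waves : Finset ℕ := Finset.Icc 1 ⌊totVar D.w₀ / D.ε⌋₊

/-- Total variation of `w₀` on `(-∞, x]`. -/
def varTo (x : ℝ) : ℝ := (eVariationOn D.w₀ (Iic x)).toReal

/-- Initial position of a wave. -/
def pos₀ (s : ℕ) : ℝ := sInf {x | D.ε * s ≤ D.varTo x}

/-- Sign of a wave. -/
def sgn (s : ℕ) : ℝ := Real.sign (D.w₀ (D.pos₀ s) - Function.leftLim D.w₀ (D.pos₀ s))

/-- Right state of a wave. -/
def hatw (s : ℕ) : ℝ :=
  Function.leftLim D.w₀ (D.pos₀ s) +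
    D.sgn s * (D.ε * s - Function.leftLim D.varTo (D.pos₀ s))

open Classical in
/-- The cell of a wave: `(ŵ - ε, ŵ]` for a positive wave, `[ŵ, ŵ + ε)` for a negative one. -/
def cell (s : ℕ) : Set ℝ :=
  if 0 < D.sgn s then Ioc (D.hatw s - D.ε) (D.hatw s) else Ico (D.hatw s) (D.hatw s + D.ε)

/-- The set of states spanned by a set of waves. -/
def span (I : Finset ℕ) : Set ℝ := ⋃ s ∈ I, D.cell s

open Classical in
/-- Entropic speed given to the wave `s` by the Riemann problem `I ∋ s` (an interval of waves of the
same sign) with the flux `g`: the constant derivative, on the cell of `s`, of the convex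
(`s` positive) or concave (`s` negative) envelope of the interpolated flux. -/
def entSpeed (g : ℝ → ℝ) (I : Finset ℕ) (s : ℕ) : ℝ :=
  if 0 < D.sgn s then
    deriv (convEnv (sInf (D.span I)) (sSup (D.span I)) (gridInterp D.ε g)) (D.hatw s - D.ε / 2)
  else
    deriv (concEnv (sInf (D.span I)) (sSup (D.span I)) (gridInterp D.ε g)) (D.hatw s + D.ε / 2)

open Classical in
/-- Speed of the wave `s` after `time j`, when the positions of the waves at `time j` are given by
`X`. -/
def speedOf (j : ℕ) (X : ℕ → WithTop ℝ) (s : ℕ) : ℝ :=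
  D.entSpeed (fun w => D.f w (D.v (D.time j) ((X s).untopD 0)))
    (D.waves.filter fun p => X p = X s) s

/-- The wave `s` survives at the collision point `(time j, point j)`. -/
def Survives (j : ℕ) (s : ℕ) : Prop :=
  D.sgn s * Function.leftLim (D.w j) (D.point j) ≤ D.sgn s * D.hatw s - D.ε ∧
    D.sgn s * D.hatw s ≤ D.sgn s * D.w j (D.point j)

open Classical in
/-- Position of the waves at `time j`; `⊤` is the position of the waves already cancelled. -/
def node : ℕ → ℕ → WithTop ℝ
  | 0 => fun s => (D.pos₀ s : WithTop ℝ)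
  | j + 1 => fun s =>
      let free : WithTop ℝ :=
        (node j s).map fun a => a + D.speedOf j (node j) s * (D.time (j + 1) - D.time j)
      if free = (D.point (j + 1) : WithTop ℝ) ∧ ¬ D.Survives (j + 1) s then ⊤ else free

/-- Speed `σ(time j, s)` of the wave `s`. -/
def speed (j : ℕ) (s : ℕ) : ℝ := D.speedOf j (D.node j) s

open Classical in
/-- The index `j ≤ J` such that `t ∈ [time j, time (j + 1))`, or `t ∈ [time J, ∞)`. -/
def index (t : ℝ) : ℕ := Nat.findGreatest (fun j => D.time j ≤ t) D.J

/-- Position `x(t, s)` of the wave `s` at any time `t ≥ 0`. -/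
def pos (t : ℝ) (s : ℕ) : WithTop ℝ :=
  (D.node (D.index t) s).map fun a =>
    a + D.speed (D.index t) s * (t - D.time (D.index t))

open Classical in
/-- The real (not cancelled) waves at `time j`. -/
def live (j : ℕ) : Finset ℕ := D.waves.filter fun s => D.node j s ≠ ⊤

open Classical in
/-- The waves that pass through the collision point `(time j, point j)`. -/
def wavesAtPoint (j : ℕ) : Finset ℕ :=
  D.waves.filter fun s => D.node j s = (D.point j : WithTop ℝ)

/-- Strength of a set of waves. -/
def size (I : Finset ℕ) : ℝ := D.ε * (I.card : ℝ)

/-! ### The effective flux -/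

open Classical in
/-- The maximal homogeneous interval of waves at `time j` that contains `p`. -/
def maxHom (j p : ℕ) : Finset ℕ :=
  (D.live j).filter fun q => ∀ r ∈ D.live j, r ∈ uIcc p q → D.sgn r = D.sgn p

/-- The effective flux at `time j` on a maximal homogeneous interval of waves `I`: a `C^{1,1}`
function whose second derivative on the cell of a wave `s ∈ I` is `∂²f/∂w² (·, v)`, with
`v` taken at the position of `s`. This determines it up to affine functions, which do not change
whether a Riemann problem divides two waves; the normalization chosen here is that the
function and its derivative vanish at `0`. -/
def effFlux (j : ℕ) (I : Finset ℕ) (u : ℝ) : ℝ :=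
  ∫ y in (0 : ℝ)..u, ∫ z in (0 : ℝ)..y,
    ∑ s ∈ I, (D.cell s).indicator
      (fun z => dww D.f z (D.v (D.time j) ((D.node j s).untopD 0))) z

/-- The Riemann problem `K` with the effective flux at `time j` divides the waves `p, q ∈ K`. -/
def Divides (j : ℕ) (K : Finset ℕ) (p q : ℕ) : Prop :=
  D.entSpeed (D.effFlux j (D.maxHom j p)) K p ≠ D.entSpeed (D.effFlux j (D.maxHom j p)) K q

/-! ### Pairs of waves and their common history -/

/-- `s, s'` have already interacted at `time j`. -/
def Interacted (j s s' : ℕ) : Prop :=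
  ∃ τ, 0 ≤ τ ∧ τ ≤ D.time j ∧ D.pos τ s = D.pos τ s'

/-- `s, s'` are joined in the real solution at `time j`, i.e. not divided: they have the same
position and the same speed. -/
def Joined (j s s' : ℕ) : Prop :=
  D.node j s = D.node j s' ∧ D.speed j s = D.speed j s'

/-- Time of last interaction of `s, s'` before `time j`. -/
def lastTime (j s s' : ℕ) : ℝ :=
  sSup {τ | 0 ≤ τ ∧ τ ≤ D.time j ∧ D.pos τ s = D.pos τ s'}

open Classical in
/-- The interval of waves `𝓘(time j, s, s')`: the waves still present at `time j` that had, at the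
time of last interaction of `s, s'`, the same position as these. -/
def hist (j s s' : ℕ) : Finset ℕ :=
  (D.live j).filter fun p => D.pos (D.lastTime j s s') p = D.pos (D.lastTime j s s') s

open Classical in
/-- The class of `p` in the partition `𝓟(time j, s, s')` of `𝓘(time j, s, s')`. -/
def part : (j s s' p : ℕ) → Finset ℕ
  | 0, s, s', p => (D.hist 0 s s').filter fun q => p ∈ D.hist 0 s s' ∧ D.Joined 0 p q
  | j + 1, s, s', p =>
      if D.lastTime (j + 1) s s' = D.time (j + 1) then
        (D.hist (j + 1) s s').filter fun q =>
          p ∈ D.hist (j + 1) s s' ∧ D.Joined (j + 1) p q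
      else
        (part j s s' p ∩ D.live (j + 1)).filter fun q =>
          p ∈ part j s s' p ∩ D.live (j + 1) ∧
            ¬ D.Divides (j + 1) (part j s s' p ∩ D.live (j + 1)) p q

/-- Order on intervals of waves. -/
def Precedes (K L : Finset ℕ) : Prop := (∀ p ∈ K, ∀ q ∈ L, p < q) ∨ K = L

open Classical in
/-- `M(time (j + 1), s, s')[p, p']`: total strength of the elements of `𝓟(time j, s, s')` between
the class of `p` and the class of `p'` that are contained in the set of waves passing through
`(time (j + 1), point (j + 1))`. -/
def transMass (j s s' p p' : ℕ) : ℝ :=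
  ∑ K ∈ ((D.hist j s s').image (D.part j s s')).filter fun K =>
      Precedes (D.part j s s' p) K ∧ Precedes K (D.part j s s' p') ∧
        K ⊆ D.wavesAtPoint (j + 1), D.size K

open Classical in
/-- `π(time j, s, s')[p, p']`, the accumulated bound for the difference in speed of `p, p'`: it is
reset to zero as long as `s, s'` are joined, it grows at transversal interactions that occur when
`s, s'` are divided (and have already interacted), and stays constant at the other collisions. -/
def excess : (j s s' p p' : ℕ) → ℝ
  | 0, _, _, _, _ => 0
  | j + 1, s, s', p, p' =>
      if D.Joined j s s' ∨ ¬ D.Interacted j s s' then 0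
      else if D.IsTransversal (j + 1) then
        excess j s s' p p' +
          2 * supNorm (dwwv D.f) * D.firstStrength (j + 1) * D.transMass j s s' p p'
      else excess j s s' p p'

open Classical in
/-- The weight `𝔮(time j, s, s')`: zero for joined pairs, `π[s, s'] / |ŵ(s') - (ŵ(s) - 𝓢(s) ε)|` for
divided pairs that have already interacted, `‖∂²f/∂w²‖` for pairs that have never interacted. -/
def weight (j s s' : ℕ) : ℝ :=
  if D.Joined j s s' then 0
  else if D.Interacted j s s' then
    D.excess j s s' s s' / |D.hatw s' - (D.hatw s - D.sgn s * D.ε)|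
  else supNorm (dww D.f)

/-- The functional `𝔔(time j)`, which is also the value of `𝔔` on `[time j, time (j + 1))`. -/
def Q (j : ℕ) : ℝ :=
  ∑ s ∈ D.live j, ∑ s' ∈ (D.live j).filter (fun s' => s < s'), D.weight j s s' * D.ε * D.ε

end Data

end Wavefront

end

namespace Wavefront

/-! ### Convex and concave envelopes -/

/-! Two facts give the one-step estimate: very few pairs can gain weight at a transversal
interaction, and the sum of their gains is a double harmonic sum.

A pair that ends up joined has weight zero. A pair that has never met keeps its weight. A pair that
was joined before, or meets only now, has its accumulated bound reset to zero. A surviving pair can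
therefore gain only if it was already divided before the collision. Its gain is
$2\|D^3_{wwv}f\|\,|v_h|$ times the transversal mass, divided by $|\hat w(s')-(\hat w(s)-\mathcal
S(s)\varepsilon)|$. The mass is at most $|A|$, where $A$ is the set of waves at the collision point,
because the classes of the partition are disjoint (`transMass_le`). The denominator is $\varepsilon$
times the number of live waves from $s$ to $s'$ (`abs_hatw_sub`): waves between two that have met
share their sign, and right states are partial sums of signs. If the mass is nonzero, a wave of $A$
separates the pair or has one of its members on its side. Both members cannot lie in $A$, since only
one front of the second family takes part and so the waves of $A$ were joined. With $X$ and $Y$ the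
waves left and right of $A$, the pair lies in $A\times Y$, $X\times A$ or $X\times Y$. On each
rectangle the reciprocals of the counts are dominated by $\sum_{i\le m,k\le n}1/(i+k)\le(m+n)\log 2$
(`sum_sum_inv_add_le`), with $m+n$ at most the number of waves. Three rectangles and the factor 2
give the constant $6\log 2$.

For the summed estimate, $x+t$ strictly increases along every wave because speeds exceed $-1$
(`neg_one_lt_speed`). A wave therefore crosses each jump of $v_0$ at most once, and exchanging the
sums over collisions and waves gives $\mathrm{Tot.Var.}(w_0)\,\mathrm{Tot.Var.}(v_0)$.

All of this relies on the waves describing the solution, which is the invariant `Traced`: live waves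
are ordered by position, waves at one point share their sign, and both the right states and $w$ are
partial sums of signs of live waves. It is proved by induction over collisions (`Traced.succ`).
Between collisions the Riemann solver moves waves at their entropic speeds; at a binary collision
the cancelled waves have total sign zero (`cancellation`). -/

theorem convEnv_le {a b c : ℝ} {g : ℝ → ℝ} (hg : ∀ z ∈ Icc a b, c ≤ g z) {u : ℝ}
    (hu : u ∈ Icc a b) : convEnv a b g u ≤ g u := by
  apply csSup_le
  · exact ⟨c, fun _ => c, convexOn_const c (convex_Icc a b), hg, rfl⟩
  · rintro y ⟨φ, -, h, rfl⟩
    exact h u hu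

theorem le_convEnv {a b : ℝ} {g φ : ℝ → ℝ} (hφ : ConvexOn ℝ (Icc a b) φ)
    (hle : ∀ z ∈ Icc a b, φ z ≤ g z) {u : ℝ} (hu : u ∈ Icc a b) : φ u ≤ convEnv a b g u := by
  apply le_csSup
  · refine ⟨g u, ?_⟩
    rintro y ⟨ψ, -, h, rfl⟩
    exact h u hu
  · exact ⟨φ, hφ, hle, rfl⟩

/-- A supremum of convex functions is convex. The bound `c` supplies a constant competitor, so that
the real `sSup` is never taken over the empty set. -/
theorem convexOn_convEnv {a b c : ℝ} {g : ℝ → ℝ} (hg : ∀ z ∈ Icc a b, c ≤ g z) :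
    ConvexOn ℝ (Icc a b) (convEnv a b g) := by
  refine ⟨convex_Icc a b, ?_⟩
  intro x hx y hy α β hα hβ hαβ
  apply csSup_le
  · exact ⟨c, fun _ => c, convexOn_const c (convex_Icc a b), hg, rfl⟩
  · rintro z ⟨φ, hφ, h, rfl⟩
    refine (hφ.2 hx hy hα hβ hαβ).trans ?_
    have h1 := le_convEnv hφ h hx
    have h2 := le_convEnv hφ h hy
    simp only [smul_eq_mul]
    gcongr

/-- Negation exchanges the competitors. Since the real infimum is defined through the supremum of
the negated set, no boundedness is needed, and negative waves reduce to convex envelopes of `-g`. -/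
theorem concEnv_eq_neg (a b : ℝ) (g : ℝ → ℝ) (u : ℝ) :
    concEnv a b g u = -convEnv a b (fun z => -g z) u := by
  unfold concEnv convEnv
  rw [Real.sInf_def]
  congr 2
  ext y
  simp only [Set.mem_neg, Set.mem_ofPred_eq]
  constructor
  · rintro ⟨φ, h1, h2, h3⟩
    exact ⟨fun z => -φ z, h1.neg, fun z hz => neg_le_neg (h2 z hz), by linarith⟩
  · rintro ⟨φ, h1, h2, h3⟩
    exact ⟨fun z => -φ z, h1.neg, fun z hz => by linarith [h2 z hz], by linarith⟩

/-- The convex envelope is affine wherever the function is. -/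
theorem convEnv_affine {a b c p q : ℝ} {g : ℝ → ℝ} (hg : ∀ z ∈ Icc a b, c ≤ g z)
    (hap : a ≤ p) (hpq : p < q) (hqb : q ≤ b)
    (haff : ∀ u ∈ Icc p q, g u = g p + (u - p) / (q - p) * (g q - g p)) {u : ℝ}
    (hu : u ∈ Icc p q) :
    convEnv a b g u = convEnv a b g p +
      (u - p) / (q - p) * (convEnv a b g q - convEnv a b g p) := by
  have hE := convexOn_convEnv hg
  set E := convEnv a b g with hEdef
  have hp : p ∈ Icc a b := ⟨hap, by linarith⟩
  have hq : q ∈ Icc a b := ⟨by linarith, hqb⟩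
  have hd : 0 < q - p := by linarith
  -- The chord of the envelope over `[p, q]`. Convexity puts the envelope below it inside the
  -- interval and above it outside.
  set l : ℝ → ℝ := fun x => E p + (x - p) / (q - p) * (E q - E p) with hl
  have hlconv : ConvexOn ℝ (Icc a b) l := by
    refine ⟨convex_Icc a b, ?_⟩
    intro x _ y _ α β _ _ hαβ
    simp only [hl, smul_eq_mul]
    apply le_of_eq
    have : β = 1 - α := by linarith
    subst this
    field_simp
    ring
  have inside : ∀ x ∈ Icc p q, E x ≤ l x := by
    intro x hx
    have h := hE.2 hp hq (show 0 ≤ (q - x) / (q - p) from div_nonneg (by linarith [hx.2]) hd.le)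
      (show 0 ≤ (x - p) / (q - p) from div_nonneg (by linarith [hx.1]) hd.le)
      (by field_simp; ring)
    have e : ((q - x) / (q - p)) • p + ((x - p) / (q - p)) • q = x := by
      simp only [smul_eq_mul]; field_simp; ring
    rw [e] at h
    refine h.trans (le_of_eq ?_)
    simp only [hl, smul_eq_mul]
    field_simp
    ring
  have outside : ∀ x ∈ Icc a b, x ∉ Icc p q → l x ≤ E x := by
    intro x hx hxn
    rw [mem_Icc, not_and_or, not_le, not_le] at hxn
    simp only [hl]
    rcases hxn with h | h
    · have := hE.slope_mono_adjacent hx hq h hpq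
      rw [div_le_div_iff₀ (by linarith) hd] at this
      rw [div_mul_eq_mul_div, ← sub_nonneg]
      have : E x - (E p + (x - p) * (E q - E p) / (q - p)) =
        ((E q - E p) * (p - x) - (E p - E x) * (q - p)) / (q - p) := by
        field_simp; ring
      rw [this]
      apply div_nonneg _ hd.le
      linarith
    · have := hE.slope_mono_adjacent hp hx hpq h
      rw [div_le_div_iff₀ hd (by linarith)] at this
      rw [div_mul_eq_mul_div, ← sub_nonneg]
      have : E x - (E p + (x - p) * (E q - E p) / (q - p)) =
        ((E x - E q) * (q - p) - (E q - E p) * (x - q)) / (q - p) := by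
        field_simp; ring
      rw [this]
      apply div_nonneg _ hd.le
      linarith
  -- The maximum of envelope and chord is again a competitor: on `[p, q]` the chord stays below the
  -- affine `g` because it does so at the two ends. Hence the chord is below the envelope.
  have hmax := le_convEnv (g := g) (hE.sup hlconv) (by
    intro z hz
    apply sup_le (convEnv_le hg hz)
    by_cases hzi : z ∈ Icc p q
    · rw [haff z hzi]
      have h1 := convEnv_le hg hp
      have h2 := convEnv_le hg hq
      have t0 : 0 ≤ (z - p) / (q - p) := div_nonneg (by linarith [hzi.1]) hd.le
      have t1 : (z - p) / (q - p) ≤ 1 := by rw [div_le_one hd]; linarith [hzi.2]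
      simp only [hl]
      nlinarith [mul_le_mul_of_nonneg_left h2 t0,
        mul_le_mul_of_nonneg_left h1 (sub_nonneg.2 t1)]
    · exact (outside z hz hzi).trans (convEnv_le hg hz)) (u := u)
      ⟨hap.trans hu.1, hu.2.trans hqb⟩
  exact le_antisymm (inside u hu) (le_sup_right.trans hmax)

theorem deriv_eq_of_affine {E : ℝ → ℝ} {p q : ℝ}
    (h : ∀ u ∈ Icc p q, E u = E p + (u - p) / (q - p) * (E q - E p)) {u : ℝ} (hu : u ∈ Ioo p q) :
    deriv E u = (E q - E p) / (q - p) := by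
  have h1 : E =ᶠ[nhds u] fun u => E p + (u - p) / (q - p) * (E q - E p) := by
    filter_upwards [Icc_mem_nhds hu.1 hu.2] with x hx using h x hx
  rw [h1.deriv_eq]
  have : HasDerivAt (fun u => E p + (u - p) / (q - p) * (E q - E p))
      (1 / (q - p) * (E q - E p)) u :=
    ((((hasDerivAt_id u).sub_const p).div_const (q - p)).mul_const (E q - E p)).const_add (E p)
  rw [this.deriv]
  ring

/-! ### Piecewise affine interpolation on the grid -/

theorem gridInterp_neg (ε : ℝ) (g : ℝ → ℝ) :
    gridInterp ε (fun z => -g z) = fun u => -gridInterp ε g u := by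
  funext u
  simp only [gridInterp]
  ring

theorem gridInterp_of_mem {ε : ℝ} (hε : 0 < ε) (g : ℝ → ℝ) {m : ℤ} {u : ℝ}
    (hu : u ∈ Icc (m * ε) ((m + 1) * ε)) :
    gridInterp ε g u = g (m * ε) + (u / ε - m) * (g ((m + 1) * ε) - g (m * ε)) := by
  -- At the right end of the cell the floor jumps to `m + 1` and the fractional part vanishes; the
  -- formula of the cell still gives the same value.
  rcases hu.2.eq_or_lt with h | h
  · have e : u / ε = ((m + 1 : ℤ) : ℝ) := by rw [h]; push_cast; field_simp
    rw [gridInterp, e, Int.floor_intCast, Int.fract_intCast]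
    push_cast
    ring
  · have e : ⌊u / ε⌋ = m := by
      rw [Int.floor_eq_iff, le_div_iff₀ hε, div_lt_iff₀ hε]
      exact ⟨hu.1, h⟩
    rw [gridInterp, Int.fract, e]

theorem gridInterp_grid {ε : ℝ} (hε : 0 < ε) (g : ℝ → ℝ) (m : ℤ) :
    gridInterp ε g (m * ε) = g (m * ε) := by
  rw [gridInterp_of_mem hε g (m := m) ⟨le_rfl, by nlinarith⟩]
  field_simp
  ring

theorem gridInterp_affine {ε : ℝ} (hε : 0 < ε) (g : ℝ → ℝ) (m : ℤ) :
    ∀ u ∈ Icc ((m : ℝ) * ε) ((m + 1) * ε), gridInterp ε g u = gridInterp ε g (m * ε) +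
      (u - m * ε) / ((m + 1) * ε - m * ε) *
        (gridInterp ε g ((m + 1) * ε) - gridInterp ε g (m * ε)) := by
  intro u hu
  have h1 := gridInterp_grid hε g m
  have h2 := gridInterp_grid hε g (m + 1)
  push_cast at h2
  rw [gridInterp_of_mem hε g hu, h1, h2]
  have : (m + 1) * ε - m * ε = ε := by ring
  rw [this]
  field_simp

theorem le_gridInterp {ε : ℝ} (g : ℝ → ℝ) {c : ℝ} (hc : ∀ z, c ≤ g z) (u : ℝ) :
    c ≤ gridInterp ε g u := by
  have h1 := hc (⌊u / ε⌋ * ε)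
  have h2 := hc ((⌊u / ε⌋ + 1) * ε)
  have h3 := Int.fract_nonneg (u / ε)
  have h4 := (Int.fract_lt_one (u / ε)).le
  simp only [gridInterp]
  nlinarith [mul_le_mul_of_nonneg_left h2 h3, mul_le_mul_of_nonneg_left h1 (sub_nonneg.2 h4)]

theorem exists_cell {ε : ℝ} (hε : 0 < ε) {k l : ℤ} (hkl : k < l) {u : ℝ}
    (hu : u ∈ Icc (k * ε) (l * ε)) :
    ∃ m : ℤ, k ≤ m ∧ m + 1 ≤ l ∧ u ∈ Icc (m * ε) ((m + 1) * ε) := by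
  rcases hu.2.eq_or_lt with h | h
  · refine ⟨l - 1, by omega, by omega, ?_⟩
    push_cast
    constructor <;> nlinarith
  · refine ⟨⌊u / ε⌋, ?_, ?_, ?_, ?_⟩
    · rw [Int.le_floor, le_div_iff₀ hε]; exact hu.1
    · rw [Int.add_one_le_iff, Int.floor_lt, div_lt_iff₀ hε]; exact h
    · rw [← le_div_iff₀ hε]; exact Int.floor_le _
    · rw [← div_le_iff₀ hε]; exact (Int.lt_floor_add_one _).le

/-! ### Slopes of envelopes on grid cells -/

section slopes

variable {ε : ℝ} (hε : 0 < ε) {a b c : ℝ} {g : ℝ → ℝ} (hc : ∀ z, c ≤ g z)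

include hε hc

/-- Slope of the envelope on a cell. -/
theorem deriv_convEnv_cell {m : ℤ} (ha : a ≤ m * ε) (hb : (m + 1) * ε ≤ b) :
    deriv (convEnv a b (gridInterp ε g)) ((m + 1 / 2) * ε) =
      (convEnv a b (gridInterp ε g) ((m + 1) * ε) - convEnv a b (gridInterp ε g) (m * ε)) / ε := by
  rw [deriv_eq_of_affine (p := m * ε) (q := (m + 1) * ε)
    (fun u hu => convEnv_affine (fun z _ => le_gridInterp g hc z) ha (by nlinarith) hb
      (gridInterp_affine hε g m) hu) ⟨by nlinarith, by nlinarith⟩]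
  congr 1
  ring

theorem deriv_convEnv_mono {m n : ℤ} (hmn : m ≤ n) (ha : a ≤ m * ε) (hb : (n + 1) * ε ≤ b) :
    deriv (convEnv a b (gridInterp ε g)) ((m + 1 / 2) * ε) ≤
      deriv (convEnv a b (gridInterp ε g)) ((n + 1 / 2) * ε) := by
  rcases hmn.eq_or_lt with rfl | h
  · exact le_rfl
  have hc' : (m : ℝ) + 1 ≤ n := by exact_mod_cast h
  have h1 : ((m : ℝ) + 1) * ε ≤ n * ε := by gcongr
  rw [deriv_convEnv_cell hε hc ha (by nlinarith), deriv_convEnv_cell hε hc (by nlinarith) hb]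
  have hE := convexOn_convEnv (a := a) (b := b) (fun z _ => le_gridInterp (ε := ε) g hc z)
  set E := convEnv a b (gridInterp ε g)
  have hm : (m : ℝ) * ε ∈ Icc a b := ⟨ha, by nlinarith⟩
  have hm1 : ((m : ℝ) + 1) * ε ∈ Icc a b := ⟨by nlinarith, by nlinarith⟩
  have hn : (n : ℝ) * ε ∈ Icc a b := ⟨by nlinarith, by nlinarith⟩
  have hn1 : ((n : ℝ) + 1) * ε ∈ Icc a b := ⟨by nlinarith, by nlinarith⟩
  have e1 : ((m : ℝ) + 1) * ε - m * ε = ε := by ring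
  have e2 : ((n : ℝ) + 1) * ε - n * ε = ε := by ring
  rcases h1.eq_or_lt with h1 | h1
  · have := hE.slope_mono_adjacent hm hn1 (y := n * ε) (by nlinarith) (by nlinarith)
    rw [← h1] at this ⊢
    rw [← h1] at e2
    rwa [e1, e2] at this
  · have h2 := hE.slope_mono_adjacent hm hn (y := (m + 1) * ε) (by nlinarith) h1
    have h3 := hE.slope_mono_adjacent hm1 hn1 h1 (by nlinarith)
    have := h2.trans h3
    rwa [e1, e2] at this

/-- The line of slope `d` through the left end of the graph is a competitor, and the envelope does
not exceed the flux at that end. This bounds the slope on the first cell, and slopes increase from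
there. -/
theorem le_deriv_convEnv {k m l : ℤ} (hkm : k ≤ m) (hml : m + 1 ≤ l) {d : ℝ}
    (hd : ∀ u ∈ Icc (k * ε) (l * ε), gridInterp ε g (k * ε) + d * (u - k * ε) ≤
      gridInterp ε g u) :
    d ≤ deriv (convEnv (k * ε) (l * ε) (gridInterp ε g)) ((m + 1 / 2) * ε) := by
  have hml' : (m : ℝ) + 1 ≤ l := by exact_mod_cast hml
  have hkl' : (k : ℝ) + 1 ≤ l := by exact_mod_cast (by omega : k + 1 ≤ l)
  refine le_trans ?_ (deriv_convEnv_mono hε hc hkm le_rfl (by gcongr))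
  rw [deriv_convEnv_cell hε hc le_rfl (by gcongr), le_div_iff₀ hε]
  have hconv : ConvexOn ℝ (Icc (k * ε) (l * ε))
      (fun u => gridInterp ε g (k * ε) + d * (u - k * ε)) := by
    refine ⟨convex_Icc _ _, ?_⟩
    intro x _ y _ α β _ _ hαβ
    have : β = 1 - α := by linarith
    subst this
    simp only [smul_eq_mul]
    apply le_of_eq
    ring
  have h1 := le_convEnv hconv hd (u := (k + 1) * ε) ⟨by nlinarith, by gcongr⟩
  have h2 := convEnv_le (a := k * ε) (b := l * ε) (fun z _ => le_gridInterp (ε := ε) g hc z)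
    (u := k * ε) ⟨le_rfl, by nlinarith⟩
  nlinarith

/-- Mirror image at the right end: the line controls the last cell, which has the largest slope. -/
theorem deriv_convEnv_le {k m l : ℤ} (hkm : k ≤ m) (hml : m + 1 ≤ l) {d : ℝ}
    (hd : ∀ u ∈ Icc (k * ε) (l * ε), gridInterp ε g (l * ε) + d * (u - l * ε) ≤
      gridInterp ε g u) :
    deriv (convEnv (k * ε) (l * ε) (gridInterp ε g)) ((m + 1 / 2) * ε) ≤ d := by
  obtain ⟨n, rfl⟩ : ∃ n, l = n + 1 := ⟨l - 1, by ring⟩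
  have hkn' : (k : ℝ) ≤ n := by exact_mod_cast (by omega : k ≤ n)
  have hkm' : (k : ℝ) ≤ m := by exact_mod_cast hkm
  push_cast at hd ⊢
  refine (deriv_convEnv_mono hε hc (n := n) (by omega) (by gcongr) le_rfl).trans ?_
  rw [deriv_convEnv_cell hε hc (by gcongr) le_rfl, div_le_iff₀ hε]
  have hconv : ConvexOn ℝ (Icc (k * ε) ((n + 1) * ε))
      (fun u => gridInterp ε g ((n + 1) * ε) + d * (u - (n + 1) * ε)) := by
    refine ⟨convex_Icc _ _, ?_⟩
    intro x _ y _ α β _ _ hαβ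
    have : β = 1 - α := by linarith
    subst this
    simp only [smul_eq_mul]
    apply le_of_eq
    ring
  have h1 := le_convEnv hconv hd (u := n * ε) ⟨by gcongr, by nlinarith⟩
  have h2 := convEnv_le (a := k * ε) (b := (n + 1) * ε)
    (fun z _ => le_gridInterp (ε := ε) g hc z) (u := (n + 1) * ε) ⟨by nlinarith, le_rfl⟩
  nlinarith

end slopes

theorem deriv_concEnv (a b ε : ℝ) (g : ℝ → ℝ) (u : ℝ) :
    deriv (concEnv a b (gridInterp ε g)) u =
      -deriv (convEnv a b (gridInterp ε (fun z => -g z))) u := by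
  have : concEnv a b (gridInterp ε g) =
      fun u => -convEnv a b (gridInterp ε (fun z => -g z)) u := by
    funext u
    rw [concEnv_eq_neg, gridInterp_neg]
  rw [this, deriv.fun_neg]

/-- If `g - d` is monotone, its interpolation stays above the line of slope `d` from the left. -/
theorem gridInterp_ge_left {ε : ℝ} (hε : 0 < ε) {g : ℝ → ℝ} {k l : ℤ} (hkl : k < l) {d : ℝ}
    (hmono : MonotoneOn (fun u => g u - d * u) (Icc (k * ε) (l * ε))) {u : ℝ}
    (hu : u ∈ Icc (k * ε) (l * ε)) :
    gridInterp ε g (k * ε) + d * (u - k * ε) ≤ gridInterp ε g u := by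
  obtain ⟨m, hkm, hml, hum⟩ := exists_cell hε hkl hu
  have h1 : (k : ℝ) ≤ m := by exact_mod_cast hkm
  have h2 : (m : ℝ) + 1 ≤ l := by exact_mod_cast hml
  have hk : (k : ℝ) * ε ∈ Icc (k * ε) (l * ε) := ⟨le_rfl, by nlinarith⟩
  have hm : (m : ℝ) * ε ∈ Icc (k * ε) (l * ε) := ⟨by gcongr, by nlinarith⟩
  have hm1 : ((m : ℝ) + 1) * ε ∈ Icc (k * ε) (l * ε) := ⟨by nlinarith, by gcongr⟩
  have i1 := hmono hk hm hm.1
  have i2 := hmono hk hm1 hm1.1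
  rw [gridInterp_grid hε, gridInterp_of_mem hε g hum]
  simp only at i1 i2
  have t0 : 0 ≤ u / ε - m := by rw [sub_nonneg, le_div_iff₀ hε]; exact hum.1
  have t1 : u / ε - m ≤ 1 := by rw [sub_le_iff_le_add', div_le_iff₀ hε]; exact hum.2
  have e : u = (u / ε) * ε := by field_simp
  -- The interpolated value is the average, with weight `t`, of two grid values that satisfy the
  -- inequality.
  set t := u / ε - m with ht
  have e' : u = (t + m) * ε := by rw [e, ht]; ring
  rw [e']
  nlinarith [mul_le_mul_of_nonneg_left i2 t0, mul_le_mul_of_nonneg_left i1 (sub_nonneg.2 t1)]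

theorem gridInterp_le_right {ε : ℝ} (hε : 0 < ε) {g : ℝ → ℝ} {k l : ℤ} (hkl : k < l) {d : ℝ}
    (hmono : MonotoneOn (fun u => g u - d * u) (Icc (k * ε) (l * ε))) {u : ℝ}
    (hu : u ∈ Icc (k * ε) (l * ε)) :
    gridInterp ε g u ≤ gridInterp ε g (l * ε) + d * (u - l * ε) := by
  obtain ⟨m, hkm, hml, hum⟩ := exists_cell hε hkl hu
  have h1 : (k : ℝ) ≤ m := by exact_mod_cast hkm
  have h2 : (m : ℝ) + 1 ≤ l := by exact_mod_cast hml
  have hl : (l : ℝ) * ε ∈ Icc (k * ε) (l * ε) := ⟨by nlinarith, le_rfl⟩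
  have hm : (m : ℝ) * ε ∈ Icc (k * ε) (l * ε) := ⟨by gcongr, by nlinarith⟩
  have hm1 : ((m : ℝ) + 1) * ε ∈ Icc (k * ε) (l * ε) := ⟨by nlinarith, by gcongr⟩
  have i1 := hmono hm hl hm.2
  have i2 := hmono hm1 hl hm1.2
  rw [gridInterp_grid hε, gridInterp_of_mem hε g hum]
  simp only at i1 i2
  have t0 : 0 ≤ u / ε - m := by rw [sub_nonneg, le_div_iff₀ hε]; exact hum.1
  have t1 : u / ε - m ≤ 1 := by rw [sub_le_iff_le_add', div_le_iff₀ hε]; exact hum.2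
  have e : u = (u / ε) * ε := by field_simp
  set t := u / ε - m with ht
  have e' : u = (t + m) * ε := by rw [e, ht]; ring
  rw [e']
  nlinarith [mul_le_mul_of_nonneg_left i2 t0, mul_le_mul_of_nonneg_left i1 (sub_nonneg.2 t1)]


/-! ### Grid-valued step functions -/

open Filter Topology in
/-- A function with values in `ℤ ε` that has a limit is eventually constant. -/
theorem eventually_eq_of_tendsto_grid {ε : ℝ} (hε : 0 < ε) {g : ℝ → ℝ}
    (hg : ∀ x, ∃ m : ℤ, g x = m * ε) {F : Filter ℝ} [F.NeBot] {c : ℝ} (h : Tendsto g F (𝓝 c)) :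
    (∀ᶠ x in F, g x = c) ∧ ∃ m : ℤ, c = m * ε := by
  -- With radius `ε / 2`, any two values differ by less than one grid step and so coincide.
  have h1 : ∀ᶠ x in F, |g x - c| < ε / 2 := by
    have := Metric.tendsto_nhds.1 h (ε / 2) (by linarith)
    simpa only [Real.dist_eq] using this
  obtain ⟨x, hx⟩ := h1.exists
  have h2 : ∀ᶠ y in F, g y = g x := by
    filter_upwards [h1] with y hy
    obtain ⟨m, hm⟩ := hg x
    obtain ⟨n, hn⟩ := hg y
    rw [abs_lt] at hx hy
    have i1 : (n : ℝ) - m < 1 := by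
      by_contra hcon
      push Not at hcon
      nlinarith
    have i2 : (m : ℝ) - n < 1 := by
      by_contra hcon
      push Not at hcon
      nlinarith
    have i3 : n - m < 1 := by exact_mod_cast i1
    have i4 : m - n < 1 := by exact_mod_cast i2
    have : n = m := by omega
    rw [hm, hn, this]
  have h3 : c = g x := by
    have := (tendsto_congr' h2).1 h
    exact tendsto_nhds_unique this tendsto_const_nhds
  rw [h3]
  exact ⟨h2, hg x⟩

/-- Total variation on a left half line. -/
noncomputable def varIic (g : ℝ → ℝ) (x : ℝ) : ℝ := (eVariationOn g (Iic x)).toReal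

/-- One-sided limits of a grid-valued function are attained nearby, so `g` is constant just to the
left and just to the right of `x`. The variation can then change only through the jump at `x`. -/
theorem IsGridStep.exists_local {ε : ℝ} (hε : 0 < ε) {g : ℝ → ℝ} (hg : IsGridStep ε g) (x : ℝ) :
    ∃ δ > 0, (∀ z ∈ Ioo (x - δ) x, g z = Function.leftLim g x ∧
        varIic g x = varIic g z + |g x - Function.leftLim g x|) ∧
      ∀ z ∈ Ico x (x + δ), g z = g x ∧ varIic g z = varIic g x := by
  have bv := hg.bounded_variation
  have h1 := (eventually_eq_of_tendsto_grid hε hg.grid_valued (bv.tendsto_leftLim x)).1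
  have h2 := (eventually_eq_of_tendsto_grid hε hg.grid_valued (hg.right_continuous x)).1
  obtain ⟨l, hl, hl'⟩ := (mem_nhdsLT_iff_exists_Ioo_subset).1 h1
  obtain ⟨u, hu, hu'⟩ := (mem_nhdsGE_iff_exists_Ico_subset).1 h2
  simp only [mem_Iio, mem_Ioi] at hl hu
  have fin : ∀ s, eVariationOn g s ≠ ⊤ := fun s => bv.mono (subset_univ s)
  refine ⟨min (x - l) (u - x), lt_min (by linarith) (by linarith), ?_, ?_⟩
  · rintro z ⟨hz1, hz2⟩
    have hzl : l < z := by have := min_le_left (x - l) (u - x); linarith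
    refine ⟨hl' ⟨hzl, hz2⟩, ?_⟩
    have e1 : eVariationOn g (Iio x) = eVariationOn g (Iic z) := by
      have : Iio x = Iic z ∪ Ico z x := by
        ext y; simp only [mem_Iio, mem_union, mem_Iic, mem_Ico]
        constructor
        · intro h; rcases le_total y z with h' | h'
          · exact Or.inl h'
          · exact Or.inr ⟨h', h⟩
        · rintro (h | h)
          · linarith
          · exact h.2
      rw [this, eVariationOn.union g (x := z) isGreatest_Iic (isLeast_Ico hz2),
        eVariationOn.constant_on (s := Ico z x), add_zero]
      rintro a ⟨a', ha, rfl⟩ b ⟨b', hb, rfl⟩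
      have r1 : g a' = _ := hl' ⟨hzl.trans_le ha.1, ha.2⟩
      have r2 : g b' = _ := hl' ⟨hzl.trans_le hb.1, hb.2⟩
      rw [r1, r2]
    rw [varIic, varIic, bv.eVariationOn_Iic_eq_Iio_add_edist, e1,
      ENNReal.toReal_add (fin _) (edist_ne_top _ _), edist_dist,
      ENNReal.toReal_ofReal dist_nonneg, Real.dist_eq]
  · rintro z ⟨hz1, hz2⟩
    have hzu : z < u := by have := min_le_right (x - l) (u - x); linarith
    refine ⟨hu' ⟨hz1, hzu⟩, ?_⟩
    have : Iic z = Iic x ∪ Icc x z := by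
      ext y; simp only [mem_union, mem_Iic, mem_Icc]
      constructor
      · intro h; rcases le_total y x with h' | h'
        · exact Or.inl h'
        · exact Or.inr ⟨h', h⟩
      · rintro (h | h)
        · linarith
        · exact h.2
    rw [varIic, varIic, this, eVariationOn.union g (x := x) isGreatest_Iic (isLeast_Icc hz1),
      eVariationOn.constant_on (s := Icc x z), add_zero]
    rintro a ⟨a', ha, rfl⟩ b ⟨b', hb, rfl⟩
    have r1 : g a' = _ := hu' ⟨ha.1, ha.2.trans_lt hzu⟩
    have r2 : g b' = _ := hu' ⟨hb.1, hb.2.trans_lt hzu⟩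
    rw [r1, r2]

theorem IsGridStep.leftLim_grid {ε : ℝ} (hε : 0 < ε) {g : ℝ → ℝ} (hg : IsGridStep ε g) (x : ℝ) :
    ∃ m : ℤ, Function.leftLim g x = m * ε :=
  (eventually_eq_of_tendsto_grid hε hg.grid_valued (hg.bounded_variation.tendsto_leftLim x)).2

/-- Connectedness of the line: `P` holds on a clopen set. The hypothesis has the shape delivered by
`exists_local`, and the lemma takes the place of an induction over the jumps. -/
theorem forall_of_locally_iff {P : ℝ → Prop}
    (h : ∀ x, ∃ δ > 0, (∀ z ∈ Ioo (x - δ) x, (P z ↔ P x)) ∧ ∀ z ∈ Ico x (x + δ), (P z ↔ P x))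
    {x₀ : ℝ} (h₀ : P x₀) (x : ℝ) : P x := by
  have key : ∀ x, ∀ᶠ z in nhds x, (P z ↔ P x) := by
    intro x
    obtain ⟨δ, hδ, h1, h2⟩ := h x
    filter_upwards [Ioo_mem_nhds (show x - δ < x by linarith) (show x < x + δ by linarith)]
      with z hz
    rcases lt_or_ge z x with h' | h'
    · exact h1 z ⟨hz.1, h'⟩
    · exact h2 z ⟨h', hz.2⟩
  have hclopen : IsClopen {x | P x} := by
    constructor
    · rw [← isOpen_compl_iff, isOpen_iff_mem_nhds]
      intro y hy
      filter_upwards [key y] with z hz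
      exact fun h' => hy (hz.1 h')
    · rw [isOpen_iff_mem_nhds]
      intro y hy
      filter_upwards [key y] with z hz
      exact hz.2 hy
  have := hclopen.eq_univ ⟨x₀, h₀⟩
  have hx : x ∈ {x | P x} := this ▸ mem_univ x
  exact hx

theorem varIic_mono {g : ℝ → ℝ} (hg : BoundedVariationOn g univ) : Monotone (varIic g) :=
  fun _ _ h => ENNReal.toReal_mono (hg.mono (subset_univ _))
    (eVariationOn.mono g (Iic_subset_Iic.2 h))

theorem IsGridStep.exists_far {ε : ℝ} {g : ℝ → ℝ} (hg : IsGridStep ε g) :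
    ∃ M, (∀ x ≤ -M, g x = 0 ∧ varIic g x = 0) ∧ varIic g M = totVar g := by
  obtain ⟨M, hM⟩ := hg.compact_support.isBounded.subset_closedBall 0
  have hz : ∀ x, M < |x| → g x = 0 := by
    intro x hx
    by_contra h
    have := hM (subset_tsupport g h)
    rw [Metric.mem_closedBall, Real.dist_eq, sub_zero] at this
    linarith
  refine ⟨|M| + 1, ?_, ?_⟩
  · have h0 : ∀ x ≤ -(|M| + 1), g x = 0 := by
      intro x hx
      apply hz
      have := le_abs_self M
      have := neg_le_abs x
      linarith
    intro x hx
    refine ⟨h0 x hx, ?_⟩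
    rw [varIic, eVariationOn.constant_on]
    · rfl
    rintro a ⟨a', ha, rfl⟩ b ⟨b', hb, rfl⟩
    rw [h0 a' (le_trans ha hx), h0 b' (le_trans hb hx)]
  · rw [varIic, totVar]
    have : (univ : Set ℝ) = Iic (|M| + 1) ∪ Ici (|M| + 1) := by simp
    rw [this, eVariationOn.union g (x := |M| + 1) isGreatest_Iic isLeast_Ici,
      eVariationOn.constant_on (s := Ici (|M| + 1)), add_zero]
    have h0 : ∀ x, |M| + 1 ≤ x → g x = 0 := by
      intro x hx
      apply hz
      have := le_abs_self M
      have := le_abs_self x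
      linarith
    rintro a ⟨a', ha, rfl⟩ b ⟨b', hb, rfl⟩
    rw [h0 a' ha, h0 b' hb]

/-- The variation vanishes far to the left, and each jump changes it by a multiple of `ε`, so
integrality propagates along the line. -/
theorem IsGridStep.exists_varIic_nat {ε : ℝ} (hε : 0 < ε) {g : ℝ → ℝ} (hg : IsGridStep ε g) :
    ∃ n : ℝ → ℕ, (∀ x, varIic g x = n x * ε) ∧ Monotone n := by
  have hz : ∀ x, ∃ m : ℤ, varIic g x = m * ε := by
    obtain ⟨M, hM, -⟩ := hg.exists_far
    refine forall_of_locally_iff ?_ (x₀ := -M) ⟨0, by rw [(hM _ le_rfl).2]; simp⟩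
    intro x
    obtain ⟨δ, hδ, h1, h2⟩ := hg.exists_local hε x
    obtain ⟨k, hk⟩ := hg.leftLim_grid hε x
    obtain ⟨l, hl⟩ := hg.grid_valued x
    have habs : |g x - Function.leftLim g x| = (|l - k| : ℤ) * ε := by
      rw [hk, hl, ← sub_mul, abs_mul, abs_of_pos hε]
      push_cast
      rfl
    refine ⟨δ, hδ, fun z hz => ?_, fun z hz => ?_⟩
    · rw [(h1 z hz).2, habs]
      constructor
      · rintro ⟨m, hm⟩
        exact ⟨m + |l - k|, by rw [hm]; push_cast; ring⟩
      · rintro ⟨m, hm⟩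
        exact ⟨m - |l - k|, by push_cast at hm ⊢; linarith⟩
    · rw [(h2 z hz).2]
  have hn : ∀ x, ∃ m : ℕ, varIic g x = m * ε := by
    intro x
    obtain ⟨m, hm⟩ := hz x
    have h0 : 0 ≤ varIic g x := ENNReal.toReal_nonneg
    rw [hm] at h0
    have : (0 : ℝ) ≤ m := by by_contra h; push Not at h; nlinarith
    have hm0 : 0 ≤ m := by exact_mod_cast this
    lift m to ℕ using hm0
    exact ⟨m, by exact_mod_cast hm⟩
  choose n hn using hn
  refine ⟨n, hn, fun x y hxy => ?_⟩
  have := varIic_mono hg.bounded_variation hxy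
  rw [hn, hn] at this
  exact_mod_cast le_of_mul_le_mul_right this hε

/-- The jumps of a function sum up to at most its total variation. -/
theorem sum_jump_le_totVar {g : ℝ → ℝ} (hg : BoundedVariationOn g univ) (F : Finset ℝ) :
    ∑ y ∈ F, |g y - Function.leftLim g y| ≤ totVar g := by
  -- Induction on the largest jump point. The open half line leaves out the jump at that point,
  -- which is then added separately.
  have key : ∀ F : Finset ℝ, ∀ b, (∀ y ∈ F, y < b) →
      ∑ y ∈ F, edist (g y) (Function.leftLim g y) ≤ eVariationOn g (Iio b) := by
    intro F
    induction F using Finset.induction_on_max with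
    | empty => intro b _; simp
    | insert y F hy ih =>
      intro b hb
      rw [Finset.sum_insert (fun h => lt_irrefl _ (hy y h)), add_comm]
      calc _ ≤ eVariationOn g (Iio y) + edist (g y) (Function.leftLim g y) := by
            gcongr; exact ih y hy
        _ = eVariationOn g (Iic y) := hg.eVariationOn_Iic_eq_Iio_add_edist.symm
        _ ≤ _ := eVariationOn.mono g (Iic_subset_Iio.2 (hb y (Finset.mem_insert_self _ _)))
  obtain ⟨b, hb⟩ := F.bddAbove
  have h1 := (key F (b + 1) (fun y hy => by have := hb hy; linarith)).trans
    (eVariationOn.mono g (subset_univ _))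
  have h2 := ENNReal.toReal_mono hg h1
  rw [ENNReal.toReal_sum (fun _ _ => edist_ne_top _ _)] at h2
  refine le_trans (le_of_eq (Finset.sum_congr rfl fun y _ => ?_)) h2
  rw [edist_dist, ENNReal.toReal_ofReal dist_nonneg, Real.dist_eq]

/-! ### The waves of the initial datum -/

namespace Data

variable {D : Data}

/-- The count `n` is the variation in units of `ε`. Its equivalence with `pos₀` turns every question
about initial positions into arithmetic of `n`. -/
theorem exists_count (hε : 0 < D.ε) (hw : IsGridStep D.ε D.w₀) :
    ∃ n : ℝ → ℕ, Monotone n ∧ (∀ x, D.varTo x = n x * D.ε) ∧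
      D.waves = Finset.Icc 1 ⌊totVar D.w₀ / D.ε⌋₊ ∧ (∀ x, n x ≤ ⌊totVar D.w₀ / D.ε⌋₊) ∧
      (∀ p ∈ D.waves, ∀ x, D.pos₀ p ≤ x ↔ p ≤ n x) ∧
      ∀ x, ∃ δ > 0, (∀ z ∈ Ioo (x - δ) x, D.w₀ z = Function.leftLim D.w₀ x ∧
          Function.leftLim D.varTo x = n z * D.ε ∧
          n x * D.ε = n z * D.ε + |D.w₀ x - Function.leftLim D.w₀ x|) ∧
        ∀ z ∈ Ico x (x + δ), D.w₀ z = D.w₀ x ∧ n z = n x := by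
  obtain ⟨n, hn, hmono⟩ := hw.exists_varIic_nat hε
  obtain ⟨M, hM, hM'⟩ := hw.exists_far
  have hTV : totVar D.w₀ / D.ε = n M := by
    rw [← hM', hn]; field_simp
  have hNn : ∀ x, n x ≤ n M := by
    intro x
    have : varIic D.w₀ x ≤ varIic D.w₀ M := by
      rw [hM']
      exact ENNReal.toReal_mono hw.bounded_variation (eVariationOn.mono _ (subset_univ _))
    rw [hn, hn] at this
    exact_mod_cast le_of_mul_le_mul_right this hε
  have hiff : ∀ (p : ℕ) x, D.ε * p ≤ D.varTo x ↔ p ≤ n x := by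
    intro p x
    rw [show D.varTo x = n x * D.ε from hn x, mul_comm, mul_le_mul_iff_left₀ hε, Nat.cast_le]
  have hsame : ∀ x y, varIic D.w₀ x = varIic D.w₀ y → n x = n y := by
    intro x y h
    rw [hn, hn] at h
    exact_mod_cast mul_right_cancel₀ hε.ne' h
  have hset : ∀ p : ℕ, {x | D.ε * p ≤ D.varTo x} = {x | p ≤ n x} := by
    intro p; ext x; exact hiff p x
  refine ⟨n, hmono, hn, rfl, by rw [hTV, Nat.floor_natCast]; exact hNn, ?_, ?_⟩
  · intro p hp x
    rw [waves, hTV, Nat.floor_natCast, Finset.mem_Icc] at hp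
    have hbdd : BddBelow {x | p ≤ n x} := by
      refine ⟨-M, fun y hy => ?_⟩
      by_contra hlt
      have h0 := (hM y (by linarith)).2
      rw [hn] at h0
      have : n y = 0 := by
        rcases mul_eq_zero.1 h0 with h | h
        · exact_mod_cast h
        · exact absurd h hε.ne'
      have : p ≤ n y := hy
      omega
    have hne : {x | p ≤ n x}.Nonempty := ⟨M, hp.2⟩
    rw [pos₀, hset]
    constructor
    · intro h
      refine le_trans ?_ (hmono h)
      -- The count is constant just to the right of the infimum, so the infimum is attained.
      obtain ⟨δ, hδ, -, h2⟩ := hw.exists_local hε (sInf {x | p ≤ n x})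
      obtain ⟨y, hy, hy'⟩ := exists_lt_of_csInf_lt hne (lt_add_of_pos_right _ hδ)
      rw [← hsame _ _ (h2 y ⟨csInf_le hbdd hy, hy'⟩).2]
      exact hy
    · intro h
      exact csInf_le hbdd h
  · intro x
    obtain ⟨δ, hδ, h1, h2⟩ := hw.exists_local hε x
    refine ⟨δ, hδ, fun z hz => ⟨(h1 z hz).1, ?_, ?_⟩,
      fun z hz => ⟨(h2 z hz).1, hsame _ _ (h2 z hz).2⟩⟩
    · apply leftLim_eq_of_tendsto
      apply tendsto_const_nhds.congr'
      filter_upwards [Ioo_mem_nhdsLT (show x - δ < x by linarith)] with y hy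
      rw [show D.varTo y = varIic D.w₀ y from rfl, ← hn]
      have e1 := (h1 y hy).2
      have e2 := (h1 _ hz).2
      linarith
    · have := (h1 _ hz).2
      rwa [hn, hn] at this

open Classical in
-- The waves born at one jump are consecutive integers with the sign of the jump, so their states
-- interpolate between its two one-sided values. Crossing the jumps from the far left turns this
-- into the formulas by partial sums of signs. The hull membership is what the speed bound needs.
theorem initial_waves (hε : 0 < D.ε) (hw : IsGridStep D.ε D.w₀) :
    (∀ p ∈ D.waves, D.sgn p = 1 ∨ D.sgn p = -1) ∧
    (∀ p ∈ D.waves, ∀ q ∈ D.waves, p ≤ q → D.pos₀ p ≤ D.pos₀ q) ∧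
    (∀ p ∈ D.waves, D.hatw p = D.ε * ∑ q ∈ D.waves with q ≤ p, D.sgn q) ∧
    (∀ x, D.w₀ x = D.ε * ∑ q ∈ D.waves with D.pos₀ q ≤ x, D.sgn q) ∧
    ∀ p ∈ D.waves, D.hatw p ∈ convexHull ℝ (range D.w₀) ∧
      D.hatw p - D.sgn p * D.ε ∈ convexHull ℝ (range D.w₀) := by
  obtain ⟨n, hmono, hn, hwaves, hN, hpos, hloc⟩ := exists_count hε hw
  obtain ⟨M, hM, -⟩ := hw.exists_far
  have hmem : ∀ p x, 1 ≤ p → p ≤ n x → p ∈ D.waves := by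
    intro p x h1 h2
    rw [hwaves, Finset.mem_Icc]
    exact ⟨h1, h2.trans (hN x)⟩
  have hone : ∀ p ∈ D.waves, 1 ≤ p := by
    intro p hp
    rw [hwaves, Finset.mem_Icc] at hp
    exact hp.1
  -- For `z` just to the left of `x`, the labels in `(n z, n x]` are born at `x`.
  have hfan : ∀ x, ∃ z < x, D.w₀ z = Function.leftLim D.w₀ x ∧
      Function.leftLim D.varTo x = n z * D.ε ∧ n z ≤ n x ∧
      |D.w₀ x - Function.leftLim D.w₀ x| = (n x - n z) * D.ε ∧
      ∀ p, n z < p → p ≤ n x → D.pos₀ p = x := by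
    intro x
    obtain ⟨δ, hδ, h1, -⟩ := hloc x
    obtain ⟨e1, e2, e3⟩ := h1 (x - δ / 2) ⟨by linarith, by linarith⟩
    refine ⟨x - δ / 2, by linarith, e1, e2, hmono (by linarith), by linarith, ?_⟩
    intro p hp1 hp2
    have hp := hmem p x (by omega) hp2
    refine le_antisymm ((hpos p hp x).2 hp2) ?_
    by_contra hlt
    push Not at hlt
    obtain ⟨y, hy1, hy2⟩ := exists_between (max_lt hlt (show x - δ / 2 < x by linarith))
    rw [max_lt_iff] at hy1
    have h3 := (hpos p hp y).1 hy1.1.le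
    obtain ⟨-, -, e4⟩ := h1 y ⟨by linarith, hy2⟩
    have : (n y : ℝ) = n (x - δ / 2) :=
      mul_right_cancel₀ hε.ne' (by linarith)
    have : n y = n (x - δ / 2) := by exact_mod_cast this
    omega
  have hjump : ∀ p ∈ D.waves, ∃ z < D.pos₀ p, n z < p ∧ p ≤ n (D.pos₀ p) ∧
      D.w₀ z = Function.leftLim D.w₀ (D.pos₀ p) ∧
      Function.leftLim D.varTo (D.pos₀ p) = n z * D.ε ∧
      (D.sgn p = 1 ∨ D.sgn p = -1) ∧
      D.w₀ (D.pos₀ p) = D.w₀ z + D.sgn p * ((n (D.pos₀ p) - n z) * D.ε) ∧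
      ∀ q, n z < q → q ≤ n (D.pos₀ p) → D.sgn q = D.sgn p := by
    intro p hp
    obtain ⟨z, hz, e1, e2, e3, e4, e5⟩ := hfan (D.pos₀ p)
    have hpn := (hpos p hp _).1 le_rfl
    have hzp : n z < p := by
      by_contra h
      push Not at h
      have := (hpos p hp z).2 h
      linarith
    have hne : D.w₀ (D.pos₀ p) - Function.leftLim D.w₀ (D.pos₀ p) ≠ 0 := by
      rw [← abs_pos, e4]
      have : (n z : ℝ) < n (D.pos₀ p) := by exact_mod_cast hzp.trans_le hpn
      exact mul_pos (by linarith) hε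
    refine ⟨z, hz, hzp, hpn, e1, e2, ?_, ?_, ?_⟩
    · rw [sgn]
      rcases lt_or_gt_of_ne hne with h | h
      · exact Or.inr (Real.sign_of_neg h)
      · exact Or.inl (Real.sign_of_pos h)
    · rw [← e4, sgn, e1]
      rcases lt_or_gt_of_ne hne with h | h
      · rw [Real.sign_of_neg h, abs_of_neg h]; ring
      · rw [Real.sign_of_pos h, abs_of_pos h]; ring
    · intro q hq1 hq2
      rw [sgn, sgn, e5 q hq1 hq2]
  have hfilter : ∀ x, D.waves.filter (fun q => D.pos₀ q ≤ x) = Finset.Icc 1 (n x) := by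
    intro x
    ext q
    rw [Finset.mem_filter, Finset.mem_Icc]
    constructor
    · rintro ⟨h1, h2⟩
      exact ⟨hone q h1, (hpos q h1 x).1 h2⟩
    · rintro ⟨h1, h2⟩
      have := hmem q x h1 h2
      exact ⟨this, (hpos q this x).2 h2⟩
  have hsplit : ∀ a b : ℕ, a ≤ b → ∑ q ∈ Finset.Icc 1 b, D.sgn q =
      ∑ q ∈ Finset.Icc 1 a, D.sgn q + ∑ q ∈ Finset.Ioc a b, D.sgn q := by
    intro a b hab
    rw [← Finset.sum_union]
    · congr 1
      ext q
      simp only [Finset.mem_Icc, Finset.mem_union, Finset.mem_Ioc]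
      omega
    · rw [Finset.disjoint_left]
      intro q h1 h2
      simp only [Finset.mem_Icc, Finset.mem_Ioc] at h1 h2
      omega
  have hconst : ∀ a b : ℕ, a ≤ b → ∀ σ : ℝ, (∀ q, a < q → q ≤ b → D.sgn q = σ) →
      ∑ q ∈ Finset.Ioc a b, D.sgn q = σ * (b - a) := by
    intro a b hab σ h
    rw [Finset.sum_congr rfl (g := fun _ => σ) (fun q hq => by
      rw [Finset.mem_Ioc] at hq; exact h q hq.1 hq.2), Finset.sum_const, Nat.card_Ioc,
      nsmul_eq_mul, Nat.cast_sub hab]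
    ring
  have hw₀ : ∀ x, D.w₀ x = D.ε * ∑ q ∈ Finset.Icc 1 (n x), D.sgn q := by
    refine forall_of_locally_iff ?_ (x₀ := -M) ?_
    · intro x
      obtain ⟨δ, hδ, h1, h2⟩ := hloc x
      refine ⟨δ, hδ, fun z hz => ?_, fun z hz => by rw [(h2 z hz).1, (h2 z hz).2]⟩
      obtain ⟨e1, -, e3⟩ := h1 z hz
      have hle := hmono hz.2.le
      rcases hle.eq_or_lt with he | hlt
      · have : |D.w₀ x - Function.leftLim D.w₀ x| = 0 := by rw [he] at e3; linarith
        rw [abs_eq_zero, sub_eq_zero] at this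
        rw [he, e1, this]
      · have hxw := hmem (n x) x (by omega) le_rfl
        have hx : D.pos₀ (n x) = x := by
          refine le_antisymm ((hpos _ hxw x).2 le_rfl) ?_
          by_contra h
          push Not at h
          obtain ⟨y, hy1, hy2⟩ := exists_between (max_lt h hz.2)
          rw [max_lt_iff] at hy1
          have i1 := (hpos _ hxw y).1 hy1.1.le
          obtain ⟨-, -, e4⟩ := h1 y ⟨by linarith [hz.1], hy2⟩
          have : (n y : ℝ) = n z := mul_right_cancel₀ hε.ne' (by linarith)
          have : n y = n z := by exact_mod_cast this
          omega
        obtain ⟨z', hz', j1, j2, j3, -, -, j4, j5⟩ := hjump _ hxw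
        rw [hx] at j2 j3 j4 j5 hz'
        -- Both counts equal `n x` minus the height of the jump in grid units.
        have hzz : n z' = n z := by
          obtain ⟨y, hy1, hy2⟩ := exists_between (max_lt hz' hz.2)
          rw [max_lt_iff] at hy1
          have habs : |D.w₀ x - D.w₀ z'| = (n x - n z') * D.ε := by
            have : (n z' : ℝ) ≤ n x := by exact_mod_cast hmono hz'.le
            rw [j4, add_sub_cancel_left, abs_mul, abs_of_nonneg (mul_nonneg (by linarith) hε.le)]
            have : |D.sgn (n x)| = 1 := by
              obtain ⟨_, _, _, _, _, _, hs, _⟩ := hjump _ hxw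
              rcases hs with h | h <;> rw [h] <;> simp
            rw [this, one_mul]
          rw [j3] at habs
          have : (n z' : ℝ) = n z := mul_right_cancel₀ hε.ne' (by linarith)
          exact_mod_cast this
        rw [hsplit _ _ hle, hconst _ _ hle (D.sgn (n x)) (by rw [← hzz]; exact j5), j4,
          j3.trans e1.symm, hzz]
        constructor <;> intro h <;> linarith
    · have h0 := (hM (-M) le_rfl)
      have : n (-M) = 0 := by
        have h1 := hn (-M)
        rw [show D.varTo (-M) = varIic D.w₀ (-M) from rfl, h0.2] at h1
        rcases mul_eq_zero.1 h1.symm with h | h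
        · exact_mod_cast h
        · exact absurd h hε.ne'
      rw [this, h0.1]
      simp
  refine ⟨fun p hp => ?_, fun p hp q hq hpq => ?_, fun p hp => ?_, fun x => ?_, fun p hp => ?_⟩
  · obtain ⟨_, _, _, _, _, _, h, _⟩ := hjump p hp
    exact h
  · exact (hpos p hp _).2 (hpq.trans ((hpos q hq _).1 le_rfl))
  · obtain ⟨z, hz, h1, h2, h3, h4, h5, h6, h7⟩ := hjump p hp
    have : D.waves.filter (fun q => q ≤ p) = Finset.Icc 1 p := by
      ext q
      rw [Finset.mem_filter, Finset.mem_Icc]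
      exact ⟨fun h => ⟨hone q h.1, h.2⟩, fun h => ⟨hmem q _ h.1 (h.2.trans h2), h.2⟩⟩
    rw [this, hsplit _ _ h1.le, hconst _ _ h1.le (D.sgn p) (fun q i1 i2 => h7 q i1 (i2.trans h2)),
      hatw, ← h3, h4, hw₀ z]
    ring
  · rw [hfilter, hw₀ x]
  · obtain ⟨z, hz, h1, h2, h3, h4, h5, h6, h7⟩ := hjump p hp
    have hd : (0 : ℝ) < n (D.pos₀ p) - n z := by
      rw [sub_pos, Nat.cast_lt]; omega
    have key : ∀ k : ℕ, n z ≤ k → k ≤ n (D.pos₀ p) →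
        D.w₀ z + D.sgn p * ((k - n z) * D.ε) ∈ convexHull ℝ (range D.w₀) := by
      intro k hk1 hk2
      have hk1' : (n z : ℝ) ≤ k := by exact_mod_cast hk1
      have hk2' : (k : ℝ) ≤ n (D.pos₀ p) := by exact_mod_cast hk2
      have := (convex_convexHull ℝ (range D.w₀)) (subset_convexHull ℝ _ (mem_range_self z))
        (subset_convexHull ℝ _ (mem_range_self (D.pos₀ p)))
        (show 0 ≤ (n (D.pos₀ p) - k) / ((n (D.pos₀ p) : ℝ) - n z) from
          div_nonneg (by linarith) hd.le)
        (show 0 ≤ (k - n z) / ((n (D.pos₀ p) : ℝ) - n z) from div_nonneg (by linarith) hd.le)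
        (by field_simp; ring)
      convert this using 1
      rw [smul_eq_mul, smul_eq_mul, h6]
      field_simp
      ring
    have e : D.hatw p = D.w₀ z + D.sgn p * ((p - n z) * D.ε) := by
      rw [hatw, ← h3, h4]; ring
    refine ⟨by rw [e]; exact key p h1.le h2, ?_⟩
    -- The left state of `p` is one grid step before its right state; `p - 1` is still at least `n
    -- z`.
    have := key (p - 1) (by omega) (by omega)
    rw [e]
    convert this using 1
    rw [Nat.cast_sub (by omega)]
    push_cast
    ring

end Data

/-! ### Ranks in finite sets of integers -/

/-- Number of elements of `G` up to `s`. -/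
def rank (G : Finset ℕ) (s : ℕ) : ℕ := (G.filter (· ≤ s)).card

theorem rank_le_card (G : Finset ℕ) (s : ℕ) : rank G s ≤ G.card :=
  Finset.card_le_card (Finset.filter_subset _ _)

theorem one_le_rank {G : Finset ℕ} {s : ℕ} (hs : s ∈ G) : 1 ≤ rank G s :=
  Finset.card_pos.2 ⟨s, Finset.mem_filter.2 ⟨hs, le_rfl⟩⟩

theorem rank_mono (G : Finset ℕ) {s t : ℕ} (h : s ≤ t) : rank G s ≤ rank G t := by
  apply Finset.card_le_card
  intro p hp
  rw [Finset.mem_filter] at hp ⊢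
  exact ⟨hp.1, hp.2.trans h⟩

theorem rank_lt {G : Finset ℕ} {s t : ℕ} (ht : t ∈ G) (h : s < t) : rank G s < rank G t := by
  apply Finset.card_lt_card
  rw [Finset.ssubset_iff_of_subset]
  · refine ⟨t, Finset.mem_filter.2 ⟨ht, le_rfl⟩, ?_⟩
    rw [Finset.mem_filter]
    omega
  · intro p hp
    rw [Finset.mem_filter] at hp ⊢
    exact ⟨hp.1, by omega⟩

theorem rank_injOn (G : Finset ℕ) : Set.InjOn (rank G) G := by
  intro s hs t ht h
  rcases lt_trichotomy s t with h' | h' | h'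
  · exact absurd h (rank_lt ht h').ne
  · exact h'
  · exact absurd h (rank_lt hs h').ne'

theorem rank_image (G : Finset ℕ) : G.image (rank G) = Finset.Icc 1 G.card := by
  apply Finset.eq_of_subset_of_card_le
  · intro i hi
    obtain ⟨s, hs, rfl⟩ := Finset.mem_image.1 hi
    exact Finset.mem_Icc.2 ⟨one_le_rank hs, rank_le_card G s⟩
  · rw [Finset.card_image_of_injOn (rank_injOn G), Nat.card_Icc]
    omega

theorem exists_rank_eq {G : Finset ℕ} {i : ℕ} (h1 : 1 ≤ i) (h2 : i ≤ G.card) :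
    ∃ s ∈ G, rank G s = i := by
  have : i ∈ G.image (rank G) := by rw [rank_image]; exact Finset.mem_Icc.2 ⟨h1, h2⟩
  exact Finset.mem_image.1 this

namespace Data

variable {D : Data}

/-! ### Riemann problems -/

/-- The waves of `G` have the sign `σ` and fill the jump of `G.card` cells from the state `k ε`. -/
structure IsRiemann (D : Data) (G : Finset ℕ) (σ : ℝ) (k : ℤ) : Prop where
  nonempty : G.Nonempty
  sign : σ = 1 ∨ σ = -1
  sgn : ∀ s ∈ G, D.sgn s = σ
  hatw : ∀ s ∈ G, D.hatw s = (k + σ * rank G s) * D.ε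

/-- Ranks run bijectively through `1, …, G.card`, so the cells tile the jump. The ceiling locates a
state because positive cells are closed on the right. -/
theorem IsRiemann.span_pos (hε : 0 < D.ε) {G : Finset ℕ} {k : ℤ} (h : IsRiemann D G 1 k) :
    D.span G = Ioc (k * D.ε) ((k + G.card : ℤ) * D.ε) := by
  ext u
  simp only [span, mem_iUnion, exists_prop]
  constructor
  · rintro ⟨s, hs, hu⟩
    rw [cell, if_pos (by rw [h.sgn s hs]; norm_num), h.hatw s hs] at hu
    have h1 : (1 : ℝ) ≤ rank G s := by exact_mod_cast one_le_rank hs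
    have h2 : (rank G s : ℝ) ≤ G.card := by exact_mod_cast rank_le_card G s
    push_cast
    constructor
    · nlinarith [hu.1]
    · nlinarith [hu.2]
  · rintro ⟨hu1, hu2⟩
    have hc1 : k < ⌈u / D.ε⌉ := by rwa [Int.lt_ceil, lt_div_iff₀ hε]
    have hc2 : ⌈u / D.ε⌉ ≤ k + G.card := by rwa [Int.ceil_le, div_le_iff₀ hε]
    obtain ⟨s, hs, hr⟩ := exists_rank_eq (G := G) (i := (⌈u / D.ε⌉ - k).toNat)
      (by omega) (by omega)
    refine ⟨s, hs, ?_⟩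
    have e : (rank G s : ℝ) = ⌈u / D.ε⌉ - k := by
      have : (rank G s : ℤ) = ⌈u / D.ε⌉ - k := by omega
      exact_mod_cast this
    rw [cell, if_pos (by rw [h.sgn s hs]; norm_num), h.hatw s hs, e]
    have h1 := Int.le_ceil (u / D.ε)
    have h2 := Int.ceil_lt_add_one (u / D.ε)
    rw [div_le_iff₀ hε] at h1
    rw [← sub_lt_iff_lt_add, lt_div_iff₀ hε] at h2
    constructor <;> linarith

/-- Cells of negative waves are closed on the left, so the floor takes the role of the ceiling. -/
theorem IsRiemann.span_neg (hε : 0 < D.ε) {G : Finset ℕ} {k : ℤ} (h : IsRiemann D G (-1) k) :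
    D.span G = Ico ((k - G.card : ℤ) * D.ε) (k * D.ε) := by
  ext u
  simp only [span, mem_iUnion, exists_prop]
  constructor
  · rintro ⟨s, hs, hu⟩
    rw [cell, if_neg (by rw [h.sgn s hs]; norm_num), h.hatw s hs] at hu
    have h1 : (1 : ℝ) ≤ rank G s := by exact_mod_cast one_le_rank hs
    have h2 : (rank G s : ℝ) ≤ G.card := by exact_mod_cast rank_le_card G s
    push_cast
    constructor
    · nlinarith [hu.1]
    · nlinarith [hu.2]
  · rintro ⟨hu1, hu2⟩
    have hc1 : ⌊u / D.ε⌋ < k := by rwa [Int.floor_lt, div_lt_iff₀ hε]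
    have hc2 : k - G.card ≤ ⌊u / D.ε⌋ := by rwa [Int.le_floor, le_div_iff₀ hε]
    obtain ⟨s, hs, hr⟩ := exists_rank_eq (G := G) (i := (k - ⌊u / D.ε⌋).toNat)
      (by omega) (by omega)
    refine ⟨s, hs, ?_⟩
    have e : (rank G s : ℝ) = k - ⌊u / D.ε⌋ := by
      have : (rank G s : ℤ) = k - ⌊u / D.ε⌋ := by omega
      exact_mod_cast this
    rw [cell, if_neg (by rw [h.sgn s hs]; norm_num), h.hatw s hs, e]
    have h1 := Int.floor_le (u / D.ε)
    have h2 := Int.lt_floor_add_one (u / D.ε)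
    rw [le_div_iff₀ hε] at h1
    rw [div_lt_iff₀ hε] at h2
    constructor <;> linarith

theorem IsRiemann.card_pos {G : Finset ℕ} {σ : ℝ} {k : ℤ} (h : IsRiemann D G σ k) :
    0 < G.card := Finset.card_pos.2 h.nonempty

/-- Rank `r` occupies the grid cell of index `k + r - 1`: ranks start at one, and the index names
the left end of the cell. -/
theorem IsRiemann.entSpeed_pos (hε : 0 < D.ε) {G : Finset ℕ} {k : ℤ} (h : IsRiemann D G 1 k)
    (g : ℝ → ℝ) {s : ℕ} (hs : s ∈ G) :
    D.entSpeed g G s = deriv (convEnv (k * D.ε) ((k + G.card : ℤ) * D.ε) (gridInterp D.ε g))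
      (((k + rank G s - 1 : ℤ) + 1 / 2) * D.ε) := by
  have hlt : (k : ℝ) * D.ε < ((k + G.card : ℤ) : ℝ) * D.ε := by
    apply mul_lt_mul_of_pos_right _ hε
    have := h.card_pos
    exact_mod_cast (by omega : k < k + G.card)
  rw [entSpeed, if_pos (by rw [h.sgn s hs]; norm_num), h.span_pos hε, csInf_Ioc hlt,
    csSup_Ioc hlt, h.hatw s hs]
  congr 1
  push_cast
  ring

/-- Going down from `k`, the wave of rank `r` has `k - r` as the left end of its cell, without the
shift by one. -/
theorem IsRiemann.entSpeed_neg (hε : 0 < D.ε) {G : Finset ℕ} {k : ℤ} (h : IsRiemann D G (-1) k)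
    (g : ℝ → ℝ) {s : ℕ} (hs : s ∈ G) :
    D.entSpeed g G s = deriv (concEnv ((k - G.card : ℤ) * D.ε) (k * D.ε) (gridInterp D.ε g))
      (((k - rank G s : ℤ) + 1 / 2) * D.ε) := by
  have hlt : ((k - G.card : ℤ) : ℝ) * D.ε < (k : ℝ) * D.ε := by
    apply mul_lt_mul_of_pos_right _ hε
    have := h.card_pos
    exact_mod_cast (by omega : k - G.card < k)
  rw [entSpeed, if_neg (by rw [h.sgn s hs]; norm_num), h.span_neg hε, csInf_Ico hlt,
    csSup_Ico hlt, h.hatw s hs]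
  congr 1
  push_cast
  ring

/-- Entropic speeds increase along a Riemann problem. -/
theorem IsRiemann.entSpeed_mono (hε : 0 < D.ε) {G : Finset ℕ} {σ : ℝ} {k : ℤ}
    (h : IsRiemann D G σ k) {g : ℝ → ℝ} {C : ℝ} (hg : ∀ z, |g z| ≤ C) {s t : ℕ} (hs : s ∈ G)
    (ht : t ∈ G) (hst : s ≤ t) : D.entSpeed g G s ≤ D.entSpeed g G t := by
  have h1 : k + (rank G s : ℤ) - 1 ≤ k + rank G t - 1 := by
    have := rank_mono G hst
    omega
  have hs1 := one_le_rank hs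
  have ht1 := rank_le_card G t
  rcases h.sign with rfl | rfl
  · rw [h.entSpeed_pos hε g hs, h.entSpeed_pos hε g ht]
    apply deriv_convEnv_mono hε (fun z => (abs_le.1 (hg z)).1) h1
    · gcongr; omega
    · have : (((k + rank G t - 1 : ℤ) : ℝ) + 1) = ((k + rank G t : ℤ) : ℝ) := by push_cast; ring
      rw [this]
      gcongr
  · rw [h.entSpeed_neg hε g hs, h.entSpeed_neg hε g ht, deriv_concEnv, deriv_concEnv]
    apply neg_le_neg
    apply deriv_convEnv_mono hε (fun z => neg_le_neg (abs_le.1 (hg z)).2) (by omega)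
    · gcongr
    · have : (((k - rank G s : ℤ) : ℝ) + 1) = ((k - rank G s + 1 : ℤ) : ℝ) := by push_cast; ring
      rw [this]
      gcongr
      omega

/-- Entropic speeds inherit lower bounds for the derivative of the flux. -/
theorem IsRiemann.le_entSpeed (hε : 0 < D.ε) {G : Finset ℕ} {σ : ℝ} {k : ℤ}
    (h : IsRiemann D G σ k) {g : ℝ → ℝ} {C d : ℝ} (hg : ∀ z, |g z| ≤ C)
    (hd : MonotoneOn (fun u => g u - d * u) (Icc (sInf (D.span G)) (sSup (D.span G)))) {s : ℕ}
    (hs : s ∈ G) : d ≤ D.entSpeed g G s := by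
  have hs1 := one_le_rank hs
  have hs2 := rank_le_card G s
  have hcard := h.card_pos
  rcases h.sign with rfl | rfl
  · have hlt : (k : ℝ) * D.ε < ((k + G.card : ℤ) : ℝ) * D.ε := by
      apply mul_lt_mul_of_pos_right _ hε
      exact_mod_cast (by omega : k < k + G.card)
    rw [h.span_pos hε, csInf_Ioc hlt, csSup_Ioc hlt] at hd
    rw [h.entSpeed_pos hε g hs]
    exact le_deriv_convEnv hε (fun z => (abs_le.1 (hg z)).1) (by omega) (by omega)
      fun u hu => gridInterp_ge_left hε (by omega) hd hu
  · have hlt : ((k - G.card : ℤ) : ℝ) * D.ε < (k : ℝ) * D.ε := by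
      apply mul_lt_mul_of_pos_right _ hε
      exact_mod_cast (by omega : k - G.card < k)
    rw [h.span_neg hε, csInf_Ico hlt, csSup_Ico hlt] at hd
    rw [h.entSpeed_neg hε g hs, deriv_concEnv, le_neg]
    -- The speed is minus a slope for `-g`, so the lower bound becomes an upper bound, read at the
    -- right end of the jump.
    apply deriv_convEnv_le hε (fun z => neg_le_neg (abs_le.1 (hg z)).2) (by omega) (by omega)
    intro u hu
    have := gridInterp_le_right hε (by omega) hd hu
    simp only [gridInterp_neg]
    linarith

open Classical in
/-- The Riemann solver makes every wave travel with its entropic speed. -/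
theorem IsRiemann.riemannSolver_eq (hε : 0 < D.ε) {G : Finset ℕ} {σ : ℝ} {k : ℤ}
    (h : IsRiemann D G σ k) (g : ℝ → ℝ) (ξ : ℝ) :
    riemannSolver D.ε g (k * D.ε) ((k + σ * G.card) * D.ε) ξ =
      k * D.ε + D.ε * ∑ s ∈ G with D.entSpeed g G s ≤ ξ, D.sgn s := by
  have hcard : (0 : ℝ) < G.card := by exact_mod_cast h.card_pos
  have hsum : ∑ s ∈ G with D.entSpeed g G s ≤ ξ, D.sgn s =
      σ * (G.filter fun s => D.entSpeed g G s ≤ ξ).card := by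
    rw [Finset.sum_congr rfl (g := fun _ => σ) (fun s hs => h.sgn s (Finset.mem_filter.1 hs).1),
      Finset.sum_const, nsmul_eq_mul, mul_comm]
  rw [hsum, riemannSolver]
  rcases h.sign with rfl | rfl
  · rw [if_pos (by nlinarith)]
    -- The cells counted by the solver correspond to the waves through their ranks.
    have e : {m : ℤ | (k : ℝ) * D.ε ≤ m * D.ε ∧ ((m : ℝ) + 1) * D.ε ≤ (k + 1 * G.card) * D.ε ∧
        deriv (convEnv (k * D.ε) ((k + 1 * G.card) * D.ε) (gridInterp D.ε g))
          ((m + 1 / 2) * D.ε) ≤ ξ} =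
        (fun s => k + (rank G s : ℤ) - 1) ''
          ((G.filter fun s => D.entSpeed g G s ≤ ξ : Finset ℕ) : Set ℕ) := by
      ext m
      simp only [mem_ofPred_eq, mem_image, Finset.coe_filter]
      have ec : ((k : ℝ) + 1 * G.card) = ((k + G.card : ℤ) : ℝ) := by push_cast; ring
      have em : (m : ℝ) + 1 = ((m + 1 : ℤ) : ℝ) := by push_cast; ring
      rw [ec, mul_le_mul_iff_left₀ hε, em, mul_le_mul_iff_left₀ hε, Int.cast_le, Int.cast_le]
      constructor
      · rintro ⟨h1, h2, h3⟩
        obtain ⟨s, hs, hr⟩ := exists_rank_eq (G := G) (i := (m + 1 - k).toNat)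
          (by omega) (by omega)
        have hm : k + (rank G s : ℤ) - 1 = m := by omega
        refine ⟨s, ⟨hs, ?_⟩, hm⟩
        rw [h.entSpeed_pos hε g hs, hm]
        exact h3
      · rintro ⟨s, ⟨hs, h3⟩, rfl⟩
        have := one_le_rank hs
        have := rank_le_card G s
        rw [h.entSpeed_pos hε g hs] at h3
        exact ⟨by omega, by omega, h3⟩
    rw [e, Set.InjOn.ncard_image, Set.ncard_coe_finset]
    · ring
    · intro s hs t ht hst
      simp only [Finset.coe_filter, mem_ofPred_eq] at hs ht
      exact rank_injOn G hs.1 ht.1 (by simp only at hst; omega)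
  · rw [if_neg (by push Not; nlinarith)]
    have e : {m : ℤ | ((k : ℝ) + -1 * G.card) * D.ε ≤ m * D.ε ∧ ((m : ℝ) + 1) * D.ε ≤ k * D.ε ∧
        deriv (concEnv ((k + -1 * G.card) * D.ε) (k * D.ε) (gridInterp D.ε g))
          ((m + 1 / 2) * D.ε) ≤ ξ} =
        (fun s => k - (rank G s : ℤ)) ''
          ((G.filter fun s => D.entSpeed g G s ≤ ξ : Finset ℕ) : Set ℕ) := by
      ext m
      simp only [mem_ofPred_eq, mem_image, Finset.coe_filter]
      have ec : ((k : ℝ) + -1 * G.card) = ((k - G.card : ℤ) : ℝ) := by push_cast; ring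
      have em : (m : ℝ) + 1 = ((m + 1 : ℤ) : ℝ) := by push_cast; ring
      rw [ec, mul_le_mul_iff_left₀ hε, em, mul_le_mul_iff_left₀ hε, Int.cast_le, Int.cast_le]
      constructor
      · rintro ⟨h1, h2, h3⟩
        obtain ⟨s, hs, hr⟩ := exists_rank_eq (G := G) (i := (k - m).toNat)
          (by omega) (by omega)
        have hm : k - (rank G s : ℤ) = m := by omega
        refine ⟨s, ⟨hs, ?_⟩, hm⟩
        rw [h.entSpeed_neg hε g hs, hm]
        exact h3
      · rintro ⟨s, ⟨hs, h3⟩, rfl⟩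
        have := one_le_rank hs
        have := rank_le_card G s
        rw [h.entSpeed_neg hε g hs] at h3
        exact ⟨by omega, by omega, h3⟩
    rw [e, Set.InjOn.ncard_image, Set.ncard_coe_finset]
    · ring
    · intro s hs t ht hst
      simp only [Finset.coe_filter, mem_ofPred_eq] at hs ht
      exact rank_injOn G hs.1 ht.1 (by simp only at hst; omega)

end Data

/-! ### Cancellation -/

theorem card_rank_le {G : Finset ℕ} {a : ℕ} (ha : a ≤ G.card) :
    (G.filter fun s => rank G s ≤ a).card = a := by
  have h : (G.filter fun s => rank G s ≤ a).image (rank G) = Finset.Icc 1 a := by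
    ext i
    simp only [Finset.mem_image, Finset.mem_filter, Finset.mem_Icc]
    constructor
    · rintro ⟨s, ⟨hs, h⟩, rfl⟩
      exact ⟨one_le_rank hs, h⟩
    · rintro ⟨h1, h2⟩
      obtain ⟨s, hs, rfl⟩ := exists_rank_eq h1 (h2.trans ha)
      exact ⟨s, ⟨hs, h2⟩, rfl⟩
  have h' := congrArg Finset.card h
  rw [Finset.card_image_of_injOn ((rank_injOn G).mono (Finset.coe_subset.2
    (Finset.filter_subset _ _))), Nat.card_Icc] at h'
  omega

theorem card_lt_rank {G : Finset ℕ} {a : ℕ} (ha : a ≤ G.card) :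
    (G.filter fun s => ¬ rank G s ≤ a).card = G.card - a := by
  have h1 := Finset.card_filter_add_card_filter_not (s := G) (fun s => rank G s ≤ a)
  rw [card_rank_le ha] at h1
  omega

theorem sum_eq_mul_card {A : Finset ℕ} {e : ℕ → ℝ} {σ : ℝ} (h : ∀ p ∈ A, e p = σ) :
    ∑ p ∈ A, e p = σ * A.card := by
  rw [Finset.sum_congr rfl h, Finset.sum_const, nsmul_eq_mul, mul_comm]

open Classical in
/-- Interaction of two groups of waves, with signs `σ` and `τ`: the cancelled waves sum up to
zero, and the surviving ones have the same sign. -/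
theorem cancellation {A : Finset ℕ} {e : ℕ → ℝ} {P : ℕ → Prop} {σ τ : ℝ}
    (hσ : σ = 1 ∨ σ = -1) (hτ : τ = 1 ∨ τ = -1)
    (hP : ∀ p ∈ A, P p → e p = σ) (hN : ∀ p ∈ A, ¬ P p → e p = τ)
    (hlt : ∀ p ∈ A, P p → ∀ q ∈ A, ¬ P q → p < q)
    {S : ℕ → Prop} (hS : ∀ s ∈ A, (S s ↔ 0 ≤ e s * ∑ p ∈ A with p ≤ s, e p - 1 ∧
      e s * ∑ p ∈ A with p ≤ s, e p ≤ e s * ∑ p ∈ A, e p)) :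
    (∀ s ∈ A, S s → ∀ t ∈ A, S t → e s = e t) ∧
    (∀ s ∈ A, S s → ∑ p ∈ A with ¬ S p ∧ p ≤ s, e p = 0) ∧
    ∑ p ∈ A with ¬ S p, e p = 0 := by
  set L := A.filter P with hL
  set R := A.filter (fun p => ¬ P p) with hR
  have memL : ∀ p, p ∈ L ↔ p ∈ A ∧ P p := fun p => Finset.mem_filter
  have memR : ∀ p, p ∈ R ↔ p ∈ A ∧ ¬ P p := fun p => Finset.mem_filter
  have HL : ∀ s ∈ A, P s → ∑ p ∈ A with p ≤ s, e p = σ * rank L s := by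
    intro s hs hPs
    have : A.filter (· ≤ s) = L.filter (· ≤ s) := by
      ext p
      simp only [Finset.mem_filter, memL]
      constructor
      · rintro ⟨h1, h2⟩
        refine ⟨⟨h1, ?_⟩, h2⟩
        by_contra hn
        have := hlt s hs hPs p h1 hn
        omega
      · rintro ⟨⟨h1, -⟩, h2⟩
        exact ⟨h1, h2⟩
    rw [this, sum_eq_mul_card (σ := σ)]
    · rfl
    · intro p hp
      rw [Finset.mem_filter, memL] at hp
      exact hP p hp.1.1 hp.1.2
  have HR : ∀ s ∈ A, ¬ P s → ∑ p ∈ A with p ≤ s, e p = σ * L.card + τ * rank R s := by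
    intro s hs hPs
    have : A.filter (· ≤ s) = L ∪ R.filter (· ≤ s) := by
      ext p
      simp only [Finset.mem_filter, Finset.mem_union, memL, memR]
      constructor
      · rintro ⟨h1, h2⟩
        by_cases h : P p
        · exact Or.inl ⟨h1, h⟩
        · exact Or.inr ⟨⟨h1, h⟩, h2⟩
      · rintro (⟨h1, h2⟩ | ⟨⟨h1, -⟩, h2⟩)
        · exact ⟨h1, (hlt p h1 h2 s hs hPs).le⟩
        · exact ⟨h1, h2⟩
    rw [this, Finset.sum_union, sum_eq_mul_card (σ := σ), sum_eq_mul_card (σ := τ)]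
    · rfl
    · intro p hp
      rw [Finset.mem_filter, memR] at hp
      exact hN p hp.1.1 hp.1.2
    · intro p hp
      rw [memL] at hp
      exact hP p hp.1 hp.2
    · rw [Finset.disjoint_left]
      intro p h1 h2
      rw [memL] at h1
      rw [Finset.mem_filter, memR] at h2
      exact h2.1.2 h1.2
  have HT : ∑ p ∈ A, e p = σ * L.card + τ * R.card := by
    rw [← Finset.sum_filter_add_sum_filter_not A P, sum_eq_mul_card (σ := σ),
      sum_eq_mul_card (σ := τ)]
    · intro p hp
      rw [Finset.mem_filter] at hp
      exact hN p hp.1 hp.2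
    · intro p hp
      rw [Finset.mem_filter] at hp
      exact hP p hp.1 hp.2
  have hσσ : σ * σ = 1 := by rcases hσ with h | h <;> rw [h] <;> norm_num
  have rL : ∀ s ∈ A, P s → (1 : ℝ) ≤ rank L s ∧ (rank L s : ℝ) ≤ L.card := fun s h1 h2 =>
    ⟨by exact_mod_cast one_le_rank ((memL s).2 ⟨h1, h2⟩), by exact_mod_cast rank_le_card L s⟩
  have rR : ∀ s ∈ A, ¬ P s → (1 : ℝ) ≤ rank R s ∧ (rank R s : ℝ) ≤ R.card := fun s h1 h2 =>
    ⟨by exact_mod_cast one_le_rank ((memR s).2 ⟨h1, h2⟩), by exact_mod_cast rank_le_card R s⟩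
  have hl0 : (0 : ℝ) ≤ L.card := Nat.cast_nonneg _
  have hr0 : (0 : ℝ) ≤ R.card := Nat.cast_nonneg _
  -- Equal signs: every wave survives.
  by_cases hst : τ = σ
  · subst hst
    have hall : ∀ s ∈ A, S s := by
      intro s hs
      rw [hS s hs, HT]
      by_cases h : P s
      · rw [HL s hs h, hP s hs h]
        obtain ⟨h1, h2⟩ := rL s hs h
        constructor <;> nlinarith
      · rw [HR s hs h, hN s hs h]
        obtain ⟨h1, h2⟩ := rR s hs h
        constructor <;> nlinarith
    have hsame : ∀ s ∈ A, e s = τ := fun s hs => by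
      by_cases h : P s
      · exact hP s hs h
      · exact hN s hs h
    refine ⟨fun s hs _ t ht _ => (hsame s hs).trans (hsame t ht).symm, fun s _ _ => ?_, ?_⟩
    · rw [Finset.filter_false_of_mem (fun p hp h => h.1 (hall p hp)), Finset.sum_empty]
    · rw [Finset.filter_false_of_mem (fun p hp h => h (hall p hp)), Finset.sum_empty]
  · have hτσ : τ = -σ := by
      rcases hσ with h | h <;> rcases hτ with h' | h'
      · exact absurd (h'.trans h.symm) hst
      · rw [h, h']
      · rw [h, h', neg_neg]
      · exact absurd (h'.trans h.symm) hst
    subst hτσ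
    -- Opposite signs: the survivors are the first `L.card - R.card` waves of the left group, or the
    -- waves of the right group with rank above `L.card`. At most one of these sets is nonempty.
    have SL : ∀ s ∈ A, P s → (S s ↔ rank L s + R.card ≤ L.card) := by
      intro s hs h
      rw [hS s hs, HT, HL s hs h, hP s hs h]
      obtain ⟨h1, h2⟩ := rL s hs h
      rw [← Nat.cast_le (α := ℝ)]
      push_cast
      constructor
      · rintro ⟨-, h4⟩; nlinarith
      · intro h3; constructor <;> nlinarith
    have SR : ∀ s ∈ A, ¬ P s → (S s ↔ L.card + 1 ≤ rank R s) := by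
      intro s hs h
      rw [hS s hs, HT, HR s hs h, hN s hs h]
      obtain ⟨h1, h2⟩ := rR s hs h
      rw [← Nat.cast_le (α := ℝ)]
      push_cast
      constructor
      · rintro ⟨h4, -⟩; nlinarith
      · intro h3; constructor <;> nlinarith
    rcases le_or_gt R.card L.card with hle | hle
    · have survL : ∀ s ∈ A, S s → P s := by
        intro s hs h
        by_contra hn
        rw [SR s hs hn] at h
        have := rank_le_card R s
        omega
      refine ⟨fun s hs h t ht h' => ?_, fun s hs h => ?_, ?_⟩
      · rw [hP s hs (survL s hs h), hP t ht (survL t ht h')]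
      · rw [Finset.filter_false_of_mem, Finset.sum_empty]
        rintro p hp ⟨h1, h2⟩
        have hPs := survL s hs h
        have hPp : P p := by
          by_contra hn
          have := hlt s hs hPs p hp hn
          omega
        rw [SL p hp hPp] at h1
        rw [SL s hs hPs] at h
        have := rank_mono L h2
        omega
      · have : A.filter (fun p => ¬ S p) =
            L.filter (fun s => ¬ rank L s ≤ L.card - R.card) ∪ R := by
          ext p
          simp only [Finset.mem_filter, Finset.mem_union, memL, memR]
          constructor
          · rintro ⟨h1, h2⟩
            by_cases h : P p
            · rw [SL p h1 h] at h2
              exact Or.inl ⟨⟨h1, h⟩, by omega⟩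
            · exact Or.inr ⟨h1, h⟩
          · rintro (⟨⟨h1, h⟩, h2⟩ | ⟨h1, h⟩)
            · refine ⟨h1, ?_⟩
              rw [SL p h1 h]
              omega
            · exact ⟨h1, fun h' => h (survL p h1 h')⟩
        rw [this, Finset.sum_union, sum_eq_mul_card (σ := σ), sum_eq_mul_card (σ := -σ),
          card_lt_rank (by omega)]
        · rw [show L.card - (L.card - R.card) = R.card by omega]
          ring
        · intro p hp
          rw [memR] at hp
          exact hN p hp.1 hp.2
        · intro p hp
          rw [Finset.mem_filter, memL] at hp
          exact hP p hp.1.1 hp.1.2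
        · rw [Finset.disjoint_left]
          intro p h1 h2
          rw [Finset.mem_filter, memL] at h1
          rw [memR] at h2
          exact h2.2 h1.1.2
    · have survR : ∀ s ∈ A, S s → ¬ P s := by
        intro s hs h hn
        rw [SL s hs hn] at h
        omega
      have hnot : ∑ p ∈ A with ¬ S p, e p = 0 := by
        have : A.filter (fun p => ¬ S p) =
            L ∪ R.filter (fun s => rank R s ≤ L.card) := by
          ext p
          simp only [Finset.mem_filter, Finset.mem_union, memL, memR]
          constructor
          · rintro ⟨h1, h2⟩
            by_cases h : P p
            · exact Or.inl ⟨h1, h⟩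
            · rw [SR p h1 h] at h2
              exact Or.inr ⟨⟨h1, h⟩, by omega⟩
          · rintro (⟨h1, h⟩ | ⟨⟨h1, h⟩, h2⟩)
            · exact ⟨h1, fun h' => survR p h1 h' h⟩
            · refine ⟨h1, ?_⟩
              rw [SR p h1 h]
              omega
        rw [this, Finset.sum_union, sum_eq_mul_card (σ := σ), sum_eq_mul_card (σ := -σ),
          card_rank_le hle.le]
        · ring
        · intro p hp
          rw [Finset.mem_filter, memR] at hp
          exact hN p hp.1.1 hp.1.2
        · intro p hp
          rw [memL] at hp
          exact hP p hp.1 hp.2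
        · rw [Finset.disjoint_left]
          intro p h1 h2
          rw [Finset.mem_filter, memR] at h2
          rw [memL] at h1
          exact h2.1.2 h1.2
      refine ⟨fun s hs h t ht h' => ?_, fun s hs h => ?_, hnot⟩
      · rw [hN s hs (survR s hs h), hN t ht (survR t ht h')]
      -- Every cancelled wave precedes a survivor of the right group, so the partial sum is the full
      -- one.
      · rw [← hnot]
        congr 1
        ext p
        simp only [Finset.mem_filter]
        refine ⟨fun hp => ⟨hp.1, hp.2.1⟩, fun hp => ⟨hp.1, hp.2, ?_⟩⟩
        have hPs := survR s hs h
        by_cases hPp : P p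
        · exact (hlt p hp.1 hPp s hs hPs).le
        · have h1 := hp.2
          rw [SR p hp.1 hPp] at h1
          rw [SR s hs hPs] at h
          by_contra hcon
          have := rank_mono R (show s ≤ p by omega)
          omega

open Filter Topology in
theorem leftLim_step (F : Finset ℕ) (X c : ℕ → ℝ) (ε : ℝ) (a : ℝ) :
    Function.leftLim (fun x => ε * ∑ q ∈ F with X q ≤ x, c q) a =
      ε * ∑ q ∈ F with X q < a, c q := by
  apply leftLim_eq_of_tendsto
  apply tendsto_const_nhds.congr'
  have : ∀ᶠ x in 𝓝[<] a, ∀ q ∈ F, (X q ≤ x ↔ X q < a) := by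
    rw [Filter.eventually_all_finset]
    intro q _
    rcases lt_or_ge (X q) a with h | h
    · filter_upwards [Ioo_mem_nhdsLT h] with x hx
      exact ⟨fun _ => h, fun _ => hx.1.le⟩
    · filter_upwards [self_mem_nhdsWithin] with x hx
      rw [mem_Iio] at hx
      exact ⟨fun h' => by linarith, fun h' => by linarith⟩
  filter_upwards [this] with x hx
  rw [Finset.filter_congr hx]

theorem riemannSolver_self {ε : ℝ} (hε : 0 < ε) (g : ℝ → ℝ) (u ξ : ℝ) :
    riemannSolver ε g u u ξ = u := by
  rw [riemannSolver, if_pos le_rfl]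
  have : {m : ℤ | u ≤ m * ε ∧ (m + 1) * ε ≤ u ∧
      deriv (convEnv u u (gridInterp ε g)) ((m + 1 / 2) * ε) ≤ ξ} = ∅ := by
    rw [Set.eq_empty_iff_forall_notMem]
    rintro m ⟨h1, h2, -⟩
    nlinarith
  rw [this]
  simp

namespace Data

variable {D : Data}

/-! ### Tracing of the waves -/

/-- The standing assumptions. -/
structure IsRegular (D : Data) : Prop where
  eps_pos : 0 < D.ε
  flux : IsAdmissibleFlux D.f
  step_w₀ : IsGridStep D.ε D.w₀
  step_v₀ : IsGridStep D.ε D.v₀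
  speed_gt : ∀ w ∈ convexHull ℝ (range D.w₀), ∀ v ∈ range D.v₀, -1 < dw D.f w v
  collisions : D.IsCollisionSequence

/-- Real position of a live wave. -/
noncomputable def loc (D : Data) (j s : ℕ) : ℝ := (D.node j s).untopD 0

/-- Position at time `τ` of a wave that travels freely after `time j`. -/
noncomputable def path (D : Data) (j s : ℕ) (τ : ℝ) : ℝ := D.loc j s + D.speed j s * (τ - D.time j)

open Classical in
/-- The live waves at a point. -/
noncomputable def group (D : Data) (j : ℕ) (a : ℝ) : Finset ℕ :=
  (D.live j).filter fun s => D.loc j s = a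

theorem mem_live {j s : ℕ} : s ∈ D.live j ↔ s ∈ D.waves ∧ D.node j s ≠ ⊤ := by
  classical exact Finset.mem_filter

theorem mem_group {j s : ℕ} {a : ℝ} : s ∈ D.group j a ↔ s ∈ D.live j ∧ D.loc j s = a := by
  classical exact Finset.mem_filter

theorem node_eq_loc {j s : ℕ} (hs : s ∈ D.live j) : D.node j s = (D.loc j s : WithTop ℝ) := by
  have h := (mem_live.1 hs).2
  rw [loc]
  cases hn : D.node j s with
  | top => exact absurd hn h
  | coe a => rfl

theorem mem_group_loc {j s : ℕ} (hs : s ∈ D.live j) : s ∈ D.group j (D.loc j s) :=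
  mem_group.2 ⟨hs, rfl⟩

open Classical in
theorem filter_node_eq {j s : ℕ} (hs : s ∈ D.live j) :
    D.waves.filter (fun p => D.node j p = D.node j s) = D.group j (D.loc j s) := by
  ext p
  rw [Finset.mem_filter, mem_group]
  constructor
  · rintro ⟨h1, h2⟩
    have hp : p ∈ D.live j := mem_live.2 ⟨h1, by rw [h2]; exact (mem_live.1 hs).2⟩
    refine ⟨hp, ?_⟩
    rw [loc, h2, loc]
  · rintro ⟨h1, h2⟩
    refine ⟨(mem_live.1 h1).1, ?_⟩
    rw [node_eq_loc h1, h2, node_eq_loc hs]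

theorem speed_eq {j s : ℕ} (hs : s ∈ D.live j) : D.speed j s =
    D.entSpeed (fun w => D.f w (D.v (D.time j) (D.loc j s))) (D.group j (D.loc j s)) s := by
  classical
  rw [speed, speedOf, filter_node_eq hs]
  rfl

open Classical in
/-- The solution at `time j` is traced by the waves. -/
structure Traced (D : Data) (j : ℕ) : Prop where
  mono : ∀ p ∈ D.live j, ∀ q ∈ D.live j, p ≤ q → D.loc j p ≤ D.loc j q
  sgn_eq : ∀ p ∈ D.live j, ∀ q ∈ D.live j, D.loc j p = D.loc j q → D.sgn p = D.sgn q
  hatw_eq : ∀ p ∈ D.live j, D.hatw p = D.ε * ∑ q ∈ D.live j with q ≤ p, D.sgn q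
  w_eq : ∀ x, D.w j x = D.ε * ∑ q ∈ D.live j with D.loc j q ≤ x, D.sgn q

theorem IsRegular.sgn_cases (hD : IsRegular D) {j p : ℕ} (hp : p ∈ D.live j) :
    D.sgn p = 1 ∨ D.sgn p = -1 :=
  (initial_waves hD.eps_pos hD.step_w₀).1 p (mem_live.1 hp).1

theorem live_zero : D.live 0 = D.waves := by
  ext p
  rw [mem_live]
  simp [node]

theorem IsRegular.traced_zero (hD : IsRegular D) : Traced D 0 := by
  classical
  obtain ⟨-, h2, h3, h4, -⟩ := initial_waves hD.eps_pos hD.step_w₀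
  have hloc : ∀ p, D.loc 0 p = D.pos₀ p := fun p => rfl
  refine ⟨?_, ?_, ?_, ?_⟩
  · simpa only [live_zero, hloc] using h2
  · intro p _ q _ h
    rw [hloc, hloc] at h
    rw [sgn, sgn, h]
  · simpa only [live_zero] using h3
  · intro x
    simp only [live_zero, hloc]
    exact h4 x

theorem IsRegular.exists_flux_bound (hD : IsRegular D) : ∃ C, ∀ w v, |D.f w v| ≤ C := by
  obtain ⟨C, hC⟩ := hD.flux.bounded
  refine ⟨C, fun w v => ?_⟩
  have := hC 0 (by norm_num) (w, v)
  rwa [norm_iteratedFDeriv_zero, Real.norm_eq_abs] at this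

theorem IsRegular.exists_int_sum (hD : IsRegular D) {j : ℕ} {F : Finset ℕ}
    (hF : F ⊆ D.live j) : ∃ k : ℤ, ∑ q ∈ F, D.sgn q = k := by
  apply Finset.sum_induction _ (fun x : ℝ => ∃ k : ℤ, x = k)
  · rintro a b ⟨k, rfl⟩ ⟨l, rfl⟩
    exact ⟨k + l, by push_cast; rfl⟩
  · exact ⟨0, by simp⟩
  · intro q hq
    rcases hD.sgn_cases (hF hq) with h | h
    · exact ⟨1, by rw [h]; simp⟩
    · exact ⟨-1, by rw [h]; simp⟩

namespace Traced

variable {j : ℕ}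

open Classical in
theorem leftLim_w (h : Traced D j) (a : ℝ) :
    Function.leftLim (D.w j) a = D.ε * ∑ q ∈ D.live j with D.loc j q < a, D.sgn q := by
  rw [← leftLim_step]
  congr 1
  funext x
  exact h.w_eq x

open Classical in
theorem sum_le_eq (h : Traced D j) {s : ℕ} (hs : s ∈ D.live j) :
    ∑ q ∈ D.live j with q ≤ s, D.sgn q =
      ∑ q ∈ D.live j with D.loc j q < D.loc j s, D.sgn q +
        ∑ q ∈ D.group j (D.loc j s) with q ≤ s, D.sgn q := by
  rw [← Finset.sum_union]
  · congr 1
    ext q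
    simp only [Finset.mem_filter, Finset.mem_union, mem_group]
    constructor
    · rintro ⟨h1, h2⟩
      rcases (h.mono q h1 s hs h2).lt_or_eq with h3 | h3
      · exact Or.inl ⟨h1, h3⟩
      · exact Or.inr ⟨⟨h1, h3⟩, h2⟩
    · rintro (⟨h1, h2⟩ | ⟨⟨h1, -⟩, h2⟩)
      · refine ⟨h1, ?_⟩
        by_contra hlt
        have := h.mono s hs q h1 (by omega)
        linarith
      · exact ⟨h1, h2⟩
  · rw [Finset.disjoint_left]
    intro q h1 h2
    simp only [Finset.mem_filter, mem_group] at h1 h2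
    exact h1.2.ne h2.1.2

/-- The signs of the waves strictly to the left add up to the integer `k`, which is the left state
in grid units; inside the group the partial sums advance by one common sign. This identifies the
waves at a point with the Riemann problem solved there. -/
theorem isRiemann (h : Traced D j) (hD : IsRegular D) {s : ℕ} (hs : s ∈ D.live j) :
    ∃ k : ℤ, IsRiemann D (D.group j (D.loc j s)) (D.sgn s) k ∧
      Function.leftLim (D.w j) (D.loc j s) = k * D.ε ∧
      D.w j (D.loc j s) = (k + D.sgn s * (D.group j (D.loc j s)).card) * D.ε := by
  classical
  obtain ⟨k, hk⟩ := hD.exists_int_sum (D := D) (j := j)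
    (F := (D.live j).filter fun q => D.loc j q < D.loc j s) (Finset.filter_subset _ _)
  have hsg : ∀ p ∈ D.group j (D.loc j s), D.sgn p = D.sgn s := by
    intro p hp
    rw [mem_group] at hp
    exact h.sgn_eq p hp.1 s hs hp.2
  refine ⟨k, ⟨⟨s, mem_group_loc hs⟩, hD.sgn_cases hs, hsg, ?_⟩, ?_, ?_⟩
  · intro p hp
    have hp' := mem_group.1 hp
    rw [h.hatw_eq p hp'.1, h.sum_le_eq hp'.1, hp'.2, hk, sum_eq_mul_card (σ := D.sgn s)]
    · rw [rank]; ring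
    · intro q hq
      exact hsg q (Finset.mem_filter.1 hq).1
  · rw [h.leftLim_w, hk]; ring
  · rw [h.w_eq]
    have : (D.live j).filter (fun q => D.loc j q ≤ D.loc j s) =
        (D.live j).filter (fun q => D.loc j q < D.loc j s) ∪ D.group j (D.loc j s) := by
      ext q
      simp only [Finset.mem_filter, Finset.mem_union, mem_group, le_iff_lt_or_eq]
      tauto
    rw [this, Finset.sum_union, hk, sum_eq_mul_card hsg]
    · ring
    · rw [Finset.disjoint_left]
      intro q h1 h2
      rw [Finset.mem_filter] at h1
      rw [mem_group] at h2
      exact h1.2.ne h2.2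

open Classical in
theorem fan_eq (h : Traced D j) (hD : IsRegular D) (a ξ : ℝ) :
    D.fan j (D.w j) a ξ = Function.leftLim (D.w j) a +
      D.ε * ∑ s ∈ D.group j a with D.speed j s ≤ ξ, D.sgn s := by
  by_cases hne : (D.group j a).Nonempty
  · obtain ⟨s, hs⟩ := hne
    rw [mem_group] at hs
    obtain ⟨hs, rfl⟩ := hs
    obtain ⟨k, h1, h2, h3⟩ := h.isRiemann hD hs
    rw [fan, h2, h3, h1.riemannSolver_eq hD.eps_pos]
    congr 3
    apply Finset.filter_congr
    intro p hp
    rw [mem_group] at hp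
    rw [speed_eq hp.1, hp.2]
  · rw [Finset.not_nonempty_iff_eq_empty] at hne
    have : D.w j a = Function.leftLim (D.w j) a := by
      rw [h.leftLim_w, h.w_eq]
      congr 2
      apply Finset.filter_congr
      intro q hq
      refine ⟨fun h' => h'.lt_of_ne ?_, le_of_lt⟩
      intro heq
      have : q ∈ D.group j a := mem_group.2 ⟨hq, heq⟩
      rw [hne] at this
      simp at this
    rw [hne, fan, this, riemannSolver_self hD.eps_pos]
    simp

/-- Every live wave sits on a front of the second family. -/
theorem front_mem (h : Traced D j) (hD : IsRegular D) {s : ℕ} (hs : s ∈ D.live j) :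
    Front.second (D.loc j s) (D.speed j s) ∈ D.fronts j := by
  classical
  change ¬ ContinuousAt (D.fan j (D.w j) (D.loc j s)) (D.speed j s)
  intro hc
  have hε := hD.eps_pos
  -- Lowering the slope below the speed of `s` drops `s` from a sum of terms of one sign, so the fan
  -- changes by at least `ε`.
  obtain ⟨δ, hδ, hd⟩ := Metric.continuousAt_iff.1 hc D.ε hε
  have := hd (x := D.speed j s - δ / 2) (by
    rw [Real.dist_eq, sub_sub_cancel_left, abs_neg, abs_of_pos] <;> linarith)
  rw [Real.dist_eq, h.fan_eq hD, h.fan_eq hD, add_sub_add_left_eq_sub, ← mul_sub] at this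
  have e : ∀ ξ, ∑ p ∈ D.group j (D.loc j s) with D.speed j p ≤ ξ, D.sgn p =
      D.sgn s * ((D.group j (D.loc j s)).filter fun p => D.speed j p ≤ ξ).card := by
    intro ξ
    apply sum_eq_mul_card
    intro p hp
    rw [Finset.mem_filter, mem_group] at hp
    exact h.sgn_eq p hp.1.1 s hs hp.1.2
  have hlt : ((D.group j (D.loc j s)).filter fun p => D.speed j p ≤ D.speed j s - δ / 2).card <
      ((D.group j (D.loc j s)).filter fun p => D.speed j p ≤ D.speed j s).card := by
    apply Finset.card_lt_card
    rw [Finset.ssubset_iff_of_subset]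
    · refine ⟨s, Finset.mem_filter.2 ⟨mem_group_loc hs, le_rfl⟩, ?_⟩
      rw [Finset.mem_filter]
      rintro ⟨-, h'⟩
      linarith
    · intro p hp
      rw [Finset.mem_filter] at hp ⊢
      exact ⟨hp.1, by linarith [hp.2]⟩
  rw [e, e, ← mul_sub, abs_mul, abs_mul, abs_of_pos hε] at this
  have hs1 : |D.sgn s| = 1 := by
    rcases hD.sgn_cases hs with h' | h' <;> rw [h'] <;> simp
  have h1 : ((((D.group j (D.loc j s)).filter fun p => D.speed j p ≤ D.speed j s - δ / 2).card : ℕ)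
      : ℝ) + 1 ≤ ((D.group j (D.loc j s)).filter fun p => D.speed j p ≤ D.speed j s).card := by
    exact_mod_cast hlt
  rw [hs1, one_mul, abs_sub_comm, abs_of_nonneg (by linarith)] at this
  nlinarith

theorem speed_mono (h : Traced D j) (hD : IsRegular D) {s t : ℕ} (hs : s ∈ D.live j)
    (ht : t ∈ D.live j) (hst : s ≤ t) (hloc : D.loc j s = D.loc j t) :
    D.speed j s ≤ D.speed j t := by
  obtain ⟨C, hC⟩ := hD.exists_flux_bound
  obtain ⟨k, h1, -⟩ := h.isRiemann hD hs
  rw [speed_eq hs, speed_eq ht, ← hloc]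
  exact h1.entSpeed_mono hD.eps_pos (fun z => hC z _) (mem_group_loc hs)
    (mem_group.2 ⟨ht, hloc.symm⟩) hst

/-- Two live waves that meet later on sit on fronts that collide. -/
theorem collide (h : Traced D j) (hD : IsRegular D) {s t : ℕ} (hs : s ∈ D.live j)
    (ht : t ∈ D.live j) (hne : ¬ (D.loc j s = D.loc j t ∧ D.speed j s = D.speed j t)) {τ : ℝ}
    (heq : D.path j s τ = D.path j t τ) : D.Collide j τ (D.path j s τ) := by
  refine ⟨_, h.front_mem hD hs, _, h.front_mem hD ht, ?_, rfl, heq.symm⟩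
  intro h'
  rw [Front.second.injEq] at h'
  exact hne h'

/-- Waves do not cross before the next collision. -/
theorem path_mono (h : Traced D j) (hD : IsRegular D) (hj : j < D.J) {s t : ℕ}
    (hs : s ∈ D.live j) (ht : t ∈ D.live j) (hst : s ≤ t) {τ : ℝ} (h1 : D.time j ≤ τ)
    (h2 : τ ≤ D.time (j + 1)) : D.path j s τ ≤ D.path j t τ := by
  rcases (h.mono s hs t ht hst).eq_or_lt with he | hlt
  · rw [path, path, he]
    have := h.speed_mono hD hs ht hst he
    gcongr
  · by_contra hcon
    push Not at hcon
    simp only [path] at hcon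
    have hd : 0 < D.speed j s - D.speed j t := by
      by_contra hle
      push Not at hle
      nlinarith
    -- The crossing time of the two paths: it would be a collision strictly before the next one.
    set τ' := D.time j + (D.loc j t - D.loc j s) / (D.speed j s - D.speed j t) with hτ'
    have hpos : D.time j < τ' := by
      have : 0 < (D.loc j t - D.loc j s) / (D.speed j s - D.speed j t) :=
        div_pos (by linarith) hd
      linarith
    have hlt' : τ' < τ := by
      rw [hτ', ← lt_sub_iff_add_lt', div_lt_iff₀ hd]
      linarith
    have heq : D.path j s τ' = D.path j t τ' := by
      simp only [path, hτ']
      field_simp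
      ring
    have hc := h.collide hD hs ht (fun h' => hlt.ne h'.1) heq
    have := ((hD.collisions.first_collision j hj τ' _ hpos (by linarith)).1 hc).1
    linarith

/-- Waves with the same position in between two collisions travel together. -/
theorem eq_of_path_eq (h : Traced D j) (hD : IsRegular D) (hj : j < D.J) {s t : ℕ}
    (hs : s ∈ D.live j) (ht : t ∈ D.live j) {τ : ℝ} (h1 : D.time j < τ)
    (h2 : τ ≤ D.time (j + 1)) (heq : D.path j s τ = D.path j t τ)
    (hne : ¬ (τ = D.time (j + 1) ∧ D.path j s τ = D.point (j + 1))) :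
    D.loc j s = D.loc j t ∧ D.speed j s = D.speed j t := by
  by_contra hcon
  exact hne ((hD.collisions.first_collision j hj τ _ h1 h2).1 (h.collide hD hs ht hcon heq))

open Classical in
-- In the fan centred at `a`, a wave has passed `x` exactly when its free path has. Adding the fans
-- regroups the live waves by position.
theorem w_succ (h : Traced D j) (hD : IsRegular D) (hj : j < D.J) (x : ℝ) :
    D.w (j + 1) x =
      D.ε * ∑ s ∈ D.live j with D.path j s (D.time (j + 1)) ≤ x, D.sgn s := by
  have hdt : 0 < D.time (j + 1) - D.time j := sub_pos.2 (hD.collisions.time_lt j hj)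
  have hterm : ∀ a, D.fan j (D.w j) a ((x - a) / (D.time (j + 1) - D.time j)) -
      Function.leftLim (D.w j) a =
        D.ε * ∑ s ∈ D.group j a with D.path j s (D.time (j + 1)) ≤ x, D.sgn s := by
    intro a
    rw [h.fan_eq hD, add_sub_cancel_left]
    congr 2
    apply Finset.filter_congr
    intro s hs
    rw [mem_group] at hs
    rw [le_div_iff₀ hdt, path, hs.2]
    constructor <;> intro h' <;> linarith
  change ∑ᶠ a, _ = _
  simp only [hterm]
  rw [finsum_eq_sum_of_support_subset (s := (D.live j).image (D.loc j)), ← Finset.mul_sum]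
  · congr 1
    rw [← Finset.sum_fiberwise_of_maps_to (t := (D.live j).image (D.loc j)) (g := D.loc j)
      (fun s hs => Finset.mem_image_of_mem _ (Finset.mem_filter.1 hs).1)]
    apply Finset.sum_congr rfl
    intro a _
    congr 1
    ext s
    simp only [Finset.mem_filter, mem_group]
    tauto
  · intro a ha
    rw [Function.mem_support] at ha
    have : (D.group j a).Nonempty := by
      rw [Finset.nonempty_iff_ne_empty]
      rintro h'
      rw [h'] at ha
      simp at ha
    obtain ⟨s, hs⟩ := this
    rw [mem_group] at hs
    rw [Finset.coe_image]
    exact ⟨s, hs.1, hs.2⟩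

end Traced

/-! ### Passage of the waves through a collision -/

theorem node_succ {j s : ℕ} (hs : s ∈ D.live j) : D.node (j + 1) s = open Classical in
    if D.path j s (D.time (j + 1)) = D.point (j + 1) ∧ ¬ D.Survives (j + 1) s then ⊤
    else (D.path j s (D.time (j + 1)) : WithTop ℝ) := by
  have hfree : (D.node j s).map (fun a => a + D.speedOf j (D.node j) s *
      (D.time (j + 1) - D.time j)) = (D.path j s (D.time (j + 1)) : WithTop ℝ) := by
    rw [node_eq_loc hs]
    rfl
  by_cases hc : D.path j s (D.time (j + 1)) = D.point (j + 1) ∧ ¬ D.Survives (j + 1) s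
  · rw [if_pos hc]
    exact if_pos ⟨by rw [hfree, hc.1], hc.2⟩
  · rw [if_neg hc]
    exact (if_neg fun h => hc ⟨WithTop.coe_inj.1 (hfree.symm.trans h.1), h.2⟩).trans hfree

theorem live_succ_subset (j : ℕ) : D.live (j + 1) ⊆ D.live j := by
  intro s hs
  rw [mem_live] at hs ⊢
  refine ⟨hs.1, fun h => hs.2 ?_⟩
  simp only [node, h, WithTop.map_top]
  split_ifs <;> rfl

theorem live_antitone : Antitone D.live := antitone_nat_of_succ_le live_succ_subset

theorem mem_live_succ {j s : ℕ} : s ∈ D.live (j + 1) ↔ s ∈ D.live j ∧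
    ¬ (D.path j s (D.time (j + 1)) = D.point (j + 1) ∧ ¬ D.Survives (j + 1) s) := by
  classical
  constructor
  · intro hs
    have hs' := live_succ_subset j hs
    refine ⟨hs', fun h => (mem_live.1 hs).2 ?_⟩
    rw [node_succ hs', if_pos h]
  · rintro ⟨hs, h⟩
    refine mem_live.2 ⟨(mem_live.1 hs).1, ?_⟩
    rw [node_succ hs, if_neg h]
    exact WithTop.coe_ne_top

theorem loc_succ {j s : ℕ} (hs : s ∈ D.live (j + 1)) :
    D.loc (j + 1) s = D.path j s (D.time (j + 1)) := by
  classical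
  obtain ⟨h1, h2⟩ := mem_live_succ.1 hs
  rw [loc, node_succ h1, if_neg h2]
  rfl


namespace Traced

variable {j : ℕ}

/-- The waves that reach the next collision point form at most two groups. -/
theorem exists_split (h : Traced D j) (hD : IsRegular D) (hj : j < D.J) {A : Finset ℕ}
    (hA : ∀ s, s ∈ A ↔ s ∈ D.live j ∧ D.path j s (D.time (j + 1)) = D.point (j + 1)) :
    ∃ (P : ℕ → Prop) (σ τ : ℝ), (σ = 1 ∨ σ = -1) ∧ (τ = 1 ∨ τ = -1) ∧
      (∀ p ∈ A, P p → D.sgn p = σ) ∧ (∀ p ∈ A, ¬ P p → D.sgn p = τ) ∧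
      ∀ p ∈ A, P p → ∀ q ∈ A, ¬ P q → p < q := by
  by_cases hne : ∃ p ∈ A, ∃ q ∈ A, D.loc j p < D.loc j q
  · obtain ⟨p₀, hp₀, q₀, hq₀, hlt⟩ := hne
    have hp₀' := (hA p₀).1 hp₀
    have hq₀' := (hA q₀).1 hq₀
    -- Waves from different positions sit on different fronts, and only two fronts reach the point;
    -- hence at most two groups of waves meet.
    obtain ⟨x, y, -, hxy⟩ := Set.ncard_eq_two.1 (hD.collisions.binary j hj)
    have hmem : ∀ p ∈ A, Front.second (D.loc j p) (D.speed j p) = x ∨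
        Front.second (D.loc j p) (D.speed j p) = y := by
      intro p hp
      rw [hA] at hp
      have : Front.second (D.loc j p) (D.speed j p) ∈ ({x, y} : Set Front) := by
        rw [← hxy]
        exact ⟨h.front_mem hD hp.1, hp.2⟩
      exact this
    have htwo : ∀ p ∈ A, D.loc j p = D.loc j p₀ ∨ D.loc j p = D.loc j q₀ := by
      intro p hp
      have h0 : Front.second (D.loc j p₀) (D.speed j p₀) ≠
          Front.second (D.loc j q₀) (D.speed j q₀) := by
        intro h'
        rw [Front.second.injEq] at h'
        exact hlt.ne h'.1
      have : Front.second (D.loc j p) (D.speed j p) = Front.second (D.loc j p₀) (D.speed j p₀) ∨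
          Front.second (D.loc j p) (D.speed j p) = Front.second (D.loc j q₀) (D.speed j q₀) := by
        have i1 := hmem p hp
        have i2 := hmem p₀ hp₀
        have i3 := hmem q₀ hq₀
        grind
      rcases this with h' | h'
      · rw [Front.second.injEq] at h'
        exact Or.inl h'.1
      · rw [Front.second.injEq] at h'
        exact Or.inr h'.1
    refine ⟨fun p => D.loc j p = D.loc j p₀, D.sgn p₀, D.sgn q₀, hD.sgn_cases hp₀'.1,
      hD.sgn_cases hq₀'.1, ?_, ?_, ?_⟩
    · intro p hp hP
      exact h.sgn_eq p ((hA p).1 hp).1 p₀ hp₀'.1 hP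
    · intro p hp hP
      exact h.sgn_eq p ((hA p).1 hp).1 q₀ hq₀'.1 ((htwo p hp).resolve_left hP)
    · intro p hp hP q hq hQ
      by_contra hcon
      have := h.mono q ((hA q).1 hq).1 p ((hA p).1 hp).1 (by omega)
      have hq' := (htwo q hq).resolve_left hQ
      rw [hP] at this
      linarith
  · push Not at hne
    rcases A.eq_empty_or_nonempty with rfl | ⟨p₀, hp₀⟩
    · exact ⟨fun _ => True, 1, 1, by simp⟩
    · have hp₀' := (hA p₀).1 hp₀
      refine ⟨fun _ => True, D.sgn p₀, D.sgn p₀, hD.sgn_cases hp₀'.1, hD.sgn_cases hp₀'.1, ?_, ?_,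
        ?_⟩
      · intro p hp _
        exact h.sgn_eq p ((hA p).1 hp).1 p₀ hp₀'.1 (le_antisymm (hne p₀ hp₀ p hp) (hne p hp p₀ hp₀))
      · intro p _ hn
        exact absurd trivial hn
      · intro p _ _ q _ hn
        exact absurd trivial hn

/-- Removing the cancelled waves leaves the needed partial sums unchanged, because their signs
cancel both in total and below every survivor. The solution is thus still the sum over live waves,
and the fixed right states remain correct. -/
theorem succ (h : Traced D j) (hD : IsRegular D) (hj : j < D.J) : Traced D (j + 1) := by
  classical
  have hε := hD.eps_pos
  have hdt := hD.collisions.time_lt j hj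
  set T := D.time (j + 1) with hT
  set X := D.point (j + 1) with hX
  set A := (D.live j).filter fun s => D.path j s T = X with hAdef
  have hA : ∀ s, s ∈ A ↔ s ∈ D.live j ∧ D.path j s T = X := fun s => Finset.mem_filter
  obtain ⟨P, σ, τ, hσ, hτ, hP, hN, hlt⟩ := h.exists_split hD hj hA
  have hpm : ∀ p ∈ D.live j, ∀ q ∈ D.live j, p ≤ q → D.path j p T ≤ D.path j q T :=
    fun p hp q hq hpq => h.path_mono hD hj hp hq hpq hdt.le le_rfl
  have hleft : Function.leftLim (D.w (j + 1)) X =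
      D.ε * ∑ q ∈ D.live j with D.path j q T < X, D.sgn q := by
    rw [← leftLim_step]
    congr 1
    funext x
    exact h.w_succ hD hj x
  have hval : D.w (j + 1) X = D.ε * (∑ q ∈ D.live j with D.path j q T < X, D.sgn q +
      ∑ q ∈ A, D.sgn q) := by
    rw [h.w_succ hD hj, ← Finset.sum_union]
    · congr 2
      ext q
      simp only [Finset.mem_filter, Finset.mem_union, hA, le_iff_lt_or_eq]
      tauto
    · rw [Finset.disjoint_left]
      intro q h1 h2
      rw [Finset.mem_filter] at h1
      rw [hA] at h2
      exact h1.2.ne h2.2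
  have hhat : ∀ s ∈ A, D.hatw s = D.ε * (∑ q ∈ D.live j with D.path j q T < X, D.sgn q +
      ∑ q ∈ A with q ≤ s, D.sgn q) := by
    intro s hs
    rw [hA] at hs
    rw [h.hatw_eq s hs.1, ← Finset.sum_union]
    · congr 2
      ext q
      simp only [Finset.mem_filter, Finset.mem_union, hA]
      constructor
      · rintro ⟨h1, h2⟩
        have := hpm q h1 s hs.1 h2
        rw [hs.2] at this
        rcases this.lt_or_eq with h3 | h3
        · exact Or.inl ⟨h1, h3⟩
        · exact Or.inr ⟨⟨h1, h3⟩, h2⟩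
      · rintro (⟨h1, h2⟩ | ⟨⟨h1, -⟩, h2⟩)
        · refine ⟨h1, ?_⟩
          by_contra hlt
          have := hpm s hs.1 q h1 (by omega)
          rw [hs.2] at this
          linarith
        · exact ⟨h1, h2⟩
    · rw [Finset.disjoint_left]
      intro q h1 h2
      simp only [Finset.mem_filter, hA] at h1 h2
      exact h1.2.ne h2.1.2
  have hS : ∀ s ∈ A, (D.Survives (j + 1) s ↔
      0 ≤ D.sgn s * ∑ p ∈ A with p ≤ s, D.sgn p - 1 ∧
        D.sgn s * ∑ p ∈ A with p ≤ s, D.sgn p ≤ D.sgn s * ∑ p ∈ A, D.sgn p) := by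
    intro s hs
    -- The state `W` left of the point cancels, and survival depends only on partial sums over the
    -- colliding waves.
    rw [Survives, hleft, hval, hhat s hs]
    generalize ∑ q ∈ D.live j with D.path j q T < X, D.sgn q = W
    generalize ∑ p ∈ A with p ≤ s, D.sgn p = H
    generalize ∑ p ∈ A, D.sgn p = V
    apply and_congr
    · rw [← mul_nonneg_iff_of_pos_left hε (b := D.sgn s * H - 1), ← sub_nonneg]
      ring_nf
    · rw [← mul_le_mul_iff_right₀ hε (b := D.sgn s * H), ← sub_nonneg, ← sub_nonneg (b := D.ε * _)]
      ring_nf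
  obtain ⟨c1, c2, c3⟩ := cancellation hσ hτ hP hN hlt hS
  have hlive : ∀ s, s ∈ D.live (j + 1) ↔ s ∈ D.live j ∧ ¬ (s ∈ A ∧ ¬ D.Survives (j + 1) s) := by
    intro s
    rw [mem_live_succ]
    constructor
    · rintro ⟨h1, h2⟩
      exact ⟨h1, fun h3 => h2 ⟨((hA s).1 h3.1).2, h3.2⟩⟩
    · rintro ⟨h1, h2⟩
      exact ⟨h1, fun h3 => h2 ⟨(hA s).2 ⟨h1, h3.1⟩, h3.2⟩⟩
  have hsum : ∀ (Q : ℕ → Prop) [DecidablePred Q], ∑ q ∈ A with ¬ D.Survives (j + 1) q ∧ Q q, D.sgn q = 0 →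
      ∑ q ∈ D.live (j + 1) with Q q, D.sgn q = ∑ q ∈ D.live j with Q q, D.sgn q := by
    intro Q _ hQ
    have : (D.live j).filter Q = (D.live (j + 1)).filter Q ∪
        A.filter (fun q => ¬ D.Survives (j + 1) q ∧ Q q) := by
      ext q
      simp only [Finset.mem_filter, Finset.mem_union, hlive, hA]
      tauto
    rw [this, Finset.sum_union, hQ, add_zero]
    rw [Finset.disjoint_left]
    intro q h1 h2
    simp only [Finset.mem_filter, hlive] at h1 h2
    exact h1.1.2 ⟨h2.1, h2.2.1⟩
  refine ⟨?_, ?_, ?_, ?_⟩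
  · intro p hp q hq hpq
    rw [loc_succ hp, loc_succ hq]
    exact hpm p (live_succ_subset j hp) q (live_succ_subset j hq) hpq
  · intro p hp q hq hpq
    rw [loc_succ hp, loc_succ hq] at hpq
    obtain ⟨hp1, hp2⟩ := (hlive p).1 hp
    obtain ⟨hq1, hq2⟩ := (hlive q).1 hq
    by_cases hpX : D.path j p T = X
    · have hpA : p ∈ A := (hA p).2 ⟨hp1, hpX⟩
      have hqA : q ∈ A := (hA q).2 ⟨hq1, hpq ▸ hpX⟩
      exact c1 p hpA (by tauto) q hqA (by tauto)
    · exact h.sgn_eq p hp1 q hq1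
        (h.eq_of_path_eq hD hj hp1 hq1 hdt le_rfl hpq (fun h' => hpX h'.2)).1
  · intro s hs
    obtain ⟨hs1, hs2⟩ := (hlive s).1 hs
    rw [h.hatw_eq s hs1, hsum]
    -- All cancelled waves lie at the collision point: none precedes `s` on its left, all precede
    -- `s` on its right, and at the point itself `cancellation` applies.
    rcases lt_trichotomy (D.path j s T) X with hlt | heq | hgt
    · rw [Finset.filter_false_of_mem, Finset.sum_empty]
      rintro q hq ⟨-, hqs⟩
      rw [hA] at hq
      have := hpm q hq.1 s hs1 hqs
      linarith [hq.2]
    · have hsA : s ∈ A := (hA s).2 ⟨hs1, heq⟩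
      exact c2 s hsA (by tauto)
    · rw [← c3]
      congr 1
      apply Finset.filter_congr
      intro q hq
      refine and_iff_left ?_
      rw [hA] at hq
      by_contra hcon
      have := hpm s hs1 q hq.1 (by omega)
      linarith [hq.2]
  · intro x
    rw [h.w_succ hD hj]
    have : (D.live (j + 1)).filter (fun q => D.loc (j + 1) q ≤ x) =
        (D.live (j + 1)).filter (fun q => D.path j q T ≤ x) := by
      apply Finset.filter_congr
      intro q hq
      rw [loc_succ hq]
    rw [this, hsum]
    by_cases hx : X ≤ x
    · rw [← c3]
      congr 1
      apply Finset.filter_congr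
      intro q hq
      refine and_iff_left ?_
      rw [((hA q).1 hq).2]
      exact hx
    · rw [Finset.filter_false_of_mem, Finset.sum_empty]
      rintro q hq ⟨-, hqs⟩
      rw [((hA q).1 hq).2] at hqs
      exact hx hqs

end Traced

theorem IsRegular.traced (hD : IsRegular D) : ∀ {j : ℕ}, j ≤ D.J → Traced D j
  | 0, _ => hD.traced_zero
  | _ + 1, hj => (hD.traced (Nat.le_of_succ_le hj)).succ hD hj

/-! ### Speed bounds and meeting times -/

/-- Envelope slopes inherit the lower bound of the derivative of the flux, and all states of the
group lie in the hull of the initial values. -/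
theorem IsRegular.neg_one_lt_speed (hD : IsRegular D) {j : ℕ} (hj : j ≤ D.J) {s : ℕ}
    (hs : s ∈ D.live j) : -1 < D.speed j s := by
  obtain ⟨C, hC⟩ := hD.exists_flux_bound
  have hε := hD.eps_pos
  obtain ⟨k, hR, -⟩ := (hD.traced hj).isRiemann hD hs
  set G := D.group j (D.loc j s)
  set g : ℝ → ℝ := fun w => D.f w (D.v (D.time j) (D.loc j s)) with hg
  have hull := (initial_waves hε hD.step_w₀).2.2.2.2
  have hconv : Icc (sInf (D.span G)) (sSup (D.span G)) ⊆ convexHull ℝ (range D.w₀) := by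
    obtain ⟨p, hp, hp1⟩ := exists_rank_eq le_rfl hR.card_pos
    obtain ⟨q, hq, hq1⟩ := exists_rank_eq (G := G) hR.card_pos le_rfl
    have hpw := hull p (mem_live.1 (mem_group.1 hp).1).1
    have hqw := hull q (mem_live.1 (mem_group.1 hq).1).1
    have hkc : k < k + (G.card : ℤ) := by have := hR.card_pos; omega
    have hkc' : k - (G.card : ℤ) < k := by omega
    rcases hR.sign with hσ | hσ
    · rw [hσ] at hR
      have hlt : (k : ℝ) * D.ε < ((k + G.card : ℤ) : ℝ) * D.ε := by gcongr
      rw [hR.span_pos hε, csInf_Ioc hlt, csSup_Ioc hlt]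
      apply (convex_convexHull ℝ _).ordConnected.out
      · convert hpw.2 using 1
        rw [hR.hatw p hp, hR.sgn p hp, hp1]
        push_cast
        ring
      · convert hqw.1 using 1
        rw [hR.hatw q hq, hq1]
        push_cast
        ring
    · rw [hσ] at hR
      have hlt : ((k - G.card : ℤ) : ℝ) * D.ε < (k : ℝ) * D.ε := by gcongr
      rw [hR.span_neg hε, csInf_Ico hlt, csSup_Ico hlt]
      apply (convex_convexHull ℝ _).ordConnected.out
      · convert hqw.1 using 1
        rw [hR.hatw q hq, hq1]
        push_cast
        ring
      · convert hpw.2 using 1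
        rw [hR.hatw p hp, hR.sgn p hp, hp1]
        push_cast
        ring
  have hgC : ContDiff ℝ 3 g :=
    hD.flux.contDiff.comp (contDiff_id.prodMk contDiff_const)
  have hgd : Differentiable ℝ g := hgC.differentiable (by norm_num)
  have hdc : Continuous (deriv g) := hgC.continuous_deriv (by norm_num)
  -- Compactness turns the pointwise strict bound into a uniform one.
  obtain ⟨d, hd1, hd⟩ : ∃ d, -1 < d ∧
      ∀ u ∈ Icc (sInf (D.span G)) (sSup (D.span G)), d ≤ deriv g u := by
    rcases (Icc (sInf (D.span G)) (sSup (D.span G))).eq_empty_or_nonempty with he | hne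
    · exact ⟨0, by norm_num, by rw [he]; simp⟩
    · obtain ⟨u, hu, hmin⟩ := isCompact_Icc.exists_isMinOn hne hdc.continuousOn
      exact ⟨deriv g u, hD.speed_gt u (hconv hu) _ ⟨_, rfl⟩, fun y hy => hmin hy⟩
  refine hd1.trans_le ?_
  rw [speed_eq hs]
  apply hR.le_entSpeed hε (fun z => hC z _) _ (mem_group_loc hs)
  apply monotoneOn_of_deriv_nonneg (convex_Icc _ _)
  · exact (hgC.continuous.sub (continuous_const.mul continuous_id)).continuousOn
  · intro u _
    exact ((hgd u).sub ((differentiableAt_id).const_mul d)).differentiableWithinAt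
  · intro u hu
    have e : deriv (fun u => g u - d * u) u = deriv g u - d := by
      have := (hgd u).hasDerivAt.sub ((hasDerivAt_id u).const_mul d)
      rw [mul_one] at this
      exact this.deriv
    rw [e]
    linarith [hd u (interior_subset hu)]

theorem IsRegular.time_strictMono (hD : IsRegular D) {i j : ℕ} (hij : i < j) (hj : j ≤ D.J) :
    D.time i < D.time j := by
  induction j, hij using Nat.le_induction with
  | base => exact hD.collisions.time_lt i hj
  | succ k _ ih => exact (ih (by omega)).trans (hD.collisions.time_lt k hj)

theorem IsRegular.time_mono (hD : IsRegular D) {i j : ℕ} (hij : i ≤ j) (hj : j ≤ D.J) :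
    D.time i ≤ D.time j := by
  rcases hij.eq_or_lt with rfl | h
  · exact le_rfl
  · exact (hD.time_strictMono h hj).le

/-- In characteristic coordinates of the first family the waves move to the right. -/
theorem IsRegular.loc_add_time_lt (hD : IsRegular D) {i j : ℕ} (hij : i < j) (hj : j ≤ D.J)
    {s : ℕ} (hs : s ∈ D.live j) : D.loc i s + D.time i < D.loc j s + D.time j := by
  induction j, hij using Nat.le_induction with
  | base =>
    rw [loc_succ hs, path]
    have h1 := hD.collisions.time_lt i hj
    have h2 := hD.neg_one_lt_speed (j := i) (by omega) (live_succ_subset _ hs)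
    nlinarith
  | succ k _ ih =>
    refine (ih (by omega) (live_succ_subset _ hs)).trans ?_
    rw [loc_succ hs, path]
    have h1 := hD.collisions.time_lt k hj
    have h2 := hD.neg_one_lt_speed (j := k) (by omega) (live_succ_subset _ hs)
    nlinarith

theorem IsRegular.index_time (hD : IsRegular D) {j : ℕ} (hj : j ≤ D.J) :
    D.index (D.time j) = j := by
  classical
  rw [index, Nat.findGreatest_eq_iff]
  refine ⟨hj, fun _ => le_rfl, fun n h1 h2 => ?_⟩
  rw [not_le]
  exact hD.time_strictMono h1 h2

theorem IsRegular.index_of_mem (hD : IsRegular D) {j : ℕ} (hj : j < D.J) {τ : ℝ}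
    (h1 : D.time j ≤ τ) (h2 : τ < D.time (j + 1)) : D.index τ = j := by
  classical
  rw [index, Nat.findGreatest_eq_iff]
  refine ⟨hj.le, fun _ => h1, fun n h3 h4 => ?_⟩
  rw [not_le]
  exact h2.trans_le (hD.time_mono h3 h4)

theorem IsRegular.pos_time (hD : IsRegular D) {j : ℕ} (hj : j ≤ D.J) (s : ℕ) :
    D.pos (D.time j) s = D.node j s := by
  rw [pos, hD.index_time hj]
  cases D.node j s <;> simp

theorem IsRegular.pos_of_mem (hD : IsRegular D) {j : ℕ} (hj : j < D.J) {τ : ℝ}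
    (h1 : D.time j ≤ τ) (h2 : τ < D.time (j + 1)) {s : ℕ} (hs : s ∈ D.live j) :
    D.pos τ s = (D.path j s τ : WithTop ℝ) := by
  rw [pos, hD.index_of_mem hj h1 h2, node_eq_loc hs]
  rfl

/-- Every time up to `time j` is a node or lies strictly between two nodes. -/
theorem IsRegular.exists_interval (hD : IsRegular D) {j : ℕ} (hj : j ≤ D.J) {τ : ℝ} (h0 : 0 ≤ τ)
    (h1 : τ ≤ D.time j) :
    (∃ i ≤ j, τ = D.time i) ∨ ∃ i < j, D.time i < τ ∧ τ < D.time (i + 1) := by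
  induction j with
  | zero =>
    left
    refine ⟨0, le_rfl, ?_⟩
    rw [hD.collisions.time_zero] at h1 ⊢
    linarith
  | succ k ih =>
    by_cases hk : τ ≤ D.time k
    · rcases ih (by omega) hk with ⟨i, hi, h⟩ | ⟨i, hi, h⟩
      · exact Or.inl ⟨i, by omega, h⟩
      · exact Or.inr ⟨i, by omega, h⟩
    · push Not at hk
      rcases h1.eq_or_lt with h | h
      · exact Or.inl ⟨k + 1, le_rfl, h⟩
      · exact Or.inr ⟨k, by omega, hk, h⟩

/-- Waves that meet strictly between two nodes are joined. -/
theorem IsRegular.joined_of_pos_eq (hD : IsRegular D) {j : ℕ} (hj : j < D.J) {s t : ℕ}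
    (hs : s ∈ D.live j) (ht : t ∈ D.live j) {τ : ℝ} (h1 : D.time j < τ)
    (h2 : τ < D.time (j + 1)) (heq : D.pos τ s = D.pos τ t) : D.Joined j s t := by
  rw [hD.pos_of_mem hj h1.le h2 hs, hD.pos_of_mem hj h1.le h2 ht, WithTop.coe_inj] at heq
  obtain ⟨i1, i2⟩ := (hD.traced hj.le).eq_of_path_eq hD hj hs ht h1 h2.le heq
    (fun h => h2.ne h.1)
  exact ⟨by rw [node_eq_loc hs, node_eq_loc ht, i1], i2⟩

/-- Waves that meet strictly between two collisions already travel together from the preceding one,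
so collision times suffice. -/
theorem IsRegular.interacted_iff (hD : IsRegular D) {j : ℕ} (hj : j ≤ D.J) {s t : ℕ}
    (hs : s ∈ D.live j) (ht : t ∈ D.live j) :
    D.Interacted j s t ↔ ∃ i ≤ j, D.node i s = D.node i t := by
  constructor
  · rintro ⟨τ, h0, h1, heq⟩
    rcases hD.exists_interval hj h0 h1 with ⟨i, hi, rfl⟩ | ⟨i, hi, h2, h3⟩
    · rw [hD.pos_time (hi.trans hj), hD.pos_time (hi.trans hj)] at heq
      exact ⟨i, hi, heq⟩
    · exact ⟨i, hi.le, (hD.joined_of_pos_eq (by omega) (live_antitone hi.le hs)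
        (live_antitone hi.le ht) h2 h3 heq).1⟩
  · rintro ⟨i, hi, h⟩
    refine ⟨D.time i, ?_, hD.time_mono hi hj, ?_⟩
    · rw [← hD.collisions.time_zero]
      exact hD.time_mono (Nat.zero_le i) (hi.trans hj)
    · rw [hD.pos_time (hi.trans hj), hD.pos_time (hi.trans hj), h]

end Data

/-! ### A double harmonic sum -/

/-- Each inner sum is at most $\log((i+n)/i)$ by telescoping $1/(i+k)\le\log\frac{i+k}{i+k-1}$. The
product of these ratios is a binomial coefficient, hence at most $2^{m+n}$. -/
theorem sum_sum_inv_add_le (m n : ℕ) :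
    ∑ i ∈ Finset.Icc 1 m, ∑ k ∈ Finset.Icc 1 n, (1 : ℝ) / (i + k) ≤ (m + n) * Real.log 2 := by
  have step : ∀ i : ℕ, 1 ≤ i → ∀ n : ℕ,
      ∑ k ∈ Finset.Icc 1 n, (1 : ℝ) / (i + k) ≤ Real.log (i + n) - Real.log i := by
    intro i hi n
    have hi' : (1 : ℝ) ≤ i := by exact_mod_cast hi
    induction n with
    | zero => simp
    | succ n ih =>
      rw [Finset.sum_Icc_succ_top (by omega)]
      have hn : (0 : ℝ) ≤ n := Nat.cast_nonneg n
      have h1 : (0 : ℝ) < i + n := by linarith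
      have h2 : (0 : ℝ) < i + (n + 1) := by linarith
      have h3 := Real.one_sub_inv_le_log_of_pos (div_pos h2 h1)
      rw [Real.log_div h2.ne' h1.ne', inv_div] at h3
      have h4 : 1 - ((i : ℝ) + n) / (i + (n + 1)) = 1 / (i + (n + 1)) := by
        field_simp
        ring
      push_cast
      linarith
  have hsum : ∀ m : ℕ, ∑ i ∈ Finset.Icc 1 m, ∑ k ∈ Finset.Icc 1 n, (1 : ℝ) / (i + k) ≤
      Real.log ((m + n).choose n) := by
    intro m
    induction m with
    | zero => simp
    | succ m ih =>
      rw [Finset.sum_Icc_succ_top (by omega)]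
      have h1 := step (m + 1) (by omega) n
      have hpos : (0 : ℝ) < ((m + n).choose n : ℕ) := by
        exact_mod_cast Nat.choose_pos (by omega)
      have hm : (0 : ℝ) < ((m + 1 : ℕ) : ℝ) := by positivity
      have hmn : (0 : ℝ) < ((m + 1 : ℕ) : ℝ) + n := by positivity
      have key : (((m + 1 + n).choose n : ℕ) : ℝ) =
          ((m + n).choose n : ℕ) * ((((m + 1 : ℕ) : ℝ) + n) / ((m + 1 : ℕ) : ℝ)) := by
        have := Nat.choose_mul_succ_eq (m + n) n
        rw [show m + n + 1 - n = m + 1 by omega, show m + n + 1 = m + 1 + n by ring] at this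
        rw [mul_div_assoc', eq_div_iff hm.ne']
        have h' : (((m + n).choose n * (m + 1 + n) : ℕ) : ℝ) =
          ((m + 1 + n).choose n * (m + 1) : ℕ) := by rw [this]
        push_cast at h' ⊢
        linarith
      rw [key, Real.log_mul hpos.ne' (div_pos hmn hm).ne', Real.log_div hmn.ne' hm.ne']
      linarith
  refine (hsum m).trans ?_
  have h1 : (((m + n).choose n : ℕ) : ℝ) ≤ 2 ^ (m + n) := by
    exact_mod_cast Nat.choose_le_two_pow (m + n) n
  have hpos : (0 : ℝ) < ((m + n).choose n : ℕ) := by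
    exact_mod_cast Nat.choose_pos (by omega)
  refine (Real.log_le_log hpos h1).trans (le_of_eq ?_)
  rw [Real.log_pow]
  push_cast
  ring

open Classical in
-- Count `s` backwards from the end of `X` as number `i`, and `t` forwards from the start of `Y` as
-- number `k`: at least `i + k` elements lie from `s` to `t`.
theorem sum_sum_inv_card_le {V X Y : Finset ℕ} (hX : X ⊆ V) (hY : Y ⊆ V)
    (hlt : ∀ s ∈ X, ∀ t ∈ Y, s < t) :
    ∑ s ∈ X, ∑ t ∈ Y, (1 : ℝ) / (V.filter fun q => s ≤ q ∧ q ≤ t).card ≤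
      (X.card + Y.card) * Real.log 2 := by
  refine le_trans ?_ (sum_sum_inv_add_le X.card Y.card)
  have himg : X.image (fun s => X.card + 1 - rank X s) = Finset.Icc 1 X.card := by
    ext i
    simp only [Finset.mem_image, Finset.mem_Icc]
    constructor
    · rintro ⟨s, hs, rfl⟩
      have := one_le_rank hs
      have := rank_le_card X s
      omega
    · rintro ⟨h1, h2⟩
      obtain ⟨s, hs, hr⟩ := exists_rank_eq (G := X) (i := X.card + 1 - i) (by omega) (by omega)
      exact ⟨s, hs, by omega⟩
  rw [← himg, ← rank_image Y, Finset.sum_image]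
  · apply Finset.sum_le_sum
    intro s hs
    rw [Finset.sum_image (rank_injOn Y)]
    apply Finset.sum_le_sum
    intro t ht
    have h1 := one_le_rank ht
    apply one_div_le_one_div_of_le
    · have : (1 : ℝ) ≤ rank Y t := by exact_mod_cast h1
      positivity
    · have hsub : X.filter (fun q => ¬ q < s) ∪ Y.filter (· ≤ t) ⊆
          V.filter fun q => s ≤ q ∧ q ≤ t := by
        intro q hq
        simp only [Finset.mem_union, Finset.mem_filter] at hq ⊢
        rcases hq with ⟨h1, h2⟩ | ⟨h1, h2⟩
        · exact ⟨hX h1, by omega, (hlt q h1 t ht).le⟩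
        · exact ⟨hY h1, (hlt s hs q h1).le, h2⟩
      have hcard := Finset.card_le_card hsub
      rw [Finset.card_union_of_disjoint] at hcard
      · have e1 := Finset.card_filter_add_card_filter_not (s := X) (fun q => q < s)
        have e2 : rank X s = (X.filter (· < s)).card + 1 := by
          rw [rank, show X.filter (· ≤ s) = insert s (X.filter (· < s)) by
            ext q
            simp only [Finset.mem_filter, Finset.mem_insert, le_iff_lt_or_eq]
            constructor
            · rintro ⟨h1, h2 | h2⟩
              · exact Or.inr ⟨h1, h2⟩
              · exact Or.inl h2
            · rintro (rfl | ⟨h1, h2⟩)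
              · exact ⟨hs, Or.inr rfl⟩
              · exact ⟨h1, Or.inl h2⟩, Finset.card_insert_of_notMem (by simp)]
        have e3 : rank Y t = (Y.filter (· ≤ t)).card := rfl
        exact_mod_cast (by omega : X.card + 1 - rank X s + rank Y t ≤ _)
      · rw [Finset.disjoint_left]
        intro q h1 h2
        rw [Finset.mem_filter] at h1 h2
        have := hlt q h1.1 q h2.1
        omega
  · intro s hs t ht hst
    have := rank_le_card X s
    have := rank_le_card X t
    exact rank_injOn X hs ht (by simp only at hst; omega)

namespace Data

variable {D : Data}

/-! ### Pairs that have interacted -/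

/-- Positions are ordered, so a wave between two that meet is squeezed to the same point, where
signs agree. -/
theorem IsRegular.node_eq_of_between (hD : IsRegular D) {i j : ℕ} (hij : i ≤ j) (hj : j ≤ D.J)
    {p q r : ℕ} (hp : p ∈ D.live j) (hq : q ∈ D.live j) (hr : r ∈ D.live j) (hpr : p ≤ r)
    (hrq : r ≤ q) (heq : D.node i p = D.node i q) : D.node i r = D.node i p ∧ D.sgn r = D.sgn p := by
  have hp' := live_antitone hij hp
  have hq' := live_antitone hij hq
  have hr' := live_antitone hij hr
  have h := hD.traced (hij.trans hj)
  rw [node_eq_loc hp', node_eq_loc hq', WithTop.coe_inj] at heq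
  have h1 := h.mono p hp' r hr' hpr
  have h2 := h.mono r hr' q hq' hrq
  have h3 : D.loc i r = D.loc i p := le_antisymm (heq ▸ h2) h1
  exact ⟨by rw [node_eq_loc hp', node_eq_loc hr', h3], h.sgn_eq r hr' p hp' h3⟩

/-- All live waves between the two have the same sign. Thus `Divides`, which takes its flux from the
first wave, uses the same flux for both. -/
theorem IsRegular.maxHom_eq (hD : IsRegular D) {i j : ℕ} (hij : i ≤ j) (hj : j ≤ D.J)
    {p q : ℕ} (hp : p ∈ D.live j) (hq : q ∈ D.live j) (heq : D.node i p = D.node i q) :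
    D.maxHom j p = D.maxHom j q := by
  classical
  have hbet : ∀ r ∈ D.live j, r ∈ uIcc p q → D.sgn r = D.sgn p ∧ D.sgn r = D.sgn q := by
    intro r hr hrm
    rcases le_total p q with hpq | hpq
    · rw [uIcc_of_le hpq] at hrm
      have h1 := (hD.node_eq_of_between hij hj hp hq hr hrm.1 hrm.2 heq).2
      have h2 := (hD.node_eq_of_between hij hj hp hq hq hpq le_rfl heq).2
      exact ⟨h1, h1.trans h2.symm⟩
    · rw [uIcc_of_ge hpq] at hrm
      have h1 := (hD.node_eq_of_between hij hj hq hp hr hrm.1 hrm.2 heq.symm).2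
      have h2 := (hD.node_eq_of_between hij hj hq hp hp hpq le_rfl heq.symm).2
      exact ⟨h1.trans h2.symm, h1⟩
  have hpq : D.sgn p = D.sgn q := (hbet p hp left_mem_uIcc).2
  unfold maxHom
  apply Finset.filter_congr
  intro x _
  constructor
  · intro h r hr hrm
    rcases uIcc_subset_uIcc_union_uIcc (b := p) hrm with h' | h'
    · exact (hbet r hr (uIcc_comm q p ▸ h')).2
    · rw [h r hr h', hpq]
  · intro h r hr hrm
    rcases uIcc_subset_uIcc_union_uIcc (b := q) hrm with h' | h'
    · exact (hbet r hr h').1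
    · rw [h r hr h', hpq]

/-- Right states are partial sums of signs, and signs agree between waves that have met, so the
difference counts waves. The shift by one cell makes the count include `s`. -/
theorem IsRegular.abs_hatw_sub (hD : IsRegular D) {j : ℕ} (hj : j ≤ D.J) {s s' : ℕ}
    (hs : s ∈ D.live j) (hs' : s' ∈ D.live j) (hlt : s < s') (hint : D.Interacted j s s') :
    |D.hatw s' - (D.hatw s - D.sgn s * D.ε)| =
      D.ε * ((D.live j).filter fun q => s ≤ q ∧ q ≤ s').card := by
  classical
  obtain ⟨i, hi, heq⟩ := (hD.interacted_iff hj hs hs').1 hint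
  have h := hD.traced hj
  have hsum : ∑ q ∈ D.live j with s ≤ q ∧ q ≤ s', D.sgn q =
      D.sgn s * ((D.live j).filter fun q => s ≤ q ∧ q ≤ s').card := by
    apply sum_eq_mul_card
    intro q hq
    rw [Finset.mem_filter] at hq
    exact (hD.node_eq_of_between hi hj hs hs' hq.1 hq.2.1 hq.2.2 heq).2
  have e1 : ∑ q ∈ D.live j with q ≤ s', D.sgn q = ∑ q ∈ D.live j with q < s, D.sgn q +
      ∑ q ∈ D.live j with s ≤ q ∧ q ≤ s', D.sgn q := by
    rw [← Finset.sum_union]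
    · congr 1
      ext q
      simp only [Finset.mem_filter, Finset.mem_union]
      constructor
      · rintro ⟨h1, h2⟩
        rcases lt_or_ge q s with h3 | h3
        · exact Or.inl ⟨h1, h3⟩
        · exact Or.inr ⟨h1, h3, h2⟩
      · rintro (⟨h1, h2⟩ | ⟨h1, h2, h3⟩)
        · exact ⟨h1, by omega⟩
        · exact ⟨h1, h3⟩
    · rw [Finset.disjoint_left]
      intro q h1 h2
      rw [Finset.mem_filter] at h1 h2
      omega
  have e2 : ∑ q ∈ D.live j with q ≤ s, D.sgn q = ∑ q ∈ D.live j with q < s, D.sgn q +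
      D.sgn s := by
    rw [← Finset.sum_singleton D.sgn s, ← Finset.sum_union]
    · congr 1
      ext q
      simp only [Finset.mem_filter, Finset.mem_union, Finset.mem_singleton, le_iff_lt_or_eq]
      constructor
      · rintro ⟨h1, h2 | h2⟩
        · exact Or.inl ⟨h1, h2⟩
        · exact Or.inr h2
      · rintro (⟨h1, h2⟩ | rfl)
        · exact ⟨h1, Or.inl h2⟩
        · exact ⟨hs, Or.inr rfl⟩
    · simp
  rw [h.hatw_eq s hs, h.hatw_eq s' hs', e1, e2, hsum]
  have : D.ε * (∑ q ∈ D.live j with q < s, D.sgn q +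
      D.sgn s * ((D.live j).filter fun q => s ≤ q ∧ q ≤ s').card) -
      (D.ε * (∑ q ∈ D.live j with q < s, D.sgn q + D.sgn s) - D.sgn s * D.ε) =
      D.sgn s * (D.ε * ((D.live j).filter fun q => s ≤ q ∧ q ≤ s').card) := by ring
  rw [this, abs_mul, abs_of_nonneg (mul_nonneg hD.eps_pos.le (Nat.cast_nonneg _))]
  rcases hD.sgn_cases hs with h' | h' <;> rw [h'] <;> simp

/-! ### The partitions -/

theorem mem_part {j s s' p q : ℕ} (h : q ∈ D.part j s s' p) :
    p ∈ D.live j ∧ q ∈ D.live j ∧ ∃ i ≤ j, D.node i p = D.node i q := by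
  classical
  have hist_sub : ∀ j, D.hist j s s' ⊆ D.live j := fun j => Finset.filter_subset _ _
  induction j generalizing q with
  | zero =>
    rw [part, Finset.mem_filter] at h
    exact ⟨hist_sub _ h.2.1, hist_sub _ h.1, 0, le_rfl, h.2.2.1⟩
  | succ j ih =>
    rw [part] at h
    split_ifs at h with hT
    · rw [Finset.mem_filter] at h
      exact ⟨hist_sub _ h.2.1, hist_sub _ h.1, j + 1, le_rfl, h.2.2.1⟩
    · rw [Finset.mem_filter, Finset.mem_inter] at h
      obtain ⟨-, -, i, hi, heq⟩ := ih h.1.1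
      exact ⟨(Finset.mem_inter.1 h.2.1).2, h.1.2, i, by omega, heq⟩

theorem part_self_left (s' : ℕ) {j s : ℕ} (hs : s ∈ D.live j) : s ∈ D.part j s s' s := by
  classical
  have hist_mem : ∀ j, s ∈ D.live j → s ∈ D.hist j s s' := fun j h =>
    Finset.mem_filter.2 ⟨h, rfl⟩
  induction j with
  | zero =>
    rw [part, Finset.mem_filter]
    exact ⟨hist_mem _ hs, hist_mem _ hs, rfl, rfl⟩
  | succ j ih =>
    rw [part]
    split_ifs with hT
    · rw [Finset.mem_filter]
      exact ⟨hist_mem _ hs, hist_mem _ hs, rfl, rfl⟩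
    · have := Finset.mem_inter.2 ⟨ih (live_succ_subset j hs), hs⟩
      rw [Finset.mem_filter]
      exact ⟨this, this, fun h => h rfl⟩

theorem lastTime_eq_of_pos_eq {j s s' : ℕ} (h0 : 0 ≤ D.time j)
    (heq : D.pos (D.time j) s = D.pos (D.time j) s') : D.lastTime j s s' = D.time j :=
  IsGreatest.csSup_eq ⟨⟨h0, le_rfl, heq⟩, fun _ hτ => hτ.2.1⟩

theorem IsRegular.time_nonneg (hD : IsRegular D) {j : ℕ} (hj : j ≤ D.J) : 0 ≤ D.time j := by
  rw [← hD.collisions.time_zero]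
  exact hD.time_mono (Nat.zero_le j) hj

/-- The supremum need not be attained a priori. A meeting time after the previous node is either
`time j` itself, or an instant at which the waves already travel together and so arrive together. -/
theorem IsRegular.node_eq_of_lastTime (hD : IsRegular D) {j : ℕ} (hj : j ≤ D.J) {s s' : ℕ}
    (hs : s ∈ D.live j) (hs' : s' ∈ D.live j) (hint : D.Interacted j s s')
    (hT : D.lastTime j s s' = D.time j) : D.node j s = D.node j s' := by
  cases j with
  | zero =>
    obtain ⟨i, hi, heq⟩ := (hD.interacted_iff hj hs hs').1 hint
    obtain rfl : i = 0 := by omega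
    exact heq
  | succ k =>
    have hk := hD.collisions.time_lt k hj
    have hne : {τ | 0 ≤ τ ∧ τ ≤ D.time (k + 1) ∧ D.pos τ s = D.pos τ s'}.Nonempty := hint
    obtain ⟨τ, hτ, hlt⟩ := exists_lt_of_lt_csSup hne (show D.time k < _ by
      rw [← lastTime, hT]; exact hk)
    rcases hτ.2.1.eq_or_lt with he | hl
    · have := hτ.2.2
      rwa [he, hD.pos_time hj, hD.pos_time hj] at this
    · have h1 := live_succ_subset k hs
      have h2 := live_succ_subset k hs'
      have hjn := hD.joined_of_pos_eq (by omega) h1 h2 hlt hl hτ.2.2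
      have hloc : D.loc k s = D.loc k s' := by rw [loc, hjn.1, loc]
      rw [node_eq_loc hs, node_eq_loc hs', loc_succ hs, loc_succ hs', path, path, hloc, hjn.2]

/-- The history is defined through the position of `s`; `s'` belongs to it because the last meeting
is attained. -/
theorem IsRegular.part_self_right (hD : IsRegular D) {j : ℕ} (hj : j ≤ D.J) {s s' : ℕ}
    (hs : s ∈ D.live j) (hs' : s' ∈ D.live j) (hint : D.Interacted j s s') :
    s' ∈ D.part j s s' s' := by
  classical
  have hist_mem : ∀ j ≤ D.J, s ∈ D.live j → s' ∈ D.live j → D.Interacted j s s' →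
      D.lastTime j s s' = D.time j → s' ∈ D.hist j s s' := by
    intro j hj hs hs' hint hT
    refine Finset.mem_filter.2 ⟨hs', ?_⟩
    rw [hT, hD.pos_time hj, hD.pos_time hj, hD.node_eq_of_lastTime hj hs hs' hint hT]
  induction j with
  | zero =>
    have hT : D.lastTime 0 s s' = D.time 0 := by
      obtain ⟨i, hi, heq⟩ := (hD.interacted_iff hj hs hs').1 hint
      obtain rfl : i = 0 := by omega
      apply lastTime_eq_of_pos_eq (hD.time_nonneg hj)
      rw [hD.pos_time hj, hD.pos_time hj, heq]
    have := hist_mem 0 hj hs hs' hint hT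
    rw [part, Finset.mem_filter]
    exact ⟨this, this, rfl, rfl⟩
  | succ j ih =>
    rw [part]
    split_ifs with hT
    · have := hist_mem _ hj hs hs' hint hT
      rw [Finset.mem_filter]
      exact ⟨this, this, rfl, rfl⟩
    · obtain ⟨i, hi, heq⟩ := (hD.interacted_iff hj hs hs').1 hint
      have hij : i ≤ j := by
        by_contra hcon
        obtain rfl : i = j + 1 := by omega
        apply hT
        apply lastTime_eq_of_pos_eq (hD.time_nonneg hj)
        rw [hD.pos_time hj, hD.pos_time hj, heq]
      have h1 := live_succ_subset j hs
      have h2 := live_succ_subset j hs'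
      have := Finset.mem_inter.2 ⟨ih (by omega) h1 h2
        ((hD.interacted_iff (by omega) h1 h2).2 ⟨i, hij, heq⟩), hs'⟩
      rw [Finset.mem_filter]
      exact ⟨this, this, fun h => h rfl⟩

/-- Two classes with a common wave coincide. -/
theorem IsRegular.part_eq (hD : IsRegular D) {j : ℕ} (hj : j ≤ D.J) {s s' p q r : ℕ}
    (hp : r ∈ D.part j s s' p) (hq : r ∈ D.part j s s' q) :
    D.part j s s' p = D.part j s s' q := by
  classical
  have joined : ∀ j, ∀ H : Finset ℕ, r ∈ H.filter (fun x => p ∈ H ∧ D.Joined j p x) →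
      r ∈ H.filter (fun x => q ∈ H ∧ D.Joined j q x) →
      H.filter (fun x => p ∈ H ∧ D.Joined j p x) = H.filter (fun x => q ∈ H ∧ D.Joined j q x) := by
    intro j H h1 h2
    rw [Finset.mem_filter] at h1 h2
    obtain ⟨-, hpH, hp1, hp2⟩ := h1
    obtain ⟨-, hqH, hq1, hq2⟩ := h2
    apply Finset.filter_congr
    intro x _
    simp only [hpH, hqH, true_and, Joined, hp1, hp2, hq1, hq2]
  induction j with
  | zero =>
    rw [part] at hp hq ⊢
    rw [part]
    exact joined 0 _ hp hq
  | succ j ih =>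
    rw [part] at hp hq ⊢
    rw [part]
    split_ifs at hp hq ⊢ with hT
    · exact joined _ _ hp hq
    · rw [Finset.mem_filter, Finset.mem_inter] at hp hq
      have hpq := ih (by omega) hp.1.1 hq.1.1
      rw [hpq] at hp ⊢
      set K := D.part j s s' q ∩ D.live (j + 1)
      obtain ⟨-, hpK, hpr⟩ := hp
      obtain ⟨-, hqK, hqr⟩ := hq
      obtain ⟨-, -, i, hi, heq⟩ := mem_part (Finset.mem_inter.1 hpK).1
      -- Waves of one class once shared a position, so one effective flux serves both; not being
      -- divided is then equality of speeds, which is transitive.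
      have hmax := hD.maxHom_eq (i := i) (by omega) hj (Finset.mem_inter.1 hqK).2
        (Finset.mem_inter.1 hpK).2 heq
      apply Finset.filter_congr
      intro x _
      simp only [hpK, hqK, true_and, Divides, not_not, hmax] at hpr hqr ⊢
      rw [hpr, hqr]

theorem IsRegular.size_nonneg (hD : IsRegular D) (I : Finset ℕ) : 0 ≤ D.size I :=
  mul_nonneg hD.eps_pos.le (Nat.cast_nonneg _)

theorem IsRegular.transMass_nonneg (hD : IsRegular D) (j s s' p p' : ℕ) :
    0 ≤ D.transMass j s s' p p' :=
  Finset.sum_nonneg fun K _ => hD.size_nonneg K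

/-- The classes in the sum are disjoint and contained in the set of waves at the collision point. -/
theorem IsRegular.transMass_le (hD : IsRegular D) {j : ℕ} (hj : j ≤ D.J) (s s' p p' : ℕ) :
    D.transMass j s s' p p' ≤ D.size (D.wavesAtPoint (j + 1)) := by
  classical
  simp only [transMass, size]
  rw [← Finset.mul_sum]
  apply mul_le_mul_of_nonneg_left _ hD.eps_pos.le
  rw [← Nat.cast_sum, Nat.cast_le, ← Finset.card_biUnion]
  · apply Finset.card_le_card
    intro x hx
    obtain ⟨K, hK, hxK⟩ := Finset.mem_biUnion.1 hx
    exact (Finset.mem_filter.1 hK).2.2.2 hxK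
  · intro K hK L hL hne
    change Disjoint K L
    rw [Finset.disjoint_left]
    intro x hxK hxL
    obtain ⟨a, -, rfl⟩ := Finset.mem_image.1 (Finset.mem_filter.1 hK).1
    obtain ⟨b, -, rfl⟩ := Finset.mem_image.1 (Finset.mem_filter.1 hL).1
    exact hne (hD.part_eq hj hxK hxL)

/-- A class of nonzero size has an element `q`. By `Precedes` it either comes after `p` or shares
the class of `p`, which then lies at the collision point; similarly for `p'`. -/
theorem exists_of_transMass_ne_zero {j s s' p p' : ℕ} (hp : p ∈ D.part j s s' p)
    (hp' : p' ∈ D.part j s s' p') (h : D.transMass j s s' p p' ≠ 0) :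
    ∃ q ∈ D.wavesAtPoint (j + 1), (p ∈ D.wavesAtPoint (j + 1) ∨ p < q) ∧
      (p' ∈ D.wavesAtPoint (j + 1) ∨ q < p') := by
  classical
  obtain ⟨K, hK, hne⟩ := Finset.exists_ne_zero_of_sum_ne_zero h
  rw [Finset.mem_filter] at hK
  obtain ⟨-, h1, h2, h3⟩ := hK
  have hKne : K.Nonempty := by
    rw [Finset.nonempty_iff_ne_empty]
    rintro rfl
    simp [size] at hne
  obtain ⟨q, hq⟩ := hKne
  refine ⟨q, h3 hq, ?_, ?_⟩
  · rcases h1 with h1 | h1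
    · exact Or.inr (h1 p hp q hq)
    · exact Or.inl (h3 (h1 ▸ hp))
  · rcases h2 with h2 | h2
    · exact Or.inr (h2 q hq p' hp')
    · exact Or.inl (h3 (h2 ▸ hp'))


/-! ### Transversal interactions -/

theorem mem_wavesAtPoint {j s : ℕ} :
    s ∈ D.wavesAtPoint j ↔ s ∈ D.live j ∧ D.loc j s = D.point j := by
  classical
  rw [wavesAtPoint, Finset.mem_filter]
  constructor
  · rintro ⟨h1, h2⟩
    refine ⟨mem_live.2 ⟨h1, by rw [h2]; exact WithTop.coe_ne_top⟩, ?_⟩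
    rw [loc, h2]
    rfl
  · rintro ⟨h1, h2⟩
    exact ⟨(mem_live.1 h1).1, by rw [node_eq_loc h1, h2]⟩

/-- The waves involved in a transversal interaction were joined before. -/
theorem IsRegular.joined_of_transversal (hD : IsRegular D) {j : ℕ} (hj : j < D.J)
    (htr : D.IsTransversal (j + 1)) {s t : ℕ} (hs : s ∈ D.wavesAtPoint (j + 1))
    (ht : t ∈ D.wavesAtPoint (j + 1)) : D.Joined j s t := by
  have h := hD.traced hj.le
  obtain ⟨⟨y, hy1, hy2⟩, -⟩ := htr
  rw [mem_wavesAtPoint] at hs ht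
  have hs' := live_succ_subset j hs.1
  have ht' := live_succ_subset j ht.1
  rw [loc_succ hs.1] at hs
  rw [loc_succ ht.1] at ht
  -- One of the two fronts is of the first family, so both waves sit on the other.
  obtain ⟨a, b, -, hab⟩ := Set.ncard_eq_two.1 (hD.collisions.binary j hj)
  have m1 : Front.first y ∈ ({a, b} : Set Front) := by rw [← hab]; exact ⟨hy1, hy2⟩
  have m2 : Front.second (D.loc j s) (D.speed j s) ∈ ({a, b} : Set Front) := by
    rw [← hab]; exact ⟨h.front_mem hD hs', hs.2⟩
  have m3 : Front.second (D.loc j t) (D.speed j t) ∈ ({a, b} : Set Front) := by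
    rw [← hab]; exact ⟨h.front_mem hD ht', ht.2⟩
  have heq : Front.second (D.loc j s) (D.speed j s) = Front.second (D.loc j t) (D.speed j t) := by
    rcases m1 with m1 | m1 <;> rcases m2 with m2 | m2 <;> rcases m3 with m3 | m3 <;>
      first
        | exact m2.trans m3.symm
        | exact absurd (m1.trans m2.symm) (by simp)
        | exact absurd (m1.trans m3.symm) (by simp)
  rw [Front.second.injEq] at heq
  exact ⟨by rw [node_eq_loc hs', node_eq_loc ht', heq.1], heq.2⟩

theorem supNorm_nonneg (g : ℝ → ℝ → ℝ) : 0 ≤ supNorm g :=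
  Real.iSup_nonneg fun _ => abs_nonneg _

theorem firstStrength_nonneg (j : ℕ) : 0 ≤ D.firstStrength j := abs_nonneg _

theorem IsRegular.excess_nonneg (hD : IsRegular D) (j s s' p p' : ℕ) :
    0 ≤ D.excess j s s' p p' := by
  induction j with
  | zero => exact le_rfl
  | succ j ih =>
    rw [excess]
    split_ifs
    · exact le_rfl
    · have h1 := supNorm_nonneg (dwwv D.f)
      have h2 := firstStrength_nonneg (D := D) (j + 1)
      have h3 := hD.transMass_nonneg j s s' p p'
      positivity
    · exact ih

theorem IsRegular.weight_nonneg (hD : IsRegular D) (j s s' : ℕ) : 0 ≤ D.weight j s s' := by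
  rw [weight]
  split_ifs
  · exact le_rfl
  · exact div_nonneg (hD.excess_nonneg _ _ _ _ _) (abs_nonneg _)
  · exact supNorm_nonneg _

theorem IsRegular.interacted_of_joined (hD : IsRegular D) {j : ℕ} (hj : j ≤ D.J) {s s' : ℕ}
    (h : D.Joined j s s') : D.Interacted j s s' :=
  ⟨D.time j, hD.time_nonneg hj, le_rfl, by rw [hD.pos_time hj, hD.pos_time hj, h.1]⟩

theorem IsRegular.interacted_succ (hD : IsRegular D) {j : ℕ} (hj : j < D.J) {s s' : ℕ}
    (h : D.Interacted j s s') : D.Interacted (j + 1) s s' := by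
  obtain ⟨τ, h0, h1, h2⟩ := h
  exact ⟨τ, h0, h1.trans (hD.collisions.time_lt j hj).le, h2⟩

open Classical in
/-- The live waves to the left of the interaction. -/
noncomputable def leftWaves (D : Data) (j : ℕ) : Finset ℕ :=
  (D.live j).filter fun s => ∀ q ∈ D.wavesAtPoint j, s < q

open Classical in
/-- The live waves to the right of the interaction. -/
noncomputable def rightWaves (D : Data) (j : ℕ) : Finset ℕ :=
  (D.live j).filter fun s => ∀ q ∈ D.wavesAtPoint j, q < s

/-- Ordered positions make the waves at the point consecutive among live waves, so one comparison
decides the side. -/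
theorem IsRegular.lt_of_not_mem (hD : IsRegular D) {j : ℕ} (hj : j ≤ D.J) {s q : ℕ}
    (hs : s ∈ D.live j) (hsn : s ∉ D.wavesAtPoint j) (hq : q ∈ D.wavesAtPoint j) :
    (s < q → s ∈ D.leftWaves j) ∧ (q < s → s ∈ D.rightWaves j) := by
  classical
  have h := hD.traced hj
  have hq' := mem_wavesAtPoint.1 hq
  rw [mem_wavesAtPoint, not_and] at hsn
  constructor
  · refine fun hlt => Finset.mem_filter.2 ⟨hs, fun r hr => ?_⟩
    rw [mem_wavesAtPoint] at hr
    by_contra hcon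
    have h1 := h.mono s hs q hq'.1 hlt.le
    have h2 := h.mono r hr.1 s hs (by omega)
    exact hsn hs (le_antisymm (hq'.2 ▸ h1) (hr.2 ▸ h2))
  · refine fun hlt => Finset.mem_filter.2 ⟨hs, fun r hr => ?_⟩
    rw [mem_wavesAtPoint] at hr
    by_contra hcon
    have h1 := h.mono q hq'.1 s hs hlt.le
    have h2 := h.mono s hs r hr.1 (by omega)
    exact hsn hs (le_antisymm (hr.2 ▸ h2) (hq'.2 ▸ h1))

open Classical in
/-- Growth of the weight of a pair in a transversal interaction. -/
theorem IsRegular.weight_succ_le (hD : IsRegular D) {j : ℕ} (hj : j < D.J)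
    (htr : D.IsTransversal (j + 1)) {s s' : ℕ} (hs : s ∈ D.live (j + 1))
    (hs' : s' ∈ D.live (j + 1)) (hlt : s < s') :
    D.weight (j + 1) s s' - D.weight j s s' ≤ 0 ∨
      (((s ∈ D.wavesAtPoint (j + 1) ∧ s' ∈ D.rightWaves (j + 1)) ∨
        (s ∈ D.leftWaves (j + 1) ∧ s' ∈ D.wavesAtPoint (j + 1)) ∨
        (s ∈ D.leftWaves (j + 1) ∧ s' ∈ D.rightWaves (j + 1))) ∧
      D.weight (j + 1) s s' - D.weight j s s' ≤
        2 * supNorm (dwwv D.f) * D.firstStrength (j + 1) * (D.wavesAtPoint (j + 1)).card *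
          (1 / ((D.live (j + 1)).filter fun q => s ≤ q ∧ q ≤ s').card)) := by
  have hL := supNorm_nonneg (dwwv D.f)
  have hv := firstStrength_nonneg (D := D) (j + 1)
  have hw := hD.weight_nonneg j s s'
  by_cases hjn : D.Joined (j + 1) s s'
  · left
    rw [weight, if_pos hjn]
    linarith
  by_cases hint : D.Interacted (j + 1) s s'
  swap
  · have h1 : ¬ D.Interacted j s s' := fun h => hint (hD.interacted_succ hj h)
    have h2 : ¬ D.Joined j s s' := fun h => h1 (hD.interacted_of_joined hj.le h)
    left
    rw [weight, if_neg hjn, if_neg hint, weight, if_neg h2, if_neg h1, sub_self]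
  by_cases hres : D.Joined j s s' ∨ ¬ D.Interacted j s s'
  · left
    rw [weight, if_neg hjn, if_pos hint, excess, if_pos hres, zero_div]
    linarith
  have hres' := hres
  push Not at hres'
  obtain ⟨hnj, hij⟩ := hres'
  have hsj := live_succ_subset j hs
  have hsj' := live_succ_subset j hs'
  -- Right states do not depend on time, so both quotients have the same denominator and only the
  -- increment remains.
  rw [weight, if_neg hjn, if_pos hint, excess, if_neg hres, if_pos htr, weight, if_neg hnj,
    if_pos hij, ← sub_div, add_sub_cancel_left]
  by_cases hzero : D.transMass j s s' s s' = 0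
  · left
    rw [hzero, mul_zero, zero_div]
  obtain ⟨q, hq, h1, h2⟩ := exists_of_transMass_ne_zero (part_self_left s' hsj)
    (hD.part_self_right hj.le hsj hsj' hij) hzero
  have hboth : ¬ (s ∈ D.wavesAtPoint (j + 1) ∧ s' ∈ D.wavesAtPoint (j + 1)) :=
    fun h => hnj (hD.joined_of_transversal hj htr h.1 h.2)
  have hcond : (s ∈ D.wavesAtPoint (j + 1) ∧ s' ∈ D.rightWaves (j + 1)) ∨
        (s ∈ D.leftWaves (j + 1) ∧ s' ∈ D.wavesAtPoint (j + 1)) ∨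
        (s ∈ D.leftWaves (j + 1) ∧ s' ∈ D.rightWaves (j + 1)) := by
    by_cases hsA : s ∈ D.wavesAtPoint (j + 1)
    · have hn : s' ∉ D.wavesAtPoint (j + 1) := fun h => hboth ⟨hsA, h⟩
      exact Or.inl ⟨hsA, (hD.lt_of_not_mem hj hs' hn hq).2 (h2.resolve_left hn)⟩
    · have hsX := (hD.lt_of_not_mem hj hs hsA hq).1 (h1.resolve_left hsA)
      by_cases hn : s' ∈ D.wavesAtPoint (j + 1)
      · exact Or.inr (Or.inl ⟨hsX, hn⟩)
      · exact Or.inr (Or.inr ⟨hsX, (hD.lt_of_not_mem hj hs' hn hq).2 (h2.resolve_left hn)⟩)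
  refine Or.inr ⟨hcond, ?_⟩
  rw [hD.abs_hatw_sub hj hs hs' hlt hint]
  have htm := hD.transMass_le hj.le s s' s s'
  have hcard : (0 : ℝ) < ((D.live (j + 1)).filter fun q => s ≤ q ∧ q ≤ s').card := by
    rw [Nat.cast_pos, Finset.card_pos]
    exact ⟨s, Finset.mem_filter.2 ⟨hs, le_rfl, hlt.le⟩⟩
  have hε := hD.eps_pos
  rw [div_le_iff₀ (mul_pos hε hcard)]
  calc _ ≤ 2 * supNorm (dwwv D.f) * D.firstStrength (j + 1) *
        D.size (D.wavesAtPoint (j + 1)) := by gcongr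
    _ = _ := by
      rw [size]
      field_simp

/-! ### Summation over pairs and over collisions -/

theorem waves_card : (D.waves.card : ℝ) = ⌊totVar D.w₀ / D.ε⌋₊ := by
  rw [waves, Nat.card_Icc, Nat.add_sub_cancel]

theorem IsRegular.eps_mul_card_waves_le (hD : IsRegular D) :
    D.ε * D.waves.card ≤ totVar D.w₀ := by
  rw [waves_card]
  have h := Nat.floor_le (div_nonneg (show 0 ≤ totVar D.w₀ from ENNReal.toReal_nonneg)
    hD.eps_pos.le)
  rwa [le_div_iff₀ hD.eps_pos, mul_comm] at h

theorem sum_sum_inv_waves_le {V X Y : Finset ℕ} (hV : V ⊆ D.waves) (hX : X ⊆ V) (hY : Y ⊆ V)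
    (hlt : ∀ s ∈ X, ∀ t ∈ Y, s < t) :
    ∑ s ∈ X, ∑ t ∈ Y, (1 : ℝ) / (V.filter fun q => s ≤ q ∧ q ≤ t).card ≤
      D.waves.card * Real.log 2 := by
  refine (sum_sum_inv_card_le hX hY hlt).trans ?_
  apply mul_le_mul_of_nonneg_right _ (Real.log_nonneg (by norm_num))
  have hdisj : Disjoint X Y := by
    rw [Finset.disjoint_left]
    intro q h1 h2
    exact lt_irrefl _ (hlt q h1 q h2)
  have := Finset.card_le_card ((Finset.union_subset hX hY).trans hV)
  rw [Finset.card_union_of_disjoint hdisj] at this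
  exact_mod_cast this

/-- Growth of the functional in a transversal interaction. -/
theorem IsRegular.Q_succ_le (hD : IsRegular D) {j : ℕ} (hj : j < D.J)
    (htr : D.IsTransversal (j + 1)) :
    D.Q (j + 1) - D.Q j ≤
      6 * Real.log 2 * supNorm (dwwv D.f) * D.firstStrength (j + 1) *
        D.size (D.wavesAtPoint (j + 1)) * totVar D.w₀ := by
  classical
  have hε := hD.eps_pos
  have hL := supNorm_nonneg (dwwv D.f)
  have hv := firstStrength_nonneg (D := D) (j + 1)
  have hlog : 0 ≤ Real.log 2 := Real.log_nonneg (by norm_num)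
  set V := D.live (j + 1)
  set A := D.wavesAtPoint (j + 1) with hAdef
  set X := D.leftWaves (j + 1) with hXdef
  set Y := D.rightWaves (j + 1) with hYdef
  have hA : A ⊆ V := fun s hs => (mem_wavesAtPoint.1 hs).1
  have hX : X ⊆ V := Finset.filter_subset _ _
  have hY : Y ⊆ V := Finset.filter_subset _ _
  have hXA : ∀ s ∈ X, ∀ t ∈ A, s < t := fun s hs => (Finset.mem_filter.1 hs).2
  have hAY : ∀ s ∈ A, ∀ t ∈ Y, s < t := fun s hs t ht => (Finset.mem_filter.1 ht).2 s hs
  have hVw : V ⊆ D.waves := Finset.filter_subset _ _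
  have hVj : V ⊆ D.live j := live_succ_subset j
  set c : ℝ := 2 * supNorm (dwwv D.f) * D.firstStrength (j + 1) * A.card with hc
  have hc0 : 0 ≤ c := by positivity
  set R : ℕ → ℕ → ℝ := fun s t => 1 / (V.filter fun q => s ≤ q ∧ q ≤ t).card with hR
  have hR0 : ∀ s t, 0 ≤ R s t := fun s t => by simp only [hR]; positivity
  -- Weights are nonnegative, so discarding pairs of waves no longer live can only lower the earlier
  -- value.
  have hQj : ∑ s ∈ V, ∑ t ∈ V with s < t, D.weight j s t * D.ε * D.ε ≤ D.Q j := by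
    have h0 : ∀ s t, 0 ≤ D.weight j s t * D.ε * D.ε := fun s t =>
      mul_nonneg (mul_nonneg (hD.weight_nonneg j s t) hε.le) hε.le
    calc _ ≤ ∑ s ∈ V, ∑ t ∈ D.live j with s < t, D.weight j s t * D.ε * D.ε := by
          apply Finset.sum_le_sum
          intro s _
          exact Finset.sum_le_sum_of_subset_of_nonneg (Finset.filter_subset_filter _ hVj)
            fun t _ _ => h0 s t
      _ ≤ ∑ s ∈ D.live j, ∑ t ∈ D.live j with s < t, D.weight j s t * D.ε * D.ε :=
          Finset.sum_le_sum_of_subset_of_nonneg hVj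
            fun s _ _ => Finset.sum_nonneg fun t _ => h0 s t
      _ = D.Q j := rfl
  have hind : ∀ X' ⊆ V, ∀ Y' ⊆ V, (∀ s ∈ X', ∀ t ∈ Y', s < t) →
      ∑ s ∈ V, ∑ t ∈ V with s < t, (if s ∈ X' ∧ t ∈ Y' then R s t else 0) ≤
        D.waves.card * Real.log 2 := by
    intro X' hX' Y' hY' hlt
    refine le_trans (le_of_eq ?_) (sum_sum_inv_waves_le hVw hX' hY' hlt)
    rw [← Finset.sum_subset hX']
    · apply Finset.sum_congr rfl
      intro s hs
      rw [← Finset.sum_filter]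
      apply Finset.sum_congr _ (fun _ _ => rfl)
      ext t
      simp only [Finset.mem_filter]
      constructor
      · rintro ⟨-, -, h⟩
        exact h
      · intro h
        exact ⟨⟨hY' h, hlt s hs t h⟩, hs, h⟩
    · intro s _ hs
      apply Finset.sum_eq_zero
      intro t _
      rw [if_neg (fun h => hs h.1)]
  have hpair : ∀ s ∈ V, ∀ t ∈ V, s < t → D.weight (j + 1) s t - D.weight j s t ≤
      c * ((if s ∈ A ∧ t ∈ Y then R s t else 0) + (if s ∈ X ∧ t ∈ A then R s t else 0) +
        (if s ∈ X ∧ t ∈ Y then R s t else 0)) := by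
    intro s hs t ht hst
    have h1 : ∀ (p : Prop) [Decidable p], 0 ≤ if p then R s t else 0 := fun p _ => by
      split_ifs
      · exact hR0 s t
      · exact le_rfl
    have i1 := h1 (s ∈ A ∧ t ∈ Y)
    have i2 := h1 (s ∈ X ∧ t ∈ A)
    have i3 := h1 (s ∈ X ∧ t ∈ Y)
    rcases hD.weight_succ_le hj htr hs ht hst with h | ⟨h, hle⟩
    · exact h.trans (mul_nonneg hc0 (add_nonneg (add_nonneg i1 i2) i3))
    · refine hle.trans (mul_le_mul_of_nonneg_left ?_ hc0)
      change R s t ≤ _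
      rcases h with h | h | h
      · have e : (if s ∈ A ∧ t ∈ Y then R s t else 0) = R s t := if_pos h
        linarith
      · have e : (if s ∈ X ∧ t ∈ A then R s t else 0) = R s t := if_pos h
        linarith
      · have e : (if s ∈ X ∧ t ∈ Y then R s t else 0) = R s t := if_pos h
        linarith
  have hXY : ∀ s ∈ X, ∀ t ∈ Y, A.Nonempty → s < t := fun s hs t ht ⟨q, hq⟩ =>
    (hXA s hs q hq).trans (hAY q hq t ht)
  -- The factor 3 counts the rectangles `A × Y`, `X × A` and `X × Y`.
  have hmain : D.Q (j + 1) - D.Q j ≤ c * (3 * (D.waves.card * Real.log 2)) * (D.ε * D.ε) := by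
    calc D.Q (j + 1) - D.Q j ≤
        D.Q (j + 1) - ∑ s ∈ V, ∑ t ∈ V with s < t, D.weight j s t * D.ε * D.ε := by linarith
      _ = ∑ s ∈ V, ∑ t ∈ V with s < t,
          (D.weight (j + 1) s t - D.weight j s t) * (D.ε * D.ε) := by
        rw [Q, ← Finset.sum_sub_distrib]
        apply Finset.sum_congr rfl
        intro s _
        rw [← Finset.sum_sub_distrib]
        apply Finset.sum_congr rfl
        intro t _
        ring
      _ ≤ ∑ s ∈ V, ∑ t ∈ V with s < t,
          (c * ((if s ∈ A ∧ t ∈ Y then R s t else 0) + (if s ∈ X ∧ t ∈ A then R s t else 0) +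
            (if s ∈ X ∧ t ∈ Y then R s t else 0))) * (D.ε * D.ε) := by
        apply Finset.sum_le_sum
        intro s hs
        apply Finset.sum_le_sum
        intro t ht
        rw [Finset.mem_filter] at ht
        exact mul_le_mul_of_nonneg_right (hpair s hs t ht.1 ht.2) (by positivity)
      _ = c * (∑ s ∈ V, ∑ t ∈ V with s < t, (if s ∈ A ∧ t ∈ Y then R s t else 0) +
          ∑ s ∈ V, ∑ t ∈ V with s < t, (if s ∈ X ∧ t ∈ A then R s t else 0) +
          ∑ s ∈ V, ∑ t ∈ V with s < t, (if s ∈ X ∧ t ∈ Y then R s t else 0)) *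
            (D.ε * D.ε) := by
        simp only [← Finset.sum_mul, ← Finset.mul_sum, Finset.sum_add_distrib]
      _ ≤ _ := by
        apply mul_le_mul_of_nonneg_right _ (by positivity)
        -- The ordering of `X` before `Y` comes from a wave of `A`; if there is none, the constant
        -- `c` vanishes.
        rcases A.eq_empty_or_nonempty with he | hne
        · have : c = 0 := by rw [hc, he]; simp
          rw [this, zero_mul, zero_mul]
        · apply mul_le_mul_of_nonneg_left _ hc0
          have i1 := hind A hA Y hY hAY
          have i2 := hind X hX A hA hXA
          have i3 := hind X hX Y hY (fun s hs t ht => hXY s hs t ht hne)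
          linarith
  refine hmain.trans ?_
  have hN := hD.eps_mul_card_waves_le
  have hc' : c * (3 * (D.waves.card * Real.log 2)) * (D.ε * D.ε) =
      6 * Real.log 2 * supNorm (dwwv D.f) * D.firstStrength (j + 1) * D.size A *
        (D.ε * D.waves.card) := by
    rw [hc, size]
    ring
  rw [hc']
  have hsz := hD.size_nonneg A
  gcongr

/-- A wave crosses every front of the first family at most once. -/
theorem IsRegular.sum_firstStrength_le (hD : IsRegular D) (s : ℕ) :
    ∑ j ∈ Finset.Icc 1 D.J with s ∈ D.wavesAtPoint j, D.firstStrength j ≤ totVar D.v₀ := by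
  -- Since `x + t` strictly increases along the wave, its collisions see distinct points of `v₀`.
  have hinj : ∀ i j, i < j → j ≤ D.J → s ∈ D.wavesAtPoint i → s ∈ D.wavesAtPoint j →
      D.point i + D.time i < D.point j + D.time j := by
    intro i j hij hj hi hj'
    rw [mem_wavesAtPoint] at hi hj'
    rw [← hi.2, ← hj'.2]
    exact hD.loc_add_time_lt hij hj hj'.1
  refine le_trans (le_of_eq ?_) (sum_jump_le_totVar hD.step_v₀.bounded_variation
    (((Finset.Icc 1 D.J).filter fun j => s ∈ D.wavesAtPoint j).image
      fun j => D.point j + D.time j))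
  rw [Finset.sum_image]
  · rfl
  · intro i hi j hj hij
    simp only [Finset.coe_filter, mem_ofPred_eq, Finset.mem_Icc] at hi hj hij
    rcases lt_trichotomy i j with h | h | h
    · exact absurd hij (hinj i j h hj.1.2 hi.2 hj.2).ne
    · exact h
    · exact absurd hij (hinj j i h hi.1.2 hj.2 hi.2).ne'

/-- Splitting each size into single waves and exchanging the sums, every wave contributes `ε` times
at most the variation of `v₀`. -/
theorem IsRegular.sum_firstStrength_mul_size_le (hD : IsRegular D) :
    ∑ j ∈ D.transversalIndices, D.firstStrength j * D.size (D.wavesAtPoint j) ≤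
      totVar D.w₀ * totVar D.v₀ := by
  classical
  have hε := hD.eps_pos
  have hv : 0 ≤ totVar D.v₀ := ENNReal.toReal_nonneg
  calc ∑ j ∈ D.transversalIndices, D.firstStrength j * D.size (D.wavesAtPoint j)
      ≤ ∑ j ∈ Finset.Icc 1 D.J, D.firstStrength j * D.size (D.wavesAtPoint j) :=
        Finset.sum_le_sum_of_subset_of_nonneg (Finset.filter_subset _ _)
          fun j _ _ => mul_nonneg (firstStrength_nonneg j) (hD.size_nonneg _)
    _ = ∑ j ∈ Finset.Icc 1 D.J, ∑ s ∈ D.waves with s ∈ D.wavesAtPoint j,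
          D.ε * D.firstStrength j := by
        apply Finset.sum_congr rfl
        intro j _
        have : D.waves.filter (fun s => s ∈ D.wavesAtPoint j) = D.wavesAtPoint j := by
          ext s
          rw [Finset.mem_filter]
          exact ⟨fun h => h.2, fun h => ⟨(Finset.mem_filter.1 h).1, h⟩⟩
        rw [this, Finset.sum_const, size, nsmul_eq_mul]
        ring
    _ = ∑ s ∈ D.waves, ∑ j ∈ Finset.Icc 1 D.J with s ∈ D.wavesAtPoint j,
          D.ε * D.firstStrength j := by
        simp only [Finset.sum_filter]
        rw [Finset.sum_comm]
    _ ≤ ∑ s ∈ D.waves, D.ε * totVar D.v₀ := by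
        apply Finset.sum_le_sum
        intro s _
        rw [← Finset.mul_sum]
        exact mul_le_mul_of_nonneg_left (hD.sum_firstStrength_le s) hε.le
    _ = D.ε * D.waves.card * totVar D.v₀ := by
        rw [Finset.sum_const, nsmul_eq_mul]
        ring
    _ ≤ _ := mul_le_mul_of_nonneg_right hD.eps_mul_card_waves_le hv

theorem IsRegular.Q_sub_le (hD : IsRegular D) {j : ℕ} (hj : j ∈ D.transversalIndices) :
    D.Q j - D.Q (j - 1) ≤
      6 * Real.log 2 * supNorm (dwwv D.f) * D.firstStrength j *
        D.size (D.wavesAtPoint j) * totVar D.w₀ := by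
  classical
  rw [transversalIndices, Finset.mem_filter, Finset.mem_Icc] at hj
  obtain ⟨⟨h1, h2⟩, h3⟩ := hj
  obtain ⟨i, rfl⟩ : ∃ i, j = i + 1 := ⟨j - 1, by omega⟩
  exact hD.Q_succ_le h2 h3

theorem IsRegular.sum_Q_sub_le (hD : IsRegular D) :
    ∑ j ∈ D.transversalIndices, (D.Q j - D.Q (j - 1)) ≤
      6 * Real.log 2 * supNorm (dwwv D.f) * totVar D.w₀ ^ 2 * totVar D.v₀ := by
  have hL := supNorm_nonneg (dwwv D.f)
  have hlog : 0 ≤ Real.log 2 := Real.log_nonneg (by norm_num)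
  have hw : 0 ≤ totVar D.w₀ := ENNReal.toReal_nonneg
  calc _ ≤ ∑ j ∈ D.transversalIndices, (6 * Real.log 2 * supNorm (dwwv D.f) * totVar D.w₀) *
        (D.firstStrength j * D.size (D.wavesAtPoint j)) := by
        apply Finset.sum_le_sum
        intro j hj
        refine (hD.Q_sub_le hj).trans (le_of_eq ?_)
        ring
    _ = (6 * Real.log 2 * supNorm (dwwv D.f) * totVar D.w₀) *
        ∑ j ∈ D.transversalIndices, D.firstStrength j * D.size (D.wavesAtPoint j) := by
        rw [Finset.mul_sum]
    _ ≤ (6 * Real.log 2 * supNorm (dwwv D.f) * totVar D.w₀) *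
        (totVar D.w₀ * totVar D.v₀) := by
        gcongr
        exact hD.sum_firstStrength_mul_size_le
    _ = _ := by ring

end Data
end Wavefront

theorem mainTheorem3 (D : Wavefront.Data)
    (hε : 0 < D.ε)
    (hf : Wavefront.IsAdmissibleFlux D.f)
    (hw : Wavefront.IsGridStep D.ε D.w₀)
    (hv : Wavefront.IsGridStep D.ε D.v₀)
    (hhyp : ∀ w ∈ convexHull ℝ (Set.range D.w₀), ∀ v ∈ Set.range D.v₀,
      -1 < Wavefront.dw D.f w v)
    (hcol : D.IsCollisionSequence) :
    (∀ j ∈ D.transversalIndices,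
      D.Q j - D.Q (j - 1) ≤
        6 * Real.log 2 * Wavefront.supNorm (Wavefront.dwwv D.f) * D.firstStrength j *
          D.size (D.wavesAtPoint j) * Wavefront.totVar D.w₀) ∧
    ∑ j ∈ D.transversalIndices, (D.Q j - D.Q (j - 1)) ≤
      6 * Real.log 2 * Wavefront.supNorm (Wavefront.dwwv D.f) *
        Wavefront.totVar D.w₀ ^ 2 * Wavefront.totVar D.v₀ := by
  have hD : Wavefront.Data.IsRegular D := ⟨hε, hf, hw, hv, hhyp, hcol⟩
  exact ⟨fun j hj => hD.Q_sub_le hj, hD.sum_Q_sub_le⟩
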